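/- Let $q\in\mathbb C\setminus\{0,\pm1,\pm i\}$ and let $\mathcal A=\mathrm{Fun}_q(\mathrm{GL}(3,\mathbb C))$ be the Hopf algebra generated by $z^i{}_j$ ($1\le i,j\le 3$) and the inverse $\mathcal D^{-1}$ of the quantum determinant $\mathcal D=\sum_{\sigma\in S_3}(-q)^{\ell(\sigma)}z^1{}_{\sigma(1)}z^2{}_{\sigma(2)}z^3{}_{\sigma(3)}$, with relations $z^i{}_jz^i{}_k=q\,z^i{}_kz^i{}_j$ ($j<k$), $z^i{}_jz^k{}_j=q\,z^k{}_jz^i{}_j$ ($i<k$), $z^i{}_jz^k{}_l=z^k{}_lz^i{}_j$ ($i<k$, $j>l$), $z^i{}_jz^k{}_l=z^k{}_lz^i{}_j+(q-q^{-1})z^k{}_jz^i{}_l$ ($i<k$, $j<l$), and $\Delta(z^i{}_j)=z^i{}_k\otimes z^k{}_j$, $\varepsilon(z^i{}_j)=\delta^i_j$, antipode $S$ (repeated indices are summed). Let $$R=\sum_{i,j}q^{\delta_{ij}}e_{ii}\otimes e_{jj}+(q-q^{-1})\sum_{i>j}e_{ij}\otimes e_{ji},$$ and let $X^i{}_j{}^k{}_l$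 denote the coefficient of $e_{ij}\otimes e_{kl}$ in $X$. Consider bicovariant first order differential calculi $(\Gamma,\mathrm d)$ over $\mathcal A$ (with coactions $\Delta_{\mathcal L},\Delta_{\mathcal R}$) such that the nine differentials $\mathrm dz^i{}_j$ form a basis of $\Gamma$ as a left $\mathcal A$-module. Put $\theta^i{}_j=S(z^i{}_k)\,\mathrm dz^k{}_j$, $\mathrm{Tr}_q\theta=q^4\theta^1{}_1+q^2\theta^2{}_2+\theta^3{}_3$, $\lambda=q-q^{-1}$, and $$\sigma=\tfrac{(q^2-t)(t-1)}{q^4(q^2+1)(t-1)-q^2+t},\quad \beta=\tfrac{t(q^2-1)(t-1)}{q^4(q^2+1)(t-1)-q^2+t},\quad \hat\sigma=-\tfrac{(q^2t-1)(t-1)}{q^4(q^2t-1)+(q^2+1)(t-1)},\quad \hat\beta=-\tfrac{t(q^2-1)(t-1)}{q^4(q^2t-1)+(q^2+1)(t-1)}.$$ Call $t\neq0$ admissible for $\nu=1$ if $(q^6+q^4+1)t\ne q^6+q^4+q^2$, and for $\nu=2$ if $(q^6+q^2+1)t\neq q^4+q^2+1$. For admissible $t$, such a calculus is called $\Gamma_1(t)$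 if - $(\mathrm dz^i{}_j)z^i{}_j=(\frac t{q^2}+t-1)z^i{}_j\mathrm dz^i{}_j+\sigma z^i{}_jz^i{}_j\mathrm{Tr}_q\theta$; - $(\mathrm dz^i{}_j)z^k{}_l=\frac tq z^k{}_l\mathrm dz^i{}_j+(t-1)z^i{}_j\mathrm dz^k{}_l+\sigma z^i{}_jz^k{}_l\mathrm{Tr}_q\theta$ for ($i=k$, $j<l$) and for ($i<k$, $j=l$); - $(\mathrm dz^i{}_j)z^k{}_l=t z^k{}_l\mathrm dz^i{}_j+(t-1)z^i{}_j\mathrm dz^k{}_l+\sigma z^i{}_jz^k{}_l\mathrm{Tr}_q\theta-\beta(z^i{}_jz^k{}_l-q z^i{}_lz^k{}_j)\mathrm{Tr}_q\theta$ for $i<k$, $j<l$; - $(\mathrm dz^i{}_j)z^k{}_l=t z^k{}_l\mathrm dz^i{}_j+(t-1)z^i{}_j\mathrm dz^k{}_l+\sigma z^i{}_jz^k{}_l\mathrm{Tr}_q\theta-t\lambda z^k{}_j\mathrm dz^i{}_l+q\beta(z^i{}_lz^k{}_j-q z^i{}_jz^k{}_l)\mathrm{Tr}_q\theta$ for $i<k$,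 $j>l$; and $\Gamma_2(t)$ if - $(\mathrm dz^i{}_j)z^i{}_j=(tq^2+t-1)z^i{}_j\mathrm dz^i{}_j+\hat\sigma z^i{}_jz^i{}_j\mathrm{Tr}_q\theta$; - $(\mathrm dz^i{}_j)z^k{}_l=tq z^k{}_l\mathrm dz^i{}_j+(tq^2-1)z^i{}_j\mathrm dz^k{}_l+\hat\sigma z^i{}_jz^k{}_l\mathrm{Tr}_q\theta$ for ($i=k$, $j<l$) and for ($i<k$, $j=l$); - $(\mathrm dz^i{}_j)z^k{}_l=t z^k{}_l\mathrm dz^i{}_j+(t-1)z^i{}_j\mathrm dz^k{}_l+\hat\sigma z^i{}_jz^k{}_l\mathrm{Tr}_q\theta+t\lambda(z^i{}_l\mathrm dz^k{}_j+z^k{}_j\mathrm dz^i{}_l)+t\lambda^2z^i{}_j\mathrm dz^k{}_l-\frac1{q^2}\hat\beta(z^i{}_jz^k{}_l-q z^i{}_lz^k{}_j)\mathrm{Tr}_q\theta$ for $i<k$, $j<l$; - $(\mathrm dz^i{}_j)z^k{}_l=t z^k{}_l\mathrm dz^i{}_j+(t-1)z^i{}_j\mathrm dz^k{}_l+\hat\sigma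 z^i{}_jz^k{}_l\mathrm{Tr}_q\theta+t\lambda z^i{}_l\mathrm dz^k{}_j+\frac1q\hat\beta(z^i{}_lz^k{}_j-q z^i{}_jz^k{}_l)\mathrm{Tr}_q\theta$ for $i<k$, $j>l$. **Proposition.** Every such calculus is a $\Gamma_1(t)$ or a $\Gamma_2(t)$ with $t$ admissible, and for every admissible $t$ a calculus $\Gamma_\nu(t)$ exists. Moreover the matrix $U$ (rows $(i,j)$, columns $(k,l)$) given by $$U^i{}_j{}^k{}_l=\tfrac1{q-q^{-1}}\bigl(t\,(R^{-1})^i{}_a{}^k{}_b(R^{-1})^b{}_l{}^a{}_j-\delta^i_j\delta^k_l\bigr)\ (\nu=1),\qquad U^i{}_j{}^k{}_l=\tfrac1{q-q^{-1}}\bigl(t\,R^k{}_a{}^i{}_bR^b{}_j{}^a{}_l-\delta^i_j\delta^k_l\bigr)\ (\nu=2)$$ is invertible for admissible $t$, and in every $\Gamma_\nu(t)$ there is a basis $\omega_i{}^j$ of the space ${}_{inv}\Gamma$ of left-invariant 1-forms with $\theta^i{}_j=U^i{}_j{}^k{}_l\,\omega_k{}^l$ and $$\omega_i{}^jz^k{}_l=t\,z^k{}_d(R^{-1})^d{}_e{}^a{}_i(R^{-1})^j{}_b{}^e{}_l\,\omega_a{}^b\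 (\nu=1),\qquad \omega_i{}^jz^k{}_l=t\,z^k{}_dR^a{}_i{}^d{}_eR^e{}_l{}^j{}_b\,\omega_a{}^b\ (\nu=2).$$ Moreover each $\Gamma_\nu(t)$ arises in this basis from Jurčo's construction: for all nonzero $c^\pm$ with $t=c^- /c^+$ ($\nu=1$), resp. $t=c^+/c^-$ ($\nu=2$), there are families of functionals $\ell^{\pm i}{}_j$ on $\mathcal A$ with $\ell^{\pm i}{}_j(z^k{}_l)=(R^\pm)^i{}_j{}^k{}_l$, $\ell^{\pm i}{}_j(1)=\delta^i_j$, $\ell^{\pm i}{}_j(ab)=\ell^{\pm i}{}_k(a)\,\ell^{\pm k}{}_j(b)$, where $R^+=c^+PRP$, $R^-=c^-R^{-1}$ and $P$ is the flip, such that (upper signs for $\nu=1$, lower signs for $\nu=2$) for all $a\in\mathcal A$ $$\omega_i{}^ja=\bigl(f_i{}^{jk}{}_l*a\bigr)\omega_k{}^l,\qquad f_i{}^{jk}{}_l=(\ell^{\pm k}{}_i\circ S)*\ell^{\mp j}{}_l,\qquad \Delta_{\mathcal R}(\omega_k{}^l)=\omega_i{}^j\otimes z^i{}_kS(z^l{}_j),\qquad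 \mathrm da=\tfrac1{q-q^{-1}}\Bigl[\sum_i\omega_i{}^i,a\Bigr].$$ Here $f*a=(\mathrm{id}\otimes f)\Delta(a)$ and $f*g=(f\otimes g)\Delta$. -/

import Mathlib

open scoped TensorProduct RightActions

universe u

namespace QuantumGL3

/-- The commutation relations of the entries of a quantum `3 × 3` matrix over a `ℂ`-algebra:
`x i j` stands for the entry in row `i` and column `j`. -/
structure IsQMatrix {B : Type*} [Ring B] [Algebra ℂ B] (q : ℂ) (x : Fin 3 → Fin 3 → B) : Prop where
  row : ∀ i j k, j < k → x i j * x i k = q • (x i k * x i j)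
  col : ∀ i k j, i < k → x i j * x k j = q • (x k j * x i j)
  anti : ∀ i k j l, i < k → l < j → x i j * x k l = x k l * x i j
  diag : ∀ i k j l, i < k → j < l →
    x i j * x k l = x k l * x i j + (q - q⁻¹) • (x k j * x i l)

/-- The quantum determinant
`∑_σ (-q)^{ℓ(σ)} x_{1σ(1)} x_{2σ(2)} x_{3σ(3)}` of a `3 × 3` array. -/
noncomputable def qdet {B : Type*} [Ring B] [Algebra ℂ B] (q : ℂ) (x : Fin 3 → Fin 3 → B) : B :=
  x 0 0 * x 1 1 * x 2 2 + q ^ 2 • (x 0 1 * x 1 2 * x 2 0) + q ^ 2 • (x 0 2 * x 1 0 * x 2 1)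
    - q • (x 0 0 * x 1 2 * x 2 1) - q ^ 3 • (x 0 2 * x 1 1 * x 2 0) - q • (x 0 1 * x 1 0 * x 2 2)

/-- The quantum adjugate: `S(Z)` is the inverse determinant times this matrix. -/
noncomputable def qadj {B : Type*} [Ring B] [Algebra ℂ B] (q : ℂ) (x : Fin 3 → Fin 3 → B) :
    Fin 3 → Fin 3 → B :=
  ![![x 1 1 * x 2 2 - q • (x 1 2 * x 2 1),
      -(q⁻¹ • (x 0 1 * x 2 2)) + x 0 2 * x 2 1,
      q⁻¹ ^ 2 • (x 0 1 * x 1 2) - q⁻¹ • (x 0 2 * x 1 1)],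
    ![-(q • (x 1 0 * x 2 2)) + q ^ 2 • (x 1 2 * x 2 0),
      x 0 0 * x 2 2 - q • (x 0 2 * x 2 0),
      -(q⁻¹ • (x 0 0 * x 1 2)) + x 0 2 * x 1 0],
    ![q ^ 2 • (x 1 0 * x 2 1) - q ^ 3 • (x 1 1 * x 2 0),
      -(q • (x 0 0 * x 2 1)) + q ^ 2 • (x 0 1 * x 2 0),
      x 0 0 * x 1 1 - q • (x 0 1 * x 1 0)]]

/-- The `q`-epsilon tensor, `(-q)^{ℓ(σ)}` on permutations and `0` elsewhere. -/
noncomputable def qeps (q : ℂ) : Fin 3 → Fin 3 → Fin 3 → ℂ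
  | 0, 1, 2 => 1
  | 1, 2, 0 => q ^ 2
  | 2, 0, 1 => q ^ 2
  | 0, 2, 1 => -q
  | 2, 1, 0 => -q ^ 3
  | 1, 0, 2 => -q
  | _, _, _ => 0

theorem mul_eq_assoc {B : Type*} [Ring B] {a b c : B} (h : a * b = c) (w : B) : a * (b * w) = c * w := by
  rw [← mul_assoc, h]

set_option linter.unusedSimpArgs false in
set_option maxHeartbeats 4000000 in
theorem IsQMatrix.adj {B : Type*} [Ring B] [Algebra ℂ B] {q : ℂ} {x : Fin 3 → Fin 3 → B}
    (hx : IsQMatrix q x) (hq : q ≠ 0) :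
    (∀ i j, ∑ k, x i k * qadj q x k j = if i = j then qdet q x else 0) ∧
    (∀ i j, ∑ k, qadj q x i k * x k j = if i = j then qdet q x else 0) := by
  have r1 := hx.row 0 0 1 (by decide)
  have r2 := hx.row 0 0 2 (by decide)
  have r3 := hx.row 0 1 2 (by decide)
  have r4 := hx.row 1 0 1 (by decide)
  have r5 := hx.row 1 0 2 (by decide)
  have r6 := hx.row 1 1 2 (by decide)
  have r7 := hx.row 2 0 1 (by decide)
  have r8 := hx.row 2 0 2 (by decide)
  have r9 := hx.row 2 1 2 (by decide)
  have c1 := hx.col 0 1 0 (by decide)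
  have c2 := hx.col 0 2 0 (by decide)
  have c3 := hx.col 1 2 0 (by decide)
  have c4 := hx.col 0 1 1 (by decide)
  have c5 := hx.col 0 2 1 (by decide)
  have c6 := hx.col 1 2 1 (by decide)
  have c7 := hx.col 0 1 2 (by decide)
  have c8 := hx.col 0 2 2 (by decide)
  have c9 := hx.col 1 2 2 (by decide)
  have a1 := hx.anti 0 1 1 0 (by decide) (by decide)
  have a2 := hx.anti 0 1 2 0 (by decide) (by decide)
  have a3 := hx.anti 0 1 2 1 (by decide) (by decide)
  have a4 := hx.anti 0 2 1 0 (by decide) (by decide)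
  have a5 := hx.anti 0 2 2 0 (by decide) (by decide)
  have a6 := hx.anti 0 2 2 1 (by decide) (by decide)
  have a7 := hx.anti 1 2 1 0 (by decide) (by decide)
  have a8 := hx.anti 1 2 2 0 (by decide) (by decide)
  have a9 := hx.anti 1 2 2 1 (by decide) (by decide)
  have d1 := hx.diag 0 1 0 1 (by decide) (by decide)
  have d2 := hx.diag 0 1 0 2 (by decide) (by decide)
  have d3 := hx.diag 0 1 1 2 (by decide) (by decide)
  have d4 := hx.diag 0 2 0 1 (by decide) (by decide)
  have d5 := hx.diag 0 2 0 2 (by decide) (by decide)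
  have d6 := hx.diag 0 2 1 2 (by decide) (by decide)
  have d7 := hx.diag 1 2 0 1 (by decide) (by decide)
  have d8 := hx.diag 1 2 0 2 (by decide) (by decide)
  have d9 := hx.diag 1 2 1 2 (by decide) (by decide)
  constructor <;> intro i j <;> fin_cases i <;> fin_cases j <;>
    simp only [Fin.sum_univ_three, qadj, qdet, Fin.zero_eta, Fin.mk_one, Fin.reduceFinMk, Fin.isValue,
        Matrix.cons_val_zero, Matrix.cons_val_one, Matrix.cons_val, reduceIte, Fin.reduceEq,
        mul_assoc, mul_add, add_mul, mul_sub, sub_mul, mul_neg, neg_mul,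
        smul_mul_assoc, mul_smul_comm, zero_ne_one, one_ne_zero,
        r1, r2, r3, r4, r5, r6, r7, r8, r9, c1, c2, c3, c4, c5, c6, c7, c8, c9, a1, a2, a3, a4, a5, a6, a7, a8, a9, d1, d2, d3, d4, d5, d6, d7, d8, d9,
        mul_eq_assoc r1, mul_eq_assoc r2, mul_eq_assoc r3, mul_eq_assoc r4, mul_eq_assoc r5, mul_eq_assoc r6, mul_eq_assoc r7, mul_eq_assoc r8, mul_eq_assoc r9, mul_eq_assoc c1, mul_eq_assoc c2, mul_eq_assoc c3, mul_eq_assoc c4, mul_eq_assoc c5, mul_eq_assoc c6, mul_eq_assoc c7, mul_eq_assoc c8, mul_eq_assoc c9, mul_eq_assoc a1, mul_eq_assoc a2, mul_eq_assoc a3, mul_eq_assoc a4, mul_eq_assoc a5, mul_eq_assoc a6, mul_eq_assoc a7, mul_eq_assoc a8, mul_eq_assoc a9, mul_eq_assoc d1, mul_eq_assoc d2, mul_eq_assoc d3, mul_eq_assoc d4, mul_eq_assoc d5, mul_eq_assoc d6, mul_eq_assoc d7, mul_eq_assoc d8, mul_eq_assoc d9] <;>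
    match_scalars <;> field_simp <;> ring

theorem IsQMatrix.pair {B : Type*} [Ring B] [Algebra ℂ B] {q : ℂ} {x : Fin 3 → Fin 3 → B}
    (hx : IsQMatrix q x) (hq : q ≠ 0) {i j a b : Fin 3} (hij : i < j) (hab : a < b) :
    x j a * x i b - q • (x j b * x i a) = -q • (x i a * x j b - q • (x i b * x j a)) := by
  rw [hx.diag i j a b hij hab, hx.anti i j b a hij hab]
  match_scalars <;> field_simp <;> ring

theorem IsQMatrix.pair_self {B : Type*} [Ring B] [Algebra ℂ B] {q : ℂ} {x : Fin 3 → Fin 3 → B}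
    (hx : IsQMatrix q x) {i a b : Fin 3} (hab : a < b) :
    x i a * x i b - q • (x i b * x i a) = 0 := by
  rw [hx.row i a b hab, sub_self]

/-- The contraction of three rows of an array with the `q`-epsilon tensor. -/
noncomputable def qtri {B : Type*} [Ring B] [Algebra ℂ B] (q : ℂ) (x : Fin 3 → Fin 3 → B)
    (i j k : Fin 3) : B :=
  ∑ a, ∑ b, ∑ c, qeps q a b c • (x i a * x j b * x k c)

theorem qtri_left {B : Type*} [Ring B] [Algebra ℂ B] (q : ℂ) (x : Fin 3 → Fin 3 → B)
    (i j k : Fin 3) : qtri q x i j k = (x i 0 * x j 1 - q • (x i 1 * x j 0)) * x k 2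
      - q • ((x i 0 * x j 2 - q • (x i 2 * x j 0)) * x k 1)
      + q ^ 2 • ((x i 1 * x j 2 - q • (x i 2 * x j 1)) * x k 0) := by
  simp [qtri, Fin.sum_univ_three, qeps, sub_mul]
  module

theorem qtri_right {B : Type*} [Ring B] [Algebra ℂ B] (q : ℂ) (x : Fin 3 → Fin 3 → B)
    (i j k : Fin 3) : qtri q x i j k = x i 0 * (x j 1 * x k 2 - q • (x j 2 * x k 1))
      - q • (x i 1 * (x j 0 * x k 2 - q • (x j 2 * x k 0)))
      + q ^ 2 • (x i 2 * (x j 0 * x k 1 - q • (x j 1 * x k 0))) := by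
  simp [qtri, Fin.sum_univ_three, qeps, mul_sub, mul_assoc]
  module

theorem IsQMatrix.qtri_eq {B : Type*} [Ring B] [Algebra ℂ B] {q : ℂ} {x : Fin 3 → Fin 3 → B}
    (hx : IsQMatrix q x) (hq : q ≠ 0) (i j k : Fin 3) :
    qtri q x i j k = qeps q i j k • qdet q x := by
  have l0 : ∀ i k, qtri q x i i k = 0 := fun i k => by
    rw [qtri_left, hx.pair_self (by decide), hx.pair_self (by decide), hx.pair_self (by decide)]
    simp
  have r0 : ∀ i k, qtri q x i k k = 0 := fun i k => by
    rw [qtri_right, hx.pair_self (by decide), hx.pair_self (by decide), hx.pair_self (by decide)]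
    simp
  have l1 : ∀ i j k, i < j → qtri q x j i k = -q • qtri q x i j k := fun i j k h => by
    rw [qtri_left, qtri_left, hx.pair hq h (by decide), hx.pair hq h (by decide),
      hx.pair hq h (by decide)]
    simp only [smul_mul_assoc]
    module
  have r1 : ∀ i j k, j < k → qtri q x i k j = -q • qtri q x i j k := fun i j k h => by
    rw [qtri_right, qtri_right, hx.pair hq h (by decide), hx.pair hq h (by decide),
      hx.pair hq h (by decide)]
    simp only [mul_smul_comm]
    module
  have h012 : qtri q x 0 1 2 = qdet q x := by
    rw [qtri_left, qdet]
    simp only [sub_mul, smul_mul_assoc]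
    module
  have h021 := r1 0 1 2 (by decide)
  have h102 := l1 0 1 2 (by decide)
  have h120 := r1 1 0 2 (by decide)
  have h201 := l1 0 2 1 (by decide)
  have h210 := l1 1 2 0 (by decide)
  have h010 := r1 0 0 1 (by decide)
  have h020 := r1 0 0 2 (by decide)
  have h121 := l1 1 2 1 (by decide)
  have h101 := l1 0 1 1 (by decide)
  have h202 := l1 0 2 2 (by decide)
  have h212 := l1 1 2 2 (by decide)
  have h121 := r1 1 1 2 (by decide)
  rw [l0] at h010 h020 h121
  rw [r0] at h101 h202 h212
  rw [h102] at h120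
  rw [h021] at h201
  rw [h120] at h210
  rw [h012] at h021 h102 h120 h201 h210
  fin_cases i <;> fin_cases j <;> fin_cases k <;>
    simp [qeps, l0, r0, h012, h021, h102, h120, h201, h210, h010, h020, h101, h121, h202, h212] <;>
    module


/-- The matrix `R = ∑ q^{δ_ij} e_ii ⊗ e_jj + (q - q⁻¹) ∑_{i > j} e_ij ⊗ e_ji`.  Pairs of indices are
arranged so that the entry `R^i_j^k_l` (the coefficient of `e_ij ⊗ e_kl`) is `Rmat q (i, k) (j, l)`. -/
noncomputable def Rmat (q : ℂ) : Matrix (Fin 3 × Fin 3) (Fin 3 × Fin 3) ℂ :=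
  Matrix.of fun r c =>
    (if r.1 = c.1 ∧ r.2 = c.2 then (if r.1 = r.2 then q else 1) else 0)
      + (if r.1 = c.2 ∧ r.2 = c.1 ∧ r.2 < r.1 then q - q⁻¹ else 0)

theorem sum_Rmat_left {M : Type*} [AddCommGroup M] [Module ℂ M] (q : ℂ) (i k : Fin 3)
    (f : Fin 3 → Fin 3 → M) :
    ∑ a, ∑ b, Rmat q (i, k) (a, b) • f a b
      = (if i = k then q else 1) • f i k + (if k < i then q - q⁻¹ else 0) • f k i := by
  fin_cases i <;> fin_cases k <;> simp [Fin.sum_univ_three, Rmat] <;>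
    exact add_comm _ _

theorem sum_Rmat_right {M : Type*} [AddCommGroup M] [Module ℂ M] (q : ℂ) (j l : Fin 3)
    (f : Fin 3 → Fin 3 → M) :
    ∑ a, ∑ b, Rmat q (a, b) (j, l) • f a b
      = (if j = l then q else 1) • f j l + (if j < l then q - q⁻¹ else 0) • f l j := by
  fin_cases j <;> fin_cases l <;> simp [Fin.sum_univ_three, Rmat]

/-- The relations `R X₁ X₂ = X₂ X₁ R`. -/
def RTT {B : Type*} [Ring B] [Algebra ℂ B] (q : ℂ) (x : Fin 3 → Fin 3 → B) : Prop :=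
  ∀ i k j l, ∑ a, ∑ b, Rmat q (i, k) (a, b) • (x a j * x b l)
    = ∑ a, ∑ b, Rmat q (a, b) (j, l) • (x k b * x i a)

theorem rtt_iff {B : Type*} [Ring B] [Algebra ℂ B] (q : ℂ) (hq : q ≠ 0)
    (x : Fin 3 → Fin 3 → B) : RTT q x ↔ IsQMatrix q x := by
  have key : RTT q x ↔ ∀ i k j l,
      (if i = k then q else 1) • (x i j * x k l) + (if k < i then q - q⁻¹ else 0) • (x k j * x i l)
      = (if j = l then q else 1) • (x k l * x i j)
        + (if j < l then q - q⁻¹ else 0) • (x k j * x i l) := by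
    simp only [RTT]
    refine forall_congr' fun i => forall_congr' fun k => forall_congr' fun j =>
      forall_congr' fun l => ?_
    rw [sum_Rmat_left q i k (fun a b => x a j * x b l),
      sum_Rmat_right q j l (fun a b => x k b * x i a)]
  rw [key]
  constructor
  · intro h
    refine ⟨fun i j k hjk => ?_, fun i k j hik => ?_, fun i k j l hik hlj => ?_,
      fun i k j l hik hjl => ?_⟩
    · have := h i i k j
      simp only [if_true, lt_irrefl, if_false, hjk.ne', hjk.not_gt, zero_smul, add_zero,
        one_smul] at this
      exact this.symm
    · have := h i k j j
      simpa only [if_true, lt_irrefl, if_false, hik.ne, hik.not_gt, zero_smul, add_zero,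
        one_smul] using this
    · have := h i k j l
      simpa only [hik.ne, hik.not_gt, hlj.ne', hlj.not_gt, if_false, zero_smul, add_zero,
        one_smul] using this
    · have := h i k j l
      simpa only [hik.ne, hik.not_gt, hjl.ne, hjl, if_true, if_false, zero_smul, add_zero,
        one_smul] using this
  · intro h i k j l
    rcases lt_trichotomy i k with hik | rfl | hik <;> rcases lt_trichotomy j l with hjl | rfl | hjl
    · simp [hik.ne, hik.not_gt, hjl.ne, hjl, h.diag i k j l hik hjl]
    · simp [hik.ne, hik.not_gt, h.col i k j hik]
    · simp [hik.ne, hik.not_gt, hjl.ne', hjl.not_gt, h.anti i k j l hik hjl]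
    · simp only [if_true, lt_irrefl, if_false, hjl.ne, hjl, h.row i j l hjl]
      match_scalars; field_simp; ring
    · simp
    · simp [hjl.ne', hjl.not_gt, h.row i l j hjl]
    · simp [hik.ne', hik, hjl.ne, hjl, h.anti k i l j hik hjl]
    · simp only [if_true, lt_irrefl, if_false, hik.ne', hik, h.col k i j hik]
      match_scalars; field_simp; ring
    · simp only [if_true, if_false, hik.ne', hik, hjl.ne', hjl.not_gt, h.diag k i l j hik hjl,
        h.anti k i j l hik hjl]
      match_scalars <;> ring

/-- Products of `q`-matrices with mutually commuting entries are `q`-matrices. -/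
theorem IsQMatrix.mul {B : Type*} [Ring B] [Algebra ℂ B] {q : ℂ} (hq : q ≠ 0)
    {x y : Fin 3 → Fin 3 → B} (hx : IsQMatrix q x) (hy : IsQMatrix q y)
    (hxy : ∀ i j k l, y i j * x k l = x k l * y i j) :
    IsQMatrix q (fun i j => ∑ k, x i k * y k j) := by
  rw [← rtt_iff q hq] at *
  intro i k j l
  have e1 : ∀ a b j l : Fin 3, (∑ c, x a c * y c j) * (∑ d, x b d * y d l)
      = ∑ c, ∑ d, (x a c * x b d) * (y c j * y d l) := fun a b j l => by
    rw [Finset.sum_mul_sum]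
    refine Finset.sum_congr rfl fun c _ => Finset.sum_congr rfl fun d _ => ?_
    rw [mul_assoc, ← mul_assoc (y c j), hxy, mul_assoc, mul_assoc]
  simp only [e1]
  calc ∑ a, ∑ b, Rmat q (i, k) (a, b) • ∑ c, ∑ d, (x a c * x b d) * (y c j * y d l)
      = ∑ c, ∑ d, (∑ a, ∑ b, Rmat q (i, k) (a, b) • (x a c * x b d)) * (y c j * y d l) := by
        simp only [Fin.sum_univ_three, smul_add, add_mul, smul_mul_assoc]; abel
    _ = ∑ c, ∑ d, (∑ a, ∑ b, Rmat q (a, b) (c, d) • (x k b * x i a)) * (y c j * y d l) := by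
        simp only [hx i k]
    _ = ∑ a, ∑ b, (x k b * x i a) * (∑ c, ∑ d, Rmat q (a, b) (c, d) • (y c j * y d l)) := by
        simp only [Fin.sum_univ_three, mul_add, add_mul, smul_mul_assoc, mul_smul_comm]; abel
    _ = ∑ a, ∑ b, (x k b * x i a) * (∑ c, ∑ d, Rmat q (c, d) (j, l) • (y b d * y a c)) := by
        simp only [hy _ _ j l]
    _ = _ := by
        simp only [Fin.sum_univ_three, mul_add, smul_add, mul_smul_comm]; abel

theorem qdet_mul {B : Type*} [Ring B] [Algebra ℂ B] {q : ℂ} (hq : q ≠ 0)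
    {x y : Fin 3 → Fin 3 → B} (hx : IsQMatrix q x) (hy : IsQMatrix q y)
    (hxy : ∀ i j k l, y i j * x k l = x k l * y i j) :
    qdet q (fun i j => ∑ k, x i k * y k j) = qdet q x * qdet q y := by
  have hz := hx.mul hq hy hxy
  have h3 : ∀ i j k a b c : Fin 3, (x 0 i * y i a) * (x 1 j * y j b) * (x 2 k * y k c)
      = (x 0 i * x 1 j * x 2 k) * (y i a * y j b * y k c) := fun i j k a b c => by
    simp only [mul_assoc]
    rw [← mul_assoc (y i a) (x 1 j), hxy]
    simp only [mul_assoc]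
    rw [← mul_assoc (y j b) (x 2 k), hxy]
    simp only [mul_assoc]
    rw [← mul_assoc (y i a) (x 2 k), hxy]
    simp only [mul_assoc]
  have hx0 := hx.qtri_eq hq 0 1 2
  have hz0 := hz.qtri_eq hq 0 1 2
  simp only [qeps, one_smul] at hx0 hz0
  rw [← hx0, ← hz0]
  have e3 : ∀ a b c : Fin 3,
      (∑ i, x 0 i * y i a) * (∑ j, x 1 j * y j b) * (∑ k, x 2 k * y k c)
      = ∑ i, ∑ j, ∑ k, (x 0 i * x 1 j * x 2 k) * (y i a * y j b * y k c) := fun a b c => by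
    simp only [Finset.sum_mul_sum, ← h3]
    simp only [Fin.sum_univ_three, add_mul]
    abel
  calc qtri q (fun i j => ∑ k, x i k * y k j) 0 1 2
      = ∑ a, ∑ b, ∑ c, ∑ i, ∑ j, ∑ k,
          qeps q a b c • ((x 0 i * x 1 j * x 2 k) * (y i a * y j b * y k c)) := by
        simp only [qtri, e3, Finset.smul_sum]
    _ = ∑ i, ∑ j, ∑ k, ∑ a, ∑ b, ∑ c,
          qeps q a b c • ((x 0 i * x 1 j * x 2 k) * (y i a * y j b * y k c)) := by
        have := Finset.sum_comm (s := (Finset.univ : Finset (Fin 3 × Fin 3 × Fin 3)))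
          (t := (Finset.univ : Finset (Fin 3 × Fin 3 × Fin 3)))
          (f := fun p r => qeps q p.1 p.2.1 p.2.2 •
            ((x 0 r.1 * x 1 r.2.1 * x 2 r.2.2) * (y r.1 p.1 * y r.2.1 p.2.1 * y r.2.2 p.2.2)))
        simpa only [Fintype.sum_prod_type] using this
    _ = ∑ i, ∑ j, ∑ k, (x 0 i * x 1 j * x 2 k) * qtri q y i j k := by
        simp only [qtri, Finset.mul_sum, mul_smul_comm]
    _ = _ := by
        simp only [hy.qtri_eq hq, mul_smul_comm]
        simp only [qtri, Finset.sum_mul, smul_mul_assoc]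

/-- Generators of the algebra: the nine matrix entries `z i j` and the inverse determinant. -/
inductive Gen : Type
  | z (i j : Fin 3)
  | dinv

/-- The matrix of the free generators. -/
noncomputable def freeZ (i j : Fin 3) : FreeAlgebra ℂ Gen := FreeAlgebra.ι ℂ (Gen.z i j)

/-- Defining relations of `Fun_q(GL(3, ℂ))`. -/
inductive Rel (q : ℂ) : FreeAlgebra ℂ Gen → FreeAlgebra ℂ Gen → Prop
  | row (i j k : Fin 3) (h : j < k) :
      Rel q (freeZ i j * freeZ i k) (q • (freeZ i k * freeZ i j))
  | col (i k j : Fin 3) (h : i < k) :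
      Rel q (freeZ i j * freeZ k j) (q • (freeZ k j * freeZ i j))
  | anti (i k j l : Fin 3) (h : i < k) (h' : l < j) :
      Rel q (freeZ i j * freeZ k l) (freeZ k l * freeZ i j)
  | diag (i k j l : Fin 3) (h : i < k) (h' : j < l) :
      Rel q (freeZ i j * freeZ k l)
        (freeZ k l * freeZ i j + (q - q⁻¹) • (freeZ k j * freeZ i l))
  | det_mul_inv : Rel q (qdet q freeZ * FreeAlgebra.ι ℂ Gen.dinv) 1
  | inv_mul_det : Rel q (FreeAlgebra.ι ℂ Gen.dinv * qdet q freeZ) 1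

/-- The algebra `Fun_q(GL(3, ℂ))`. -/
def GLq (q : ℂ) : Type := RingQuot (Rel q)

noncomputable instance (q : ℂ) : Ring (GLq q) := inferInstanceAs (Ring (RingQuot (Rel q)))
noncomputable instance (q : ℂ) : Algebra ℂ (GLq q) :=
  inferInstanceAs (Algebra ℂ (RingQuot (Rel q)))

/-- The quotient map from the free algebra. -/
noncomputable def mkGL (q : ℂ) : FreeAlgebra ℂ Gen →ₐ[ℂ] GLq q := RingQuot.mkAlgHom ℂ (Rel q)

/-- The generators `z^i_j`. -/
noncomputable def z (q : ℂ) (i j : Fin 3) : GLq q := mkGL q (freeZ i j)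

/-- The inverse of the quantum determinant. -/
noncomputable def dinv (q : ℂ) : GLq q := mkGL q (FreeAlgebra.ι ℂ Gen.dinv)

theorem map_qdet {B C : Type*} [Ring B] [Algebra ℂ B] [Ring C] [Algebra ℂ C] (q : ℂ)
    (f : B →ₐ[ℂ] C) (x : Fin 3 → Fin 3 → B) :
    f (qdet q x) = qdet q (fun i j => f (x i j)) := by
  simp [qdet]

theorem mkGL_rel {q : ℂ} {x y : FreeAlgebra ℂ Gen} (h : Rel q x y) : mkGL q x = mkGL q y :=
  RingQuot.mkAlgHom_rel ℂ h

theorem isQMatrix_z (q : ℂ) : IsQMatrix q (z q) where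
  row i j k h := by simpa [z] using mkGL_rel (Rel.row (q := q) i j k h)
  col i k j h := by simpa [z] using mkGL_rel (Rel.col (q := q) i k j h)
  anti i k j l h h' := by simpa [z] using mkGL_rel (Rel.anti (q := q) i k j l h h')
  diag i k j l h h' := by simpa [z] using mkGL_rel (Rel.diag (q := q) i k j l h h')

theorem det_mul_dinv (q : ℂ) : qdet q (z q) * dinv q = 1 := by
  have := mkGL_rel (Rel.det_mul_inv (q := q))
  rwa [map_mul, map_qdet, map_one] at this

theorem dinv_mul_det (q : ℂ) : dinv q * qdet q (z q) = 1 := by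
  have := mkGL_rel (Rel.inv_mul_det (q := q))
  rwa [map_mul, map_qdet, map_one] at this

/-- The universal property. -/
noncomputable def liftGL {B : Type*} [Ring B] [Algebra ℂ B] {q : ℂ} (x : Fin 3 → Fin 3 → B) (e : B)
    (hx : IsQMatrix q x) (h1 : qdet q x * e = 1) (h2 : e * qdet q x = 1) : GLq q →ₐ[ℂ] B :=
  RingQuot.liftAlgHom ℂ ⟨FreeAlgebra.lift ℂ fun g => match g with
    | Gen.z i j => x i j
    | Gen.dinv => e, by
    intro a b h
    induction h with
    | row i j k h => simpa [freeZ] using hx.row i j k h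
    | col i k j h => simpa [freeZ] using hx.col i k j h
    | anti i k j l h h' => simpa [freeZ] using hx.anti i k j l h h'
    | diag i k j l h h' => simpa [freeZ] using hx.diag i k j l h h'
    | det_mul_inv => simpa [map_qdet, freeZ] using h1
    | inv_mul_det => simpa [map_qdet, freeZ] using h2⟩

theorem liftGL_z {B : Type*} [Ring B] [Algebra ℂ B] {q : ℂ} (x : Fin 3 → Fin 3 → B) (e : B)
    (hx : IsQMatrix q x) (h1 : qdet q x * e = 1) (h2 : e * qdet q x = 1) (i j : Fin 3) :
    liftGL x e hx h1 h2 (z q i j) = x i j := by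
  unfold liftGL z mkGL
  erw [RingQuot.liftAlgHom_mkAlgHom_apply]
  simp [freeZ]

theorem liftGL_dinv {B : Type*} [Ring B] [Algebra ℂ B] {q : ℂ} (x : Fin 3 → Fin 3 → B) (e : B)
    (hx : IsQMatrix q x) (h1 : qdet q x * e = 1) (h2 : e * qdet q x = 1) :
    liftGL x e hx h1 h2 (dinv q) = e := by
  unfold liftGL dinv mkGL
  erw [RingQuot.liftAlgHom_mkAlgHom_apply]
  simp

theorem GLq.hom_ext {B : Type*} [Ring B] [Algebra ℂ B] {q : ℂ} {f g : GLq q →ₐ[ℂ] B}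
    (h : ∀ i j, f (z q i j) = g (z q i j)) : f = g := by
  have hd : f (qdet q (z q)) = g (qdet q (z q)) := by simp only [map_qdet, h]
  refine RingQuot.ringQuot_ext' ℂ f g (FreeAlgebra.hom_ext (funext fun x => ?_))
  cases x with
  | z i j => exact h i j
  | dinv =>
    change f (dinv q) = g (dinv q)
    calc f (dinv q) = f (dinv q) * (g (qdet q (z q)) * g (dinv q)) := by
          rw [← map_mul, det_mul_dinv, map_one, mul_one]
      _ = g (dinv q) := by
          rw [← hd, ← mul_assoc, ← map_mul, dinv_mul_det, map_one, one_mul]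

theorem GLq.induction {q : ℂ} {p : GLq q → Prop} (halg : ∀ c : ℂ, p (algebraMap ℂ _ c))
    (hz : ∀ i j, p (z q i j)) (hd : p (dinv q)) (hadd : ∀ a b, p a → p b → p (a + b))
    (hmul : ∀ a b, p a → p b → p (a * b)) (a : GLq q) : p a := by
  obtain ⟨a, rfl⟩ := RingQuot.mkAlgHom_surjective ℂ (Rel q) a
  induction a using FreeAlgebra.induction with
  | grade0 c => rw [AlgHom.commutes]; exact halg c
  | grade1 g =>
    cases g with
    | z i j => exact hz i j
    | dinv => exact hd
  | mul a b ha hb => rw [map_mul]; exact hmul _ _ ha hb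
  | add a b ha hb => rw [map_add]; exact hadd _ _ ha hb

/-- The matrix `S(Z)`. -/
noncomputable def Smat (q : ℂ) (i j : Fin 3) : GLq q := dinv q * qadj q (z q) i j

theorem dinv_comm (q : ℂ) (hq : q ≠ 0) (i j : Fin 3) : dinv q * z q i j = z q i j * dinv q := by
  obtain ⟨h1, h2⟩ := (isQMatrix_z q).adj hq
  have hD : qdet q (z q) * z q i j = z q i j * qdet q (z q) := by
    calc qdet q (z q) * z q i j = ∑ l, (∑ k, z q i k * qadj q (z q) k l) * z q l j := by
          simp [h1]
      _ = ∑ k, z q i k * ∑ l, qadj q (z q) k l * z q l j := by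
          simp only [Finset.sum_mul, Finset.mul_sum, mul_assoc]
          exact Finset.sum_comm
      _ = _ := by simp [h2]
  calc dinv q * z q i j = dinv q * (z q i j * qdet q (z q)) * dinv q := by
        rw [mul_assoc, mul_assoc, det_mul_dinv, mul_one]
    _ = _ := by rw [← hD, ← mul_assoc, dinv_mul_det, one_mul]

theorem Smat_mul_z (q : ℂ) (hq : q ≠ 0) (i j : Fin 3) :
    ∑ k, Smat q i k * z q k j = if i = j then 1 else 0 := by
  obtain ⟨-, h2⟩ := (isQMatrix_z q).adj hq
  simp only [Smat, mul_assoc, ← Finset.mul_sum, h2, mul_ite, dinv_mul_det, mul_zero]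

theorem z_mul_Smat (q : ℂ) (hq : q ≠ 0) (i j : Fin 3) :
    ∑ k, z q i k * Smat q k j = if i = j then 1 else 0 := by
  obtain ⟨h1, -⟩ := (isQMatrix_z q).adj hq
  simp only [Smat, ← mul_assoc, ← dinv_comm q hq]
  simp only [mul_assoc, ← Finset.mul_sum, h1, mul_ite, dinv_mul_det, mul_zero]

theorem isQMatrix_Sop (q : ℂ) (hq : q ≠ 0) :
    IsQMatrix q (fun i j => MulOpposite.op (Smat q i j)) := by
  let Rm : Matrix (Fin 3 × Fin 3) (Fin 3 × Fin 3) (GLq q) := (Rmat q).map (algebraMap ℂ _)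
  let T12 : (Fin 3 → Fin 3 → GLq q) → Matrix (Fin 3 × Fin 3) (Fin 3 × Fin 3) (GLq q) :=
    fun x => Matrix.of fun r c => x r.1 c.1 * x r.2 c.2
  let T21 : (Fin 3 → Fin 3 → GLq q) → Matrix (Fin 3 × Fin 3) (Fin 3 × Fin 3) (GLq q) :=
    fun x => Matrix.of fun r c => x r.2 c.2 * x r.1 c.1
  have hZ : Rm * T12 (z q) = T21 (z q) * Rm := by
    ext ⟨i, k⟩ ⟨j, l⟩
    have := (rtt_iff q hq (z q)).2 (isQMatrix_z q) i k j l
    simpa [Matrix.mul_apply, Fintype.sum_prod_type, Rm, T12, T21, Algebra.smul_def,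
      Algebra.commutes] using this
  have h1 : T12 (z q) * T21 (Smat q) = 1 := by
    ext ⟨i, k⟩ ⟨j, l⟩
    calc (T12 (z q) * T21 (Smat q)) (i, k) (j, l)
        = ∑ c, z q i c * (∑ d, z q k d * Smat q d l) * Smat q c j := by
          simp only [Matrix.mul_apply, Fintype.sum_prod_type, T12, T21, Matrix.of_apply,
            Finset.mul_sum, Finset.sum_mul, mul_assoc]
      _ = _ := by
          by_cases h : k = l
          · simp [z_mul_Smat q hq, h, Matrix.one_apply]
          · simp [z_mul_Smat q hq, h, Matrix.one_apply]
  have h2 : T12 (Smat q) * T21 (z q) = 1 := by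
    ext ⟨i, k⟩ ⟨j, l⟩
    calc (T12 (Smat q) * T21 (z q)) (i, k) (j, l)
        = ∑ c, Smat q i c * (∑ d, Smat q k d * z q d l) * z q c j := by
          simp only [Matrix.mul_apply, Fintype.sum_prod_type, T12, T21, Matrix.of_apply,
            Finset.mul_sum, Finset.sum_mul, mul_assoc]
      _ = _ := by
          by_cases h : k = l
          · simp [Smat_mul_z q hq, h, Matrix.one_apply]
          · simp [Smat_mul_z q hq, h, Matrix.one_apply]
  have h3 : Rm * T21 (Smat q) = T12 (Smat q) * Rm := by
    calc Rm * T21 (Smat q) = T12 (Smat q) * T21 (z q) * (Rm * T21 (Smat q)) := by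
          rw [h2, Matrix.one_mul]
      _ = T12 (Smat q) * (T21 (z q) * Rm) * T21 (Smat q) := by simp only [Matrix.mul_assoc]
      _ = T12 (Smat q) * Rm * (T12 (z q) * T21 (Smat q)) := by
          rw [← hZ]; simp only [Matrix.mul_assoc]
      _ = _ := by rw [h1, Matrix.mul_one]
  rw [← rtt_iff q hq]
  intro i k j l
  have h4 := congrFun (congrFun h3 (i, k)) (j, l)
  simp only [Matrix.mul_apply, Fintype.sum_prod_type, T12, T21, Matrix.of_apply, Rm,
    Matrix.map_apply, ← Algebra.smul_def, ← Algebra.commutes] at h4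
  have h5 := congrArg MulOpposite.op h4
  simpa only [Finset.op_sum, MulOpposite.op_smul, MulOpposite.op_mul] using h5

theorem qdet_Sop (q : ℂ) (hq : q ≠ 0) :
    qdet q (fun i j => MulOpposite.op (Smat q i j)) = MulOpposite.op (dinv q) := by
  have hs := (isQMatrix_Sop q hq).qtri_eq hq 0 1 2
  simp only [qeps, one_smul] at hs
  have h1 : (qdet q (fun i j => MulOpposite.op (Smat q i j))).unop
      = ∑ a, ∑ b, ∑ c, qeps q a b c • (Smat q 2 c * (Smat q 1 b * Smat q 0 a)) := by
    rw [← hs]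
    simp only [qtri, Finset.unop_sum, MulOpposite.unop_smul, MulOpposite.unop_mul,
      MulOpposite.unop_op]
  have h2 : (qdet q (fun i j => MulOpposite.op (Smat q i j))).unop * qdet q (z q) = 1 := by
    calc _ = ∑ a, ∑ b, ∑ c, ∑ i, ∑ j, ∑ k, qeps q i j k •
            (Smat q 2 c * (Smat q 1 b * Smat q 0 a) * (z q a i * z q b j * z q c k)) := by
          rw [h1]
          simp only [Finset.sum_mul]
          refine Finset.sum_congr rfl fun a _ => Finset.sum_congr rfl fun b _ =>
            Finset.sum_congr rfl fun c _ => ?_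
          rw [smul_mul_assoc, ← mul_smul_comm, ← (isQMatrix_z q).qtri_eq hq]
          simp only [qtri, Finset.mul_sum, mul_smul_comm]
      _ = ∑ i, ∑ j, ∑ k, ∑ a, ∑ b, ∑ c, qeps q i j k •
            (Smat q 2 c * (Smat q 1 b * Smat q 0 a) * (z q a i * z q b j * z q c k)) := by
          have := Finset.sum_comm (s := (Finset.univ : Finset (Fin 3 × Fin 3 × Fin 3)))
            (t := (Finset.univ : Finset (Fin 3 × Fin 3 × Fin 3)))
            (f := fun p r => qeps q r.1 r.2.1 r.2.2 • (Smat q 2 p.2.2 *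
              (Smat q 1 p.2.1 * Smat q 0 p.1) * (z q p.1 r.1 * z q p.2.1 r.2.1 * z q p.2.2 r.2.2)))
          simpa only [Fintype.sum_prod_type] using this
      _ = ∑ i, ∑ j, ∑ k, qeps q i j k • ∑ c, Smat q 2 c * (∑ b, Smat q 1 b *
            (∑ a, Smat q 0 a * z q a i) * z q b j) * z q c k := by
          refine Finset.sum_congr rfl fun i _ => Finset.sum_congr rfl fun j _ =>
            Finset.sum_congr rfl fun k _ => ?_
          simp only [Finset.mul_sum, Finset.sum_mul, Finset.smul_sum, mul_assoc]
          rw [Finset.sum_comm_cycle]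
          exact Finset.sum_congr rfl fun c _ => Finset.sum_comm
      _ = 1 := by
          have h0 : ∀ i j k : Fin 3, (∑ c, Smat q 2 c * (∑ b, Smat q 1 b *
              (∑ a, Smat q 0 a * z q a i) * z q b j) * z q c k)
              = if 0 = i ∧ 1 = j ∧ 2 = k then 1 else 0 := fun i j k => by
            by_cases hi : 0 = i
            · by_cases hj : 1 = j
              · simp [Smat_mul_z q hq, hi, hj]
              · simp [Smat_mul_z q hq, hi, hj]
            · simp [Smat_mul_z q hq, hi]
          simp only [h0]
          simp [Fin.sum_univ_three, qeps]
  have h3 := congrArg (· * dinv q) h2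
  simp only [mul_assoc, det_mul_dinv, mul_one, one_mul] at h3
  rw [← h3, MulOpposite.op_unop]

theorem IsQMatrix.map {B C : Type*} [Ring B] [Algebra ℂ B] [Ring C] [Algebra ℂ C] {q : ℂ}
    {x : Fin 3 → Fin 3 → B} (hx : IsQMatrix q x) (f : B →ₐ[ℂ] C) :
    IsQMatrix q (fun i j => f (x i j)) where
  row i j k h := by rw [← map_mul, hx.row i j k h, map_smul, map_mul]
  col i k j h := by rw [← map_mul, hx.col i k j h, map_smul, map_mul]
  anti i k j l h h' := by rw [← map_mul, hx.anti i k j l h h', map_mul]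
  diag i k j l h h' := by
    rw [← map_mul, hx.diag i k j l h h', map_add, map_smul, map_mul, map_mul]

theorem comulGL_aux (q : ℂ) (hq : q ≠ 0) :
    IsQMatrix q (fun i j => ∑ k, z q i k ⊗ₜ[ℂ] z q k j) ∧
    qdet q (fun i j => ∑ k, z q i k ⊗ₜ[ℂ] z q k j) = qdet q (z q) ⊗ₜ[ℂ] qdet q (z q) := by
  have hl := (isQMatrix_z q).map
    (Algebra.TensorProduct.includeLeft : GLq q →ₐ[ℂ] GLq q ⊗[ℂ] GLq q)
  have hr := (isQMatrix_z q).map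
    (Algebra.TensorProduct.includeRight : GLq q →ₐ[ℂ] GLq q ⊗[ℂ] GLq q)
  have hlr : ∀ i j k l, Algebra.TensorProduct.includeRight (z q i j) *
      (Algebra.TensorProduct.includeLeft : GLq q →ₐ[ℂ] GLq q ⊗[ℂ] GLq q) (z q k l)
      = (Algebra.TensorProduct.includeLeft : GLq q →ₐ[ℂ] GLq q ⊗[ℂ] GLq q) (z q k l)
        * Algebra.TensorProduct.includeRight (z q i j) := fun i j k l => by simp
  refine ⟨by simpa using hl.mul hq hr hlr, ?_⟩
  have := qdet_mul hq hl hr hlr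
  rw [← map_qdet, ← map_qdet] at this
  simpa using this

/-- The coproduct `Δ(z^i_j) = ∑ z^i_k ⊗ z^k_j`. -/
noncomputable def comulGL (q : ℂ) (hq : q ≠ 0) : GLq q →ₐ[ℂ] GLq q ⊗[ℂ] GLq q :=
  liftGL (fun i j => ∑ k, z q i k ⊗ₜ[ℂ] z q k j) (dinv q ⊗ₜ[ℂ] dinv q)
    (comulGL_aux q hq).1
    (by rw [(comulGL_aux q hq).2, Algebra.TensorProduct.tmul_mul_tmul, det_mul_dinv]; rfl)
    (by rw [(comulGL_aux q hq).2, Algebra.TensorProduct.tmul_mul_tmul, dinv_mul_det]; rfl)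

theorem comulGL_z (q : ℂ) (hq : q ≠ 0) (i j : Fin 3) :
    comulGL q hq (z q i j) = ∑ k, z q i k ⊗ₜ[ℂ] z q k j := by
  rw [comulGL, liftGL_z]

theorem comulGL_dinv (q : ℂ) (hq : q ≠ 0) :
    comulGL q hq (dinv q) = dinv q ⊗ₜ[ℂ] dinv q := by
  rw [comulGL, liftGL_dinv]

/-- The counit `ε(z^i_j) = δ^i_j`. -/
noncomputable def counitGL (q : ℂ) : GLq q →ₐ[ℂ] ℂ :=
  liftGL (fun i j => if i = j then 1 else 0) 1
    { row := fun i j k h => by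
        by_cases h1 : i = j <;> by_cases h2 : i = k <;> simp_all
      col := fun i k j h => by
        by_cases h1 : i = j <;> by_cases h2 : k = j <;> simp_all
      anti := fun i k j l h h' => by ring
      diag := fun i k j l h h' => by
        have : ¬ (k = j ∧ i = l) := by rintro ⟨rfl, rfl⟩; exact lt_asymm h h'
        have h0 : (if k = j then (1 : ℂ) else 0) * (if i = l then 1 else 0) = 0 := by
          by_cases h1 : k = j
          · rw [if_neg (fun h2 => this ⟨h1, h2⟩), mul_zero]
          · rw [if_neg h1, zero_mul]
        rw [h0, smul_zero, add_zero, mul_comm] }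
    (by simp [qdet]) (by simp [qdet])

theorem counitGL_z (q : ℂ) (i j : Fin 3) : counitGL q (z q i j) = if i = j then 1 else 0 :=
  liftGL_z _ _ _ _ _ _ _

theorem counitGL_dinv (q : ℂ) : counitGL q (dinv q) = 1 := liftGL_dinv _ _ _ _ _

/-- The antipode, as a homomorphism into the opposite algebra. -/
noncomputable def antipodeGL (q : ℂ) (hq : q ≠ 0) : GLq q →ₐ[ℂ] (GLq q)ᵐᵒᵖ :=
  liftGL (fun i j => MulOpposite.op (Smat q i j)) (MulOpposite.op (qdet q (z q)))
    (isQMatrix_Sop q hq)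
    (by rw [qdet_Sop q hq, ← MulOpposite.op_mul, det_mul_dinv, MulOpposite.op_one])
    (by rw [qdet_Sop q hq, ← MulOpposite.op_mul, dinv_mul_det, MulOpposite.op_one])

theorem antipodeGL_z (q : ℂ) (hq : q ≠ 0) (i j : Fin 3) :
    antipodeGL q hq (z q i j) = MulOpposite.op (Smat q i j) := liftGL_z _ _ _ _ _ _ _

theorem antipodeGL_dinv (q : ℂ) (hq : q ≠ 0) :
    antipodeGL q hq (dinv q) = MulOpposite.op (qdet q (z q)) := liftGL_dinv _ _ _ _ _

noncomputable instance instBialgebra (q : ℂ) [NeZero q] : Bialgebra ℂ (GLq q) :=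
  Bialgebra.ofAlgHom (comulGL q (NeZero.ne q)) (counitGL q)
    (GLq.hom_ext fun i j => by
      simp only [AlgHom.comp_apply, comulGL_z, map_sum, Algebra.TensorProduct.map_tmul,
        AlgHom.id_apply, TensorProduct.sum_tmul, TensorProduct.tmul_sum]
      rw [Finset.sum_comm]
      rfl)
    (GLq.hom_ext fun i j => by
      simp [comulGL_z, counitGL_z, TensorProduct.ite_tmul])
    (GLq.hom_ext fun i j => by
      simp [comulGL_z, counitGL_z, TensorProduct.tmul_ite])

theorem comul_z (q : ℂ) [NeZero q] (i j : Fin 3) :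
    Coalgebra.comul (R := ℂ) (z q i j) = ∑ k, z q i k ⊗ₜ[ℂ] z q k j := comulGL_z _ _ _ _

theorem comul_dinv (q : ℂ) [NeZero q] :
    Coalgebra.comul (R := ℂ) (dinv q) = dinv q ⊗ₜ[ℂ] dinv q := comulGL_dinv _ _

theorem counit_z (q : ℂ) [NeZero q] (i j : Fin 3) :
    Coalgebra.counit (R := ℂ) (z q i j) = if i = j then 1 else 0 := counitGL_z _ _ _

theorem counit_dinv (q : ℂ) [NeZero q] :
    Coalgebra.counit (R := ℂ) (dinv q) = 1 := counitGL_dinv _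

/-- The antipode as a linear map. -/
noncomputable def antipodeLin (q : ℂ) [NeZero q] : GLq q →ₗ[ℂ] GLq q :=
  (MulOpposite.opLinearEquiv ℂ).symm.toLinearMap ∘ₗ (antipodeGL q (NeZero.ne q)).toLinearMap

theorem antipodeLin_mul (q : ℂ) [NeZero q] (a b : GLq q) :
    antipodeLin q (a * b) = antipodeLin q b * antipodeLin q a := by
  simp [antipodeLin]

theorem antipodeLin_z (q : ℂ) [NeZero q] (i j : Fin 3) :
    antipodeLin q (z q i j) = Smat q i j := by
  simp [antipodeLin, antipodeGL_z]

theorem antipodeLin_dinv (q : ℂ) [NeZero q] : antipodeLin q (dinv q) = qdet q (z q) := by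
  simp [antipodeLin, antipodeGL_dinv]

noncomputable instance instHopfAlgebra (q : ℂ) [NeZero q] : HopfAlgebra ℂ (GLq q) where
  antipode := antipodeLin q
  mul_antipode_rTensor_comul := by
    have key : ∀ x y : GLq q ⊗[ℂ] GLq q, ∀ c : ℂ,
        LinearMap.mul' ℂ (GLq q) ((antipodeLin q).rTensor (GLq q) x) = algebraMap ℂ _ c →
        LinearMap.mul' ℂ (GLq q) ((antipodeLin q).rTensor (GLq q) (x * y))
          = c • LinearMap.mul' ℂ (GLq q) ((antipodeLin q).rTensor (GLq q) y) := by
      intro x y c hx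
      induction y using TensorProduct.induction_on with
      | zero => simp
      | add y y' h h' => rw [mul_add, map_add, map_add, h, h', map_add, map_add, smul_add]
      | tmul b b' =>
        have : LinearMap.mul' ℂ (GLq q) ((antipodeLin q).rTensor (GLq q) (x * b ⊗ₜ[ℂ] b'))
            = antipodeLin q b * LinearMap.mul' ℂ (GLq q) ((antipodeLin q).rTensor (GLq q) x)
              * b' := by
          clear hx
          induction x using TensorProduct.induction_on with
          | zero => simp
          | add x x' h h' => rw [add_mul, map_add, map_add, h, h', map_add, map_add, mul_add, add_mul]
          | tmul a a' => simp [antipodeLin_mul, mul_assoc]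
        rw [this, hx]
        simp [Algebra.algebraMap_eq_smul_one]
    ext a
    simp only [LinearMap.comp_apply, Algebra.linearMap_apply]
    induction a using GLq.induction with
    | halg c =>
      rw [Bialgebra.comul_algebraMap, Bialgebra.counit_algebraMap]
      simp [antipodeLin]
    | hz i j =>
      rw [comul_z, counit_z]
      simp only [map_sum, LinearMap.rTensor_tmul, LinearMap.mul'_apply, antipodeLin_z,
        Smat_mul_z q (NeZero.ne q)]
      split <;> simp
    | hd =>
      rw [comul_dinv, counit_dinv]
      simp [antipodeLin_dinv, det_mul_dinv]
    | hadd a b ha hb => simp only [map_add, ha, hb]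
    | hmul a b ha hb =>
      rw [Bialgebra.comul_mul, key _ _ _ ha, hb, Bialgebra.counit_mul, map_mul, Algebra.smul_def]
  mul_antipode_lTensor_comul := by
    have key : ∀ x y : GLq q ⊗[ℂ] GLq q, ∀ c : ℂ,
        LinearMap.mul' ℂ (GLq q) ((antipodeLin q).lTensor (GLq q) y) = algebraMap ℂ _ c →
        LinearMap.mul' ℂ (GLq q) ((antipodeLin q).lTensor (GLq q) (x * y))
          = c • LinearMap.mul' ℂ (GLq q) ((antipodeLin q).lTensor (GLq q) x) := by
      intro x y c hy
      induction x using TensorProduct.induction_on with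
      | zero => simp
      | add x x' h h' => rw [add_mul, map_add, map_add, h, h', map_add, map_add, smul_add]
      | tmul b b' =>
        have : LinearMap.mul' ℂ (GLq q) ((antipodeLin q).lTensor (GLq q) (b ⊗ₜ[ℂ] b' * y))
            = b * LinearMap.mul' ℂ (GLq q) ((antipodeLin q).lTensor (GLq q) y)
              * antipodeLin q b' := by
          clear hy
          induction y using TensorProduct.induction_on with
          | zero => simp
          | add x x' h h' => rw [mul_add, map_add, map_add, h, h', map_add, map_add, mul_add, add_mul]
          | tmul a a' => simp [antipodeLin_mul, mul_assoc]
        rw [this, hy]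
        simp [Algebra.algebraMap_eq_smul_one]
    ext a
    simp only [LinearMap.comp_apply, Algebra.linearMap_apply]
    induction a using GLq.induction with
    | halg c =>
      rw [Bialgebra.comul_algebraMap, Bialgebra.counit_algebraMap]
      simp [antipodeLin]
    | hz i j =>
      rw [comul_z, counit_z]
      simp only [map_sum, LinearMap.lTensor_tmul, LinearMap.mul'_apply, antipodeLin_z,
        z_mul_Smat q (NeZero.ne q)]
      split <;> simp
    | hd =>
      rw [comul_dinv, counit_dinv]
      simp [antipodeLin_dinv, dinv_mul_det]
    | hadd a b ha hb => simp only [map_add, ha, hb]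
    | hmul a b ha hb =>
      rw [Bialgebra.comul_mul, key _ _ _ hb, ha, Bialgebra.counit_mul, mul_comm, map_mul,
        Algebra.smul_def]

theorem antipode_z (q : ℂ) [NeZero q] (i j : Fin 3) :
    HopfAlgebra.antipode ℂ (z q i j) = Smat q i j := antipodeLin_z q i j

/-! Bicovariant first order differential calculi on a Hopf algebra -/

section Calculus

/-- `(a ⊗ b)(c ⊗ ρ) = ac ⊗ bρ` on `A ⊗ Γ`. -/
noncomputable def tensorActL (A Γ : Type*) [Ring A] [Algebra ℂ A] [AddCommGroup Γ] [Module ℂ Γ]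
    [Module A Γ] [IsScalarTower ℂ A Γ] :
    A ⊗[ℂ] A →ₗ[ℂ] A ⊗[ℂ] Γ →ₗ[ℂ] A ⊗[ℂ] Γ :=
  TensorProduct.map₂ (LinearMap.mul ℂ A) (Algebra.lsmul ℂ ℂ Γ : A →ₐ[ℂ] Module.End ℂ Γ).toLinearMap

/-- `(a ⊗ b)(ρ ⊗ c) = aρ ⊗ bc` on `Γ ⊗ A`. -/
noncomputable def tensorActR (A Γ : Type*) [Ring A] [Algebra ℂ A] [AddCommGroup Γ] [Module ℂ Γ]
    [Module A Γ] [IsScalarTower ℂ A Γ] :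
    A ⊗[ℂ] A →ₗ[ℂ] Γ ⊗[ℂ] A →ₗ[ℂ] Γ ⊗[ℂ] A :=
  TensorProduct.map₂ (Algebra.lsmul ℂ ℂ Γ : A →ₐ[ℂ] Module.End ℂ Γ).toLinearMap (LinearMap.mul ℂ A)

/-- A first order differential calculus over `A`: an `A`-bimodule `Γ` (with `ρ <• a` for the right
multiplication `ρ a`) and a linear map `d : A → Γ` that satisfies the Leibniz rule and whose image
generates `Γ` as a left `A`-module. -/
structure FirstOrderCalculus (A : Type*) [Ring A] [Algebra ℂ A] where
  Γ : Type u
  [addCommGroup : AddCommGroup Γ]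
  [moduleC : Module ℂ Γ]
  [leftModule : Module A Γ]
  [rightModule : Module Aᵐᵒᵖ Γ]
  [leftTower : IsScalarTower ℂ A Γ]
  [rightTower : IsScalarTower ℂ Aᵐᵒᵖ Γ]
  [bimodule : SMulCommClass A Aᵐᵒᵖ Γ]
  d : A →ₗ[ℂ] Γ
  leibniz : ∀ a b : A, d (a * b) = d a <• b + a • d b
  span_d : Submodule.span A (Set.range d) = ⊤

attribute [instance] FirstOrderCalculus.addCommGroup FirstOrderCalculus.moduleC
  FirstOrderCalculus.leftModule FirstOrderCalculus.rightModule FirstOrderCalculus.leftTower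
  FirstOrderCalculus.rightTower FirstOrderCalculus.bimodule

/-- A bicovariant first order differential calculus over the Hopf algebra `A`, with its left and
right coactions, `Δ_L(a db) = Δ(a) (id ⊗ d)Δ(b)` and `Δ_R(a db) = Δ(a) (d ⊗ id)Δ(b)`. -/
structure BicovariantCalculus (A : Type*) [Ring A] [HopfAlgebra ℂ A] extends
    FirstOrderCalculus.{u} A where
  coL : Γ →ₗ[ℂ] A ⊗[ℂ] Γ
  coR : Γ →ₗ[ℂ] Γ ⊗[ℂ] A
  coL_smul_d : ∀ a b : A, coL (a • d b)
    = tensorActL A Γ (Coalgebra.comul (R := ℂ) a) (d.lTensor A (Coalgebra.comul (R := ℂ) b))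
  coR_smul_d : ∀ a b : A, coR (a • d b)
    = tensorActR A Γ (Coalgebra.comul (R := ℂ) a) (d.rTensor A (Coalgebra.comul (R := ℂ) b))

/-- The space `_invΓ` of left-invariant 1-forms, `Δ_L(ω) = 1 ⊗ ω`. -/
noncomputable def BicovariantCalculus.inv {A : Type*} [Ring A] [HopfAlgebra ℂ A]
    (C : BicovariantCalculus.{u} A) : Submodule ℂ C.Γ :=
  LinearMap.eqLocus C.coL (TensorProduct.mk ℂ A C.Γ 1)

/-- The convolution product `f ∗ a = (id ⊗ f)Δ(a)`. -/
noncomputable def convElem {A : Type*} [Ring A] [HopfAlgebra ℂ A] (f : A →ₗ[ℂ] ℂ) (a : A) : A :=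
  TensorProduct.rid ℂ A (f.lTensor A (Coalgebra.comul (R := ℂ) a))

/-- The convolution product of functionals, `⟨f ∗ g, a⟩ = ⟨f ⊗ g, Δ(a)⟩`. -/
noncomputable def convFun {A : Type*} [Ring A] [HopfAlgebra ℂ A] (f g : A →ₗ[ℂ] ℂ) : A →ₗ[ℂ] ℂ :=
  LinearMap.mul' ℂ ℂ ∘ₗ TensorProduct.map f g ∘ₗ Coalgebra.comul

end Calculus

/-! Calculi on `GL_q(3, ℂ)` -/

section GLCalculus

variable {q : ℂ} [NeZero q] (C : BicovariantCalculus.{u} (GLq q))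

/-- The differentials `dz^i_j` form a basis of `Γ` as a left module. -/
def HasCoordinateBasis : Prop :=
  LinearIndependent (GLq q) (fun p : Fin 3 × Fin 3 => C.d (z q p.1 p.2)) ∧
    Submodule.span (GLq q) (Set.range fun p : Fin 3 × Fin 3 => C.d (z q p.1 p.2)) = ⊤

/-- The Maurer-Cartan forms `θ^i_j = ∑_k S(z^i_k) dz^k_j`. -/
noncomputable def theta (i j : Fin 3) : C.Γ :=
  ∑ k, HopfAlgebra.antipode ℂ (z q i k) • C.d (z q k j)

/-- `Tr_q θ = q⁴ θ^1_1 + q² θ^2_2 + θ^3_3`. -/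
noncomputable def traceQ : C.Γ := q ^ 4 • theta C 0 0 + q ^ 2 • theta C 1 1 + theta C 2 2

/-- The coefficient `σ` of the first family. -/
noncomputable def sigma1 (q t : ℂ) : ℂ :=
  (q ^ 2 - t) * (t - 1) / (q ^ 4 * (q ^ 2 + 1) * (t - 1) - q ^ 2 + t)
/-- The coefficient `β` of the first family. -/
noncomputable def beta1 (q t : ℂ) : ℂ :=
  t * (q ^ 2 - 1) * (t - 1) / (q ^ 4 * (q ^ 2 + 1) * (t - 1) - q ^ 2 + t)

/-- The coefficient `σ^` of the second family. -/
noncomputable def sigma2 (q t : ℂ) : ℂ :=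
  -((q ^ 2 * t - 1) * (t - 1) / (q ^ 4 * (q ^ 2 * t - 1) + (q ^ 2 + 1) * (t - 1)))
/-- The coefficient `β^` of the second family. -/
noncomputable def beta2 (q t : ℂ) : ℂ :=
  -(t * (q ^ 2 - 1) * (t - 1) / (q ^ 4 * (q ^ 2 * t - 1) + (q ^ 2 + 1) * (t - 1)))

/-- The admissible parameters of the first family. -/
def Admissible1 (q t : ℂ) : Prop :=
  t ≠ 0 ∧ (q ^ 6 + q ^ 4 + 1) * t - (q ^ 6 + q ^ 4 + q ^ 2) ≠ 0

/-- The admissible parameters of the second family. -/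
def Admissible2 (q t : ℂ) : Prop :=
  t ≠ 0 ∧ (q ^ 6 + q ^ 2 + 1) * t - (q ^ 4 + q ^ 2 + 1) ≠ 0

/-- `C` is the calculus `Γ_1(t)`: the commutation relations of the `dz^i_j` with the `z^k_l`. -/
structure IsGamma1 (t : ℂ) : Prop where
  same : ∀ i j, C.d (z q i j) <• z q i j
    = (t / q ^ 2 + t - 1) • z q i j • C.d (z q i j)
      + sigma1 q t • (z q i j * z q i j) • traceQ C
  row : ∀ i j l, j < l → C.d (z q i j) <• z q i l
    = (t / q) • z q i l • C.d (z q i j) + (t - 1) • z q i j • C.d (z q i l)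
      + sigma1 q t • (z q i j * z q i l) • traceQ C
  col : ∀ i k j, i < k → C.d (z q i j) <• z q k j
    = (t / q) • z q k j • C.d (z q i j) + (t - 1) • z q i j • C.d (z q k j)
      + sigma1 q t • (z q i j * z q k j) • traceQ C
  diag : ∀ i k j l, i < k → j < l → C.d (z q i j) <• z q k l
    = t • z q k l • C.d (z q i j) + (t - 1) • z q i j • C.d (z q k l)
      + sigma1 q t • (z q i j * z q k l) • traceQ C
      - beta1 q t • (z q i j * z q k l - q • (z q i l * z q k j)) • traceQ C
  anti : ∀ i k j l, i < k → l < j → C.d (z q i j) <• z q k l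
    = t • z q k l • C.d (z q i j) + (t - 1) • z q i j • C.d (z q k l)
      + sigma1 q t • (z q i j * z q k l) • traceQ C
      - (t * (q - 1 / q)) • z q k j • C.d (z q i l)
      + (q * beta1 q t) • (z q i l * z q k j - q • (z q i j * z q k l)) • traceQ C

/-- `C` is the calculus `Γ_2(t)`: the commutation relations of the `dz^i_j` with the `z^k_l`. -/
structure IsGamma2 (t : ℂ) : Prop where
  same : ∀ i j, C.d (z q i j) <• z q i j
    = (t * q ^ 2 + t - 1) • z q i j • C.d (z q i j)
      + sigma2 q t • (z q i j * z q i j) • traceQ C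
  row : ∀ i j l, j < l → C.d (z q i j) <• z q i l
    = (t * q) • z q i l • C.d (z q i j) + (t * q ^ 2 - 1) • z q i j • C.d (z q i l)
      + sigma2 q t • (z q i j * z q i l) • traceQ C
  col : ∀ i k j, i < k → C.d (z q i j) <• z q k j
    = (t * q) • z q k j • C.d (z q i j) + (t * q ^ 2 - 1) • z q i j • C.d (z q k j)
      + sigma2 q t • (z q i j * z q k j) • traceQ C
  diag : ∀ i k j l, i < k → j < l → C.d (z q i j) <• z q k l
    = t • z q k l • C.d (z q i j) + (t - 1) • z q i j • C.d (z q k l)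
      + sigma2 q t • (z q i j * z q k l) • traceQ C
      + (t * (q - 1 / q)) • (z q i l • C.d (z q k j) + z q k j • C.d (z q i l))
      + (t * (q - 1 / q) ^ 2) • z q i j • C.d (z q k l)
      - (1 / q ^ 2 * beta2 q t) • (z q i j * z q k l - q • (z q i l * z q k j)) • traceQ C
  anti : ∀ i k j l, i < k → l < j → C.d (z q i j) <• z q k l
    = t • z q k l • C.d (z q i j) + (t - 1) • z q i j • C.d (z q k l)
      + sigma2 q t • (z q i j * z q k l) • traceQ C
      + (t * (q - 1 / q)) • z q i l • C.d (z q k j)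
      + (1 / q * beta2 q t) • (z q i l * z q k j - q • (z q i j * z q k l)) • traceQ C

/-- The transformation matrix of the first family,
`U^i_j^k_l = (q - q⁻¹)⁻¹ (t (R⁻¹)^i_a^k_b (R⁻¹)^b_l^a_j - δ^i_j δ^k_l)`,
with rows `(i, j)` and columns `(k, l)`. -/
noncomputable def U1 (q t : ℂ) : Matrix (Fin 3 × Fin 3) (Fin 3 × Fin 3) ℂ :=
  Matrix.of fun r c => (q - q⁻¹)⁻¹ *
    (t * ∑ a, ∑ b, (Rmat q)⁻¹ (r.1, c.1) (a, b) * (Rmat q)⁻¹ (b, a) (c.2, r.2)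
      - if r.1 = r.2 ∧ c.1 = c.2 then 1 else 0)

/-- The transformation matrix of the second family,
`U^i_j^k_l = (q - q⁻¹)⁻¹ (t R^k_a^i_b R^b_j^a_l - δ^i_j δ^k_l)`,
with rows `(i, j)` and columns `(k, l)`. -/
noncomputable def U2 (q t : ℂ) : Matrix (Fin 3 × Fin 3) (Fin 3 × Fin 3) ℂ :=
  Matrix.of fun r c => (q - q⁻¹)⁻¹ *
    (t * ∑ a, ∑ b, Rmat q (c.1, r.1) (a, b) * Rmat q (b, a) (r.2, c.2)
      - if r.1 = r.2 ∧ c.1 = c.2 then 1 else 0)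

/-- The relations `ω_i^j z^k_l = t z^k_d (R⁻¹)^d_e^a_i (R⁻¹)^j_b^e_l ω_a^b`. -/
def RMatrixRelations1 (t : ℂ) (ω : Fin 3 → Fin 3 → C.Γ) : Prop :=
  ∀ i j k l, ω i j <• z q k l = t • ∑ d, ∑ e, ∑ a, ∑ b,
    ((Rmat q)⁻¹ (d, a) (e, i) * (Rmat q)⁻¹ (j, e) (b, l)) • z q k d • ω a b

/-- The relations `ω_i^j z^k_l = t z^k_d R^a_i^d_e R^e_l^j_b ω_a^b`. -/
def RMatrixRelations2 (t : ℂ) (ω : Fin 3 → Fin 3 → C.Γ) : Prop :=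
  ∀ i j k l, ω i j <• z q k l = t • ∑ d, ∑ e, ∑ a, ∑ b,
    (Rmat q (a, d) (i, e) * Rmat q (e, j) (l, b)) • z q k d • ω a b

/-- The permutation matrix `P^i_j^k_l = δ^i_l δ^k_j`. -/
def Pmat : Matrix (Fin 3 × Fin 3) (Fin 3 × Fin 3) ℂ :=
  Matrix.of fun r c => if r.1 = c.2 ∧ r.2 = c.1 then 1 else 0

/-- `R⁺ = c⁺ P R P`. -/
noncomputable def Rplus (q c : ℂ) : Matrix (Fin 3 × Fin 3) (Fin 3 × Fin 3) ℂ :=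
  c • (Pmat * Rmat q * Pmat)

/-- `R⁻ = c⁻ R⁻¹`. -/
noncomputable def Rminus (q c : ℂ) : Matrix (Fin 3 × Fin 3) (Fin 3 × Fin 3) ℂ :=
  c • (Rmat q)⁻¹

/-- `L = (ℓ^i_j)` is the family of functionals with `⟨ℓ^i_j, z^k_l⟩ = X^i_j^k_l`,
`⟨ℓ^i_j, 1⟩ = δ^i_j` and `⟨ℓ^i_j, ab⟩ = ⟨ℓ^i_k, a⟩ ⟨ℓ^k_j, b⟩`; the last two conditions
say that `a ↦ (⟨ℓ^i_j, a⟩)` is a homomorphism of algebras. -/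
def IsLFunctional (X : Matrix (Fin 3 × Fin 3) (Fin 3 × Fin 3) ℂ)
    (L : GLq q →ₐ[ℂ] Matrix (Fin 3) (Fin 3) ℂ) : Prop :=
  ∀ i j k l, L (z q k l) i j = X (i, k) (j, l)

/-- The functional `ℓ^i_j`. -/
noncomputable def ell (L : GLq q →ₐ[ℂ] Matrix (Fin 3) (Fin 3) ℂ) (i j : Fin 3) : GLq q →ₗ[ℂ] ℂ :=
  Matrix.entryLinearMap ℂ ℂ i j ∘ₗ L.toLinearMap

/-- `C` arises by Jurco's construction from `L`, `L'` with generators `ω_i^j`: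
`ω_i^j a = (f_i^j^k_l ∗ a) ω_k^l` with `f_i^j^k_l = S'(ℓ^k_i) ∗ ℓ'^j_l` and `S'(ℓ) = ℓ ∘ S`;
`Δ_L(ω_i^j) = 1 ⊗ ω_i^j`; `Δ_R(ω_k^l) = ω_i^j ⊗ z^i_k S(z^l_j)`;
`da = (q - q⁻¹)⁻¹ [Tr ω, a]`. -/
structure IsJurco (L L' : GLq q →ₐ[ℂ] Matrix (Fin 3) (Fin 3) ℂ) (ω : Fin 3 → Fin 3 → C.Γ) :
    Prop where
  comm : ∀ i j a, ω i j <• a = ∑ k, ∑ l,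
    convElem (convFun (ell L k i ∘ₗ HopfAlgebra.antipode ℂ) (ell L' j l)) a • ω k l
  coL : ∀ i j, C.coL (ω i j) = 1 ⊗ₜ ω i j
  coR : ∀ k l, C.coR (ω k l)
    = ∑ i, ∑ j, ω i j ⊗ₜ (z q i k * HopfAlgebra.antipode ℂ (z q l j))
  d_eq : ∀ a, C.d a = (q - q⁻¹)⁻¹ • ((∑ i, ω i i) <• a - a • ∑ i, ω i i)

end GLCalculus

end QuantumGL3

open QuantumGL3

namespace QuantumGL3

/-! Index conventions and the braiding -/

/-! Write σ = PR for the braiding, λ = q - q⁻¹ and V = ℂ³. The Hecke relation σ² = λσ + 1, the braid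
relation, a constant partial quantum trace and the commutation with Z ⊗ Z hold for σ and, with λ
replaced by -λ, for σ⁻¹ = σ - λ. Both families are therefore treated at once, for a matrix `s` with
`IsHeckeBraiding`: s = σ⁻¹ for ν = 1 and s = σ for ν = 2. The calculus is encoded in the right
adjoint action ρ ↦ S(z^k_m) ρ z^m_l (`adz`) on left-invariant forms.

Suppose θ is the contraction of λ⁻¹(t s² - 1) with forms ω on which the adjoint action is given by
two copies of s. The braid and Hecke relations then yield the adjoint action on θ itself
(`adTheta_eq`); multiplying by z z and moving s across Z ⊗ Z turns it into the commutation rules of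
dz with z (`sum_zz_adTheta`, `adz_theta_iff`). The rules listed in the definition of Γ_ν(t) concern
ordered index pairs only, and the others follow because d respects the quadratic relations
(`commRHS_of_ordered`). The quantum trace of θ is μ/λ times the trace of ω, and μ (`heckeMu`) is, up
to a power of q, the denominator of σ and β in the statement. Admissibility says exactly t ≠ 0 and μ
≠ 0; in that case U is invertible (`isUnit_heckeU`), so ω is recovered from θ
(`exists_jurco_basis`).

For existence, the matrix s and its inverse represent Z by 3 × 3 matrices, by the braid relation.
This produces the functionals ℓ^±, and their convolution is an algebra homomorphism Θ from A to 9 ×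
9 matrices over A (`jurcoAction`). The free left module on the ω's with right multiplication through
Θ and d = λ⁻¹[Tr ω, ·] is the required calculus (`exists_calculus`).

For the classification, the forms S(z z) d(z z) are left-invariant, and right covariance places
their coefficients, in a suitably chosen basis, in the algebra of endomorphisms of the
corepresentation V ⊗ V ⊗ V (`exists_commutant`). For every q ≠ 0 this algebra is the Hecke algebra
generated by σ₁₂ and σ₂₃ (`exists_heckeElement`): an endomorphism is determined by the image of the
strictly decreasing basis vector, that image has the same weight, and the six standard Hecke
elements send this vector to the six basis vectors of that weight. No semisimplicity enters. Since d
respects the quadratic relations, the endomorphism commutes with σ₁₂, and four parameters a, b, x, y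
remain (`exists_adz_eq`). Finally the operators `adz` must obey the relations of Z. Three instances
of these give b(b + eλ) = 0 with e = a + bλ, together with linear equations for x and y
(`adz_relations`). The alternatives b = 0 and b = -eλ are the families ν = 2 and ν = 1. -/

/-- Matrices acting on the first two legs of a threefold tensor power. -/
noncomputable def leg12 : Matrix (Fin 3 × Fin 3) (Fin 3 × Fin 3) ℂ →ₐ[ℂ]
    Matrix (Fin 3 × Fin 3 × Fin 3) (Fin 3 × Fin 3 × Fin 3) ℂ :=
  AlgHom.ofLinearMap
    { toFun := fun X => Matrix.of fun r c =>
        if r.2.2 = c.2.2 then X (r.1, r.2.1) (c.1, c.2.1) else 0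
      map_add' := fun X Y => by ext r c; by_cases h : r.2.2 = c.2.2 <;> simp [h]
      map_smul' := fun a X => by ext r c; by_cases h : r.2.2 = c.2.2 <;> simp [h] }
    (by
      ext ⟨i, j, k⟩ ⟨l, m, n⟩
      by_cases h : k = n <;> simp [Matrix.one_apply, h])
    (fun X Y => by
      ext ⟨i, j, k⟩ ⟨l, m, n⟩
      by_cases h : k = n <;>
        simp [Matrix.mul_apply, Fintype.sum_prod_type, h])

/-- Matrices acting on the last two legs of a threefold tensor power. -/
noncomputable def leg23 : Matrix (Fin 3 × Fin 3) (Fin 3 × Fin 3) ℂ →ₐ[ℂ]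
    Matrix (Fin 3 × Fin 3 × Fin 3) (Fin 3 × Fin 3 × Fin 3) ℂ :=
  AlgHom.ofLinearMap
    { toFun := fun X => Matrix.of fun r c => if r.1 = c.1 then X r.2 c.2 else 0
      map_add' := fun X Y => by ext r c; by_cases h : r.1 = c.1 <;> simp [h]
      map_smul' := fun a X => by ext r c; by_cases h : r.1 = c.1 <;> simp [h] }
    (by
      ext ⟨i, j, k⟩ ⟨l, m, n⟩
      by_cases h : i = l <;> simp [Matrix.one_apply, h])
    (fun X Y => by
      ext ⟨i, j, k⟩ ⟨l, m, n⟩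
      by_cases h : i = l <;>
        simp [Matrix.mul_apply, Fintype.sum_prod_type, h])

theorem leg12_apply (X : Matrix (Fin 3 × Fin 3) (Fin 3 × Fin 3) ℂ) (i j k l m n : Fin 3) :
    leg12 X (i, j, k) (l, m, n) = if k = n then X (i, j) (l, m) else 0 := rfl

theorem leg23_apply (X : Matrix (Fin 3 × Fin 3) (Fin 3 × Fin 3) ℂ) (i j k l m n : Fin 3) :
    leg23 X (i, j, k) (l, m, n) = if i = l then X (j, k) (m, n) else 0 := rfl

/-- The braiding `P R`. -/
noncomputable def braiding (q : ℂ) : Matrix (Fin 3 × Fin 3) (Fin 3 × Fin 3) ℂ :=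
  Matrix.of fun r c => Rmat q (r.2, r.1) c

theorem braiding_apply (q : ℂ) (i k j l : Fin 3) :
    braiding q (i, k) (j, l) = Rmat q (k, i) (j, l) := rfl

theorem sum_braiding_left {M : Type*} [AddCommGroup M] [Module ℂ M] (q : ℂ) (i k : Fin 3)
    (f : Fin 3 → Fin 3 → M) :
    ∑ a, ∑ b, braiding q (i, k) (a, b) • f a b
      = (if i = k then q else 1) • f k i + (if i < k then q - q⁻¹ else 0) • f i k := by
  simp only [braiding_apply, sum_Rmat_left, eq_comm]

theorem sum_braiding_right {M : Type*} [AddCommGroup M] [Module ℂ M] (q : ℂ) (j l : Fin 3)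
    (f : Fin 3 → Fin 3 → M) :
    ∑ a, ∑ b, braiding q (a, b) (j, l) • f a b
      = (if j = l then q else 1) • f l j + (if j < l then q - q⁻¹ else 0) • f j l := by
  rw [Finset.sum_comm]
  simp only [braiding_apply]
  exact sum_Rmat_right q j l fun a b => f b a

theorem sum_leg12 (X : Matrix (Fin 3 × Fin 3) (Fin 3 × Fin 3) ℂ) (i j k : Fin 3)
    (F : Fin 3 × Fin 3 × Fin 3 → ℂ) :
    (leg12 X).mulVec F (i, j, k) = ∑ a, ∑ b, X (i, j) (a, b) • F (a, b, k) := by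
  simp [Matrix.mulVec, dotProduct, Fintype.sum_prod_type, leg12_apply]

theorem sum_leg23 (X : Matrix (Fin 3 × Fin 3) (Fin 3 × Fin 3) ℂ) (i j k : Fin 3)
    (F : Fin 3 × Fin 3 × Fin 3 → ℂ) :
    (leg23 X).mulVec F (i, j, k) = ∑ a, ∑ b, X (j, k) (a, b) • F (i, a, b) := by
  simp [Matrix.mulVec, dotProduct, Fintype.sum_prod_type, leg23_apply]

theorem leg12_braiding_mulVec (q : ℂ) (i j k : Fin 3) (F : Fin 3 × Fin 3 × Fin 3 → ℂ) :
    (leg12 (braiding q)).mulVec F (i, j, k)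
      = (if i = j then q else 1) * F (j, i, k) + (if i < j then q - q⁻¹ else 0) * F (i, j, k) := by
  rw [sum_leg12, sum_braiding_left q i j fun a b => F (a, b, k)]
  rfl

theorem leg23_braiding_mulVec (q : ℂ) (i j k : Fin 3) (F : Fin 3 × Fin 3 × Fin 3 → ℂ) :
    (leg23 (braiding q)).mulVec F (i, j, k)
      = (if j = k then q else 1) * F (i, k, j) + (if j < k then q - q⁻¹ else 0) * F (i, j, k) := by
  rw [sum_leg23, sum_braiding_left q j k fun a b => F (i, a, b)]
  rfl

/-- Both sides act on an arbitrary vector instead of being compared entrywise: each factor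
contributes at most two terms, so every one of the 27 index triples is a short scalar identity. -/
theorem braiding_braid (q : ℂ) (hq : q ≠ 0) :
    leg12 (braiding q) * leg23 (braiding q) * leg12 (braiding q)
      = leg23 (braiding q) * leg12 (braiding q) * leg23 (braiding q) := by
  refine Matrix.toLin'.injective (LinearMap.ext fun F => ?_)
  ext ⟨i, j, k⟩
  simp only [Matrix.toLin'_apply, ← Matrix.mulVec_mulVec, leg12_braiding_mulVec,
    leg23_braiding_mulVec]
  fin_cases i <;> fin_cases j <;> fin_cases k <;> simp <;> field_simp <;> ring_nf

theorem braiding_mulVec (q : ℂ) (i j : Fin 3) (F : Fin 3 × Fin 3 → ℂ) :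
    (braiding q).mulVec F (i, j)
      = (if i = j then q else 1) * F (j, i) + (if i < j then q - q⁻¹ else 0) * F (i, j) := by
  have h := sum_braiding_left q i j fun a b => F (a, b)
  simpa [Matrix.mulVec, dotProduct, Fintype.sum_prod_type] using h

theorem braiding_sq (q : ℂ) (hq : q ≠ 0) :
    braiding q * braiding q = (q - q⁻¹) • braiding q + 1 := by
  refine Matrix.toLin'.injective (LinearMap.ext fun F => ?_)
  ext ⟨i, j⟩
  simp only [Matrix.toLin'_apply, ← Matrix.mulVec_mulVec, Matrix.add_mulVec, Matrix.smul_mulVec,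
    Matrix.one_mulVec, Pi.add_apply, Pi.smul_apply, smul_eq_mul, braiding_mulVec]
  rcases lt_trichotomy i j with h | rfl | h
  · simp only [h, h.ne, h.ne', h.not_gt, if_true, if_false]; ring
  · simp only [lt_irrefl, if_true, if_false]; field_simp; ring
  · simp only [h, h.ne, h.ne', h.not_gt, if_true, if_false]; ring

/-- The weights of the quantum trace. -/
noncomputable def qweight (q : ℂ) : Fin 3 → ℂ := ![q ^ 4, q ^ 2, 1]

/-- The diagonal entry is q times the weight of k plus q - q⁻¹ times the sum of the earlier weights.
The weights q⁴, q², 1 are the ones that make this independent of k. -/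
theorem braiding_trace (q : ℂ) (hq : q ≠ 0) (k l : Fin 3) :
    ∑ a, qweight q a * braiding q (a, k) (a, l) = if k = l then q ^ 5 else 0 := by
  fin_cases k <;> fin_cases l <;>
    simp [Fin.sum_univ_three, qweight, braiding_apply, Rmat] <;> field_simp <;> ring

/-- The system is triangular. The entry (i, j) with i ≠ j reads off `w j i`; the diagonal entry i
involves `w i i` and the later `w k k`, so the diagonal is solved from the last index down. -/
theorem braiding_nondegenerate (q : ℂ) (hq : q ≠ 0) (w : Fin 3 → Fin 3 → ℂ)
    (hw : ∀ i j, ∑ k, ∑ l, braiding q (i, k) (j, l) * w k l = 0) : w = 0 := by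
  have h22 : w 2 2 = 0 := by
    simpa [Fin.sum_univ_three, braiding_apply, Rmat, hq] using hw 2 2
  have h11 : w 1 1 = 0 := by
    simpa [Fin.sum_univ_three, braiding_apply, Rmat, hq, h22] using hw 1 1
  have h00 : w 0 0 = 0 := by
    simpa [Fin.sum_univ_three, braiding_apply, Rmat, hq, h22, h11] using hw 0 0
  funext j i
  have h := hw i j
  fin_cases i <;> fin_cases j <;>
    first
    | assumption
    | simpa [Fin.sum_univ_three, braiding_apply, Rmat] using h

/-- The inverse braiding. -/
noncomputable def braidingInv (q : ℂ) : Matrix (Fin 3 × Fin 3) (Fin 3 × Fin 3) ℂ :=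
  braiding q - (q - q⁻¹) • 1

theorem braidingInv_mul (q : ℂ) (hq : q ≠ 0) : braidingInv q * braiding q = 1 := by
  rw [braidingInv, sub_mul, braiding_sq q hq, smul_mul_assoc, one_mul, add_sub_cancel_left]

theorem braiding_mul_inv (q : ℂ) (hq : q ≠ 0) : braiding q * braidingInv q = 1 := by
  rw [braidingInv, mul_sub, braiding_sq q hq, mul_smul_comm, mul_one, add_sub_cancel_left]

/-- Since R = Pσ, its inverse is σ⁻¹P, that is, σ⁻¹ with the two column indices exchanged. -/
theorem Rmat_inv (q : ℂ) (hq : q ≠ 0) :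
    (Rmat q)⁻¹ = Matrix.of fun r c => braidingInv q r (c.2, c.1) := by
  refine Matrix.inv_eq_left_inv ?_
  ext ⟨i, k⟩ ⟨j, l⟩
  have h := congrFun (congrFun (braidingInv_mul q hq) (i, k)) (j, l)
  simp only [Matrix.mul_apply, Fintype.sum_prod_type, Matrix.of_apply] at h ⊢
  rw [Finset.sum_comm, ← h]
  rfl

theorem Rmat_inv_apply (q : ℂ) (hq : q ≠ 0) (i k j l : Fin 3) :
    (Rmat q)⁻¹ (i, k) (j, l) = braidingInv q (i, k) (l, j) := by
  rw [Rmat_inv q hq]; rfl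

/-- A braiding on `ℂ³` of Hecke type (with parameter `p`, and with constant partial quantum trace
`c`) that is compatible with the relations of `GLq q`. -/
structure IsHeckeBraiding (q p c : ℂ) (s : Matrix (Fin 3 × Fin 3) (Fin 3 × Fin 3) ℂ) : Prop where
  sq : s * s = p • s + 1
  braid : leg12 s * leg23 s * leg12 s = leg23 s * leg12 s * leg23 s
  trace : ∀ k l, ∑ a, qweight q a * s (a, k) (a, l) = if k = l then c else 0
  comm : ∀ i k j l, ∑ a, ∑ b, s (i, k) (a, b) • (z q a j * z q b l)
    = ∑ a, ∑ b, s (a, b) (j, l) • (z q i a * z q k b)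
  nondegenerate : ∀ w : Fin 3 → Fin 3 → ℂ, (∀ i j, ∑ k, ∑ l, s (i, k) (j, l) * w k l = 0) →
    ∑ k, w k k = 0 → w = 0

theorem isHeckeBraiding_braiding (q : ℂ) (hq : q ≠ 0) :
    IsHeckeBraiding q (q - q⁻¹) (q ^ 5) (braiding q) where
  sq := braiding_sq q hq
  braid := braiding_braid q hq
  trace := braiding_trace q hq
  comm i k j l := by
    have h := (rtt_iff q hq (z q)).2 (isQMatrix_z q) k i j l
    simp only [braiding_apply]
    rw [h, Finset.sum_comm]
  nondegenerate w hw _ := braiding_nondegenerate q hq w hw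

/-- Everything follows from σ⁻¹ = σ - λ. In the braid relation the Hecke relation makes the
lower-order terms symmetric in the two legs, and the partial trace is q⁵ - (q - q⁻¹)(q⁴ + q² + 1) =
q⁻¹. -/
theorem isHeckeBraiding_braidingInv (q : ℂ) (hq : q ≠ 0) :
    IsHeckeBraiding q (-(q - q⁻¹)) q⁻¹ (braidingInv q) where
  sq := by
    rw [braidingInv, sub_mul, mul_sub, mul_sub, braiding_sq q hq]
    simp only [smul_mul_assoc, mul_smul_comm, one_mul, mul_one]
    module
  braid := by
    have h := braiding_braid q hq
    have h1 := congrArg leg12 (braiding_sq q hq)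
    have h2 := congrArg leg23 (braiding_sq q hq)
    simp only [map_mul, map_add, map_smul, map_one] at h1 h2
    simp only [braidingInv, map_sub, map_smul, map_one, sub_mul, mul_sub, smul_mul_assoc,
      mul_smul_comm, one_mul, mul_one, h, h1, h2]
    module
  trace k l := by
    simp only [braidingInv, Matrix.sub_apply, mul_sub, Finset.sum_sub_distrib,
      braiding_trace q hq, Matrix.smul_apply, Matrix.one_apply, Prod.mk.injEq, true_and]
    by_cases h : k = l
    · simp [h, qweight, Fin.sum_univ_three]; field_simp; ring
    · simp [h]
  comm i k j l := by
    have h := (isHeckeBraiding_braiding q hq).comm i k j l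
    simp only [braidingInv, Matrix.sub_apply, sub_smul, Finset.sum_sub_distrib, h,
      Matrix.smul_apply, Matrix.one_apply, smul_eq_mul]
    simp [ite_and]
  -- Contracting the identity matrix with w gives the trace of w times δ, so for traceless w the
  -- contractions with σ and with σ⁻¹ agree.
  nondegenerate w hw htr := by
    refine braiding_nondegenerate q hq w fun i j => ?_
    have h : ∑ k, ∑ l, braiding q (i, k) (j, l) * w k l
        = ∑ k, ∑ l, braidingInv q (i, k) (j, l) * w k l
          + (q - q⁻¹) * if i = j then ∑ k, w k k else 0 := by
      simp only [braidingInv, Matrix.sub_apply, Matrix.smul_apply, Matrix.one_apply, sub_mul,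
        Finset.sum_sub_distrib, Prod.mk.injEq, smul_eq_mul]
      by_cases hij : i = j <;> simp [hij, Finset.mul_sum]
    rw [h, hw, htr]
    simp

/-! Bicovariant calculi with a coordinate basis -/

theorem sum_rotate_three {M : Type*} [AddCommMonoid M] (F : Fin 3 → Fin 3 → Fin 3 → M) :
    ∑ a, ∑ b, ∑ c, F a b c = ∑ b, ∑ c, ∑ a, F a b c := by
  rw [Finset.sum_comm]
  exact Finset.sum_congr rfl fun b _ => Finset.sum_comm

theorem sum_rotate_four {M : Type*} [AddCommMonoid M] (F : Fin 3 → Fin 3 → Fin 3 → Fin 3 → M) :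
    ∑ a, ∑ b, ∑ c, ∑ d, F a b c d = ∑ b, ∑ c, ∑ d, ∑ a, F a b c d := by
  rw [Finset.sum_comm]
  exact Finset.sum_congr rfl fun b _ => sum_rotate_three fun a c d => F a b c d

theorem sum_swap_pairs {M : Type*} [AddCommMonoid M] (F : Fin 3 → Fin 3 → Fin 3 → Fin 3 → M) :
    ∑ a, ∑ b, ∑ c, ∑ d, F a b c d = ∑ c, ∑ d, ∑ a, ∑ b, F a b c d := by
  rw [sum_rotate_four, sum_rotate_four]

theorem z_mul_Smat_mul (q : ℂ) (hq : q ≠ 0) (i j : Fin 3) (w : GLq q) :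
    ∑ k, z q i k * (Smat q k j * w) = if i = j then w else 0 := by
  simp only [← mul_assoc, ← Finset.sum_mul, z_mul_Smat q hq, ite_mul, one_mul, zero_mul]

theorem Smat_mul_z_mul (q : ℂ) (hq : q ≠ 0) (i j : Fin 3) (w : GLq q) :
    ∑ k, Smat q i k * (z q k j * w) = if i = j then w else 0 := by
  simp only [← mul_assoc, ← Finset.sum_mul, Smat_mul_z q hq, ite_mul, one_mul, zero_mul]

section Cancellation

variable {q : ℂ} [NeZero q] {N : Type*} [AddCommGroup N] [Module ℂ N]

/-- The matrix Z is invertible with inverse S(Z), and this survives in every representation of A.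
The lemma is later used for the action on Γ and, through Δ, for the actions on A ⊗ Γ and Γ ⊗ A. -/
theorem cancel_z (φ : GLq q →ₐ[ℂ] Module.End ℂ N) {T T' : Fin 3 → N}
    (h : ∀ i, ∑ m, φ (z q i m) (T m) = ∑ m, φ (z q i m) (T' m)) : T = T' := by
  have key : ∀ (T : Fin 3 → N) j, ∑ i, φ (Smat q j i) (∑ m, φ (z q i m) (T m)) = T j := by
    intro T j
    simp only [map_sum, ← Module.End.mul_apply, ← map_mul]
    rw [Finset.sum_comm]
    simp only [← LinearMap.sum_apply, ← map_sum, Smat_mul_z q (NeZero.ne q)]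
    simp only [apply_ite φ, map_zero, map_one]
    rw [Finset.sum_eq_single j] <;> simp +contextual [eq_comm]
  funext j
  rw [← key T j, ← key T' j]
  simp only [h]

theorem cancel_zz (φ : GLq q →ₐ[ℂ] Module.End ℂ N) {T T' : Fin 3 → Fin 3 → N}
    (h : ∀ i k, ∑ m, ∑ n, φ (z q i m) (φ (z q k n) (T m n))
      = ∑ m, ∑ n, φ (z q i m) (φ (z q k n) (T' m n))) : T = T' := by
  have h1 : ∀ k, (fun m => ∑ n, φ (z q k n) (T m n)) = fun m => ∑ n, φ (z q k n) (T' m n) :=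
    fun k => cancel_z φ fun i => by simpa only [map_sum] using h i k
  funext m
  exact cancel_z φ fun k => congrFun (h1 k) m

end Cancellation

section TensorAction

variable (A Γ : Type*) [Ring A] [Algebra ℂ A] [AddCommGroup Γ] [Module ℂ Γ]
    [Module A Γ] [IsScalarTower ℂ A Γ]

theorem tensorActL_mul (x y : A ⊗[ℂ] A) (w : A ⊗[ℂ] Γ) :
    tensorActL A Γ (x * y) w = tensorActL A Γ x (tensorActL A Γ y w) := by
  induction x using TensorProduct.induction_on with
  | zero => simp
  | add x x' h h' => simp only [add_mul, map_add, LinearMap.add_apply, h, h']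
  | tmul a b =>
    induction y using TensorProduct.induction_on with
    | zero => simp
    | add y y' h h' => simp only [mul_add, map_add, LinearMap.add_apply, h, h']
    | tmul c d =>
      induction w using TensorProduct.induction_on with
      | zero => simp
      | add w w' h h' => simp only [map_add, h, h']
      | tmul e ρ => simp [tensorActL, mul_assoc]

theorem tensorActR_mul (x y : A ⊗[ℂ] A) (w : Γ ⊗[ℂ] A) :
    tensorActR A Γ (x * y) w = tensorActR A Γ x (tensorActR A Γ y w) := by
  induction x using TensorProduct.induction_on with
  | zero => simp
  | add x x' h h' => simp only [add_mul, map_add, LinearMap.add_apply, h, h']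
  | tmul a b =>
    induction y using TensorProduct.induction_on with
    | zero => simp
    | add y y' h h' => simp only [mul_add, map_add, LinearMap.add_apply, h, h']
    | tmul c d =>
      induction w using TensorProduct.induction_on with
      | zero => simp
      | add w w' h h' => simp only [map_add, h, h']
      | tmul e ρ => simp [tensorActR, mul_assoc]

@[simp] theorem tensorActL_tmul (a b c : A) (ρ : Γ) :
    tensorActL A Γ (a ⊗ₜ b) (c ⊗ₜ ρ) = (a * c) ⊗ₜ (b • ρ) := rfl

@[simp] theorem tensorActR_tmul (a b c : A) (ρ : Γ) :
    tensorActR A Γ (a ⊗ₜ b) (ρ ⊗ₜ c) = (a • ρ) ⊗ₜ (b * c) := rfl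

theorem tensorActL_one (w : A ⊗[ℂ] Γ) : tensorActL A Γ 1 w = w := by
  induction w using TensorProduct.induction_on with
  | zero => simp
  | add w w' h h' => simp only [map_add, h, h']
  | tmul e ρ => simp [Algebra.TensorProduct.one_def]

theorem tensorActR_one (w : Γ ⊗[ℂ] A) : tensorActR A Γ 1 w = w := by
  induction w using TensorProduct.induction_on with
  | zero => simp
  | add w w' h h' => simp only [map_add, h, h']
  | tmul e ρ => simp [Algebra.TensorProduct.one_def]

/-- The action of `A ⊗ A` on `A ⊗ Γ`. -/
noncomputable def actL : A ⊗[ℂ] A →ₐ[ℂ] Module.End ℂ (A ⊗[ℂ] Γ) :=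
  AlgHom.ofLinearMap (tensorActL A Γ) (LinearMap.ext (tensorActL_one A Γ))
    fun x y => LinearMap.ext (tensorActL_mul A Γ x y)

/-- The action of `A ⊗ A` on `Γ ⊗ A`. -/
noncomputable def actR : A ⊗[ℂ] A →ₐ[ℂ] Module.End ℂ (Γ ⊗[ℂ] A) :=
  AlgHom.ofLinearMap (tensorActR A Γ) (LinearMap.ext (tensorActR_one A Γ))
    fun x y => LinearMap.ext (tensorActR_mul A Γ x y)

end TensorAction

/-! ### Coactions on the Maurer-Cartan forms and on their quadratic analogues -/

section Basic

variable {q : ℂ} [NeZero q] (C : BicovariantCalculus.{u} (GLq q))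

/-- The axioms prescribe the coaction on the forms a db only; these span Γ, and Δ is multiplicative.
-/
theorem coL_smul (a : GLq q) (ρ : C.Γ) : C.coL (a • ρ)
    = tensorActL (GLq q) C.Γ (Coalgebra.comul (R := ℂ) a) (C.coL ρ) := by
  have hρ : ρ ∈ Submodule.span (GLq q) (Set.range C.d) := C.span_d ▸ Submodule.mem_top
  revert a
  induction hρ using Submodule.span_induction with
  | mem x hx =>
    obtain ⟨b, rfl⟩ := hx
    intro a
    have h := C.coL_smul_d 1 b
    rw [one_smul, Bialgebra.comul_one, tensorActL_one] at h
    rw [C.coL_smul_d, h]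
  | zero => simp
  | add x y _ _ hx hy => intro a; rw [smul_add, map_add, hx, hy, map_add, map_add]
  | smul b x _ hx => intro a; rw [smul_smul, hx, hx, Bialgebra.comul_mul, tensorActL_mul]

theorem coR_smul (a : GLq q) (ρ : C.Γ) : C.coR (a • ρ)
    = tensorActR (GLq q) C.Γ (Coalgebra.comul (R := ℂ) a) (C.coR ρ) := by
  have hρ : ρ ∈ Submodule.span (GLq q) (Set.range C.d) := C.span_d ▸ Submodule.mem_top
  revert a
  induction hρ using Submodule.span_induction with
  | mem x hx =>
    obtain ⟨b, rfl⟩ := hx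
    intro a
    have h := C.coR_smul_d 1 b
    rw [one_smul, Bialgebra.comul_one, tensorActR_one] at h
    rw [C.coR_smul_d, h]
  | zero => simp
  | add x y _ _ hx hy => intro a; rw [smul_add, map_add, hx, hy, map_add, map_add]
  | smul b x _ hx => intro a; rw [smul_smul, hx, hx, Bialgebra.comul_mul, tensorActR_mul]

theorem coL_d (a : GLq q) : C.coL (C.d a)
    = C.d.lTensor (GLq q) (Coalgebra.comul (R := ℂ) a) := by
  have h := C.coL_smul_d 1 a
  rwa [one_smul, Bialgebra.comul_one, tensorActL_one] at h

theorem coR_d (a : GLq q) : C.coR (C.d a)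
    = C.d.rTensor (GLq q) (Coalgebra.comul (R := ℂ) a) := by
  have h := C.coR_smul_d 1 a
  rwa [one_smul, Bialgebra.comul_one, tensorActR_one] at h

theorem sum_Smat_z_smul (f : Fin 3 → C.Γ) (i : Fin 3) :
    ∑ k, Smat q i k • ∑ j, z q k j • f j = f i := by
  simp only [Finset.smul_sum, smul_smul]
  rw [Finset.sum_comm]
  simp only [← Finset.sum_smul, Smat_mul_z q (NeZero.ne q), ite_smul, one_smul, zero_smul]
  simp

theorem sum_z_Smat_smul (f : Fin 3 → C.Γ) (i : Fin 3) :
    ∑ k, z q i k • ∑ j, Smat q k j • f j = f i := by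
  simp only [Finset.smul_sum, smul_smul]
  rw [Finset.sum_comm]
  simp only [← Finset.sum_smul, z_mul_Smat q (NeZero.ne q), ite_smul, one_smul, zero_smul]
  simp

theorem theta_eq (i j : Fin 3) : theta C i j = ∑ k, Smat q i k • C.d (z q k j) := by
  simp only [theta, antipode_z]

theorem d_z_eq (i j : Fin 3) : C.d (z q i j) = ∑ k, z q i k • theta C k j := by
  simp only [theta_eq]
  rw [sum_z_Smat_smul C (fun l => C.d (z q l j)) i]

/-- The form `S(z^i_m z^k_n) d(z^m_j z^n_l)`. -/
noncomputable def theta2 (i k j l : Fin 3) : C.Γ :=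
  ∑ n, Smat q k n • ∑ m, Smat q i m • C.d (z q m j * z q n l)

theorem d_zz_eq (i k j l : Fin 3) :
    C.d (z q i j * z q k l) = ∑ m, ∑ n, z q i m • z q k n • theta2 C m n j l := by
  simp only [theta2, ← Finset.smul_sum]
  simp only [sum_z_Smat_smul C (fun n => ∑ m', Smat q _ m' • C.d (z q m' j * z q n l)) k]
  rw [sum_z_Smat_smul C (fun n => C.d (z q n j * z q k l)) i]

/-- After multiplication by Δ(Z) both sides become (id ⊗ d)Δ(z), and Δ(Z) can be cancelled. -/
theorem coL_theta (i j : Fin 3) : C.coL (theta C i j) = 1 ⊗ₜ theta C i j := by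
  refine congrFun (cancel_z (((actL (GLq q) C.Γ).comp (Bialgebra.comulAlgHom ℂ (GLq q))))
    (T := fun i => C.coL (theta C i j)) (T' := fun i => 1 ⊗ₜ theta C i j) fun i => ?_) i
  simp only [AlgHom.comp_apply, Bialgebra.comulAlgHom_apply]
  change ∑ m, tensorActL _ _ _ _ = ∑ m, tensorActL _ _ _ _
  simp only [← coL_smul]
  rw [← map_sum, ← d_z_eq, coL_d]
  simp only [comul_z, map_sum, LinearMap.sum_apply, tensorActL_tmul, mul_one,
    LinearMap.lTensor_tmul, d_z_eq, TensorProduct.tmul_sum]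
  exact Finset.sum_comm

theorem coL_theta2 (i k j l : Fin 3) : C.coL (theta2 C i k j l) = 1 ⊗ₜ theta2 C i k j l := by
  refine congrFun (congrFun (cancel_zz
    (((actL (GLq q) C.Γ).comp (Bialgebra.comulAlgHom ℂ (GLq q))))
    (T := fun i k => C.coL (theta2 C i k j l))
    (T' := fun i k => 1 ⊗ₜ theta2 C i k j l) fun i k => ?_) i) k
  simp only [AlgHom.comp_apply, Bialgebra.comulAlgHom_apply]
  change ∑ m, ∑ n, tensorActL _ _ _ (tensorActL _ _ _ _)
    = ∑ m, ∑ n, tensorActL _ _ _ (tensorActL _ _ _ _)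
  simp only [← coL_smul]
  simp only [← map_sum]
  rw [← d_zz_eq, coL_d, Bialgebra.comul_mul, comul_z, comul_z, Finset.sum_mul_sum]
  simp only [map_sum, Algebra.TensorProduct.tmul_mul_tmul, LinearMap.lTensor_tmul, d_zz_eq,
    TensorProduct.tmul_sum]
  simp only [comul_z, map_sum, LinearMap.sum_apply, tensorActL_tmul, mul_one]
  simp only [Fin.sum_univ_three]
  abel

theorem coR_theta (i j : Fin 3) : C.coR (theta C i j)
    = ∑ c, ∑ u, theta C c u ⊗ₜ (Smat q i c * z q u j) := by
  refine congrFun (cancel_z (((actR (GLq q) C.Γ).comp (Bialgebra.comulAlgHom ℂ (GLq q))))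
    (T := fun i => C.coR (theta C i j))
    (T' := fun i => ∑ c, ∑ u, theta C c u ⊗ₜ (Smat q i c * z q u j)) fun i => ?_) i
  simp only [AlgHom.comp_apply, Bialgebra.comulAlgHom_apply]
  change ∑ m, tensorActR _ _ _ _ = ∑ m, tensorActR _ _ _ _
  simp only [← coR_smul]
  rw [← map_sum, ← d_z_eq, coR_d]
  simp only [comul_z, map_sum, LinearMap.sum_apply, tensorActR_tmul, LinearMap.rTensor_tmul, d_z_eq,
    TensorProduct.sum_tmul]
  rw [sum_rotate_four]
  simp only [← TensorProduct.tmul_sum, z_mul_Smat_mul q (NeZero.ne q),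
    TensorProduct.tmul_ite, Finset.sum_ite_eq', Finset.mem_univ, if_true]
  rw [Finset.sum_comm]

/-- The coefficient condition expressing right covariance of `theta2`. -/
theorem coR_theta2 (i k j l : Fin 3) :
    ∑ p, ∑ r, tensorActR (GLq q) C.Γ (1 ⊗ₜ (z q i p * z q k r)) (C.coR (theta2 C p r j l))
      = ∑ u, ∑ v, theta2 C i k u v ⊗ₜ (z q u j * z q v l) := by
  refine congrFun (congrFun (cancel_zz
    (((actR (GLq q) C.Γ).comp Algebra.TensorProduct.includeLeft))
    (T := fun i k => ∑ p, ∑ r, tensorActR (GLq q) C.Γ (1 ⊗ₜ (z q i p * z q k r))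
      (C.coR (theta2 C p r j l)))
    (T' := fun i k => ∑ u, ∑ v, theta2 C i k u v ⊗ₜ (z q u j * z q v l)) fun i k => ?_) i) k
  simp only [AlgHom.comp_apply, Algebra.TensorProduct.includeLeft_apply]
  change ∑ m, ∑ n, tensorActR _ _ _ (tensorActR _ _ _ _)
    = ∑ m, ∑ n, tensorActR _ _ _ (tensorActR _ _ _ _)
  -- The coaction on d(zz) is computed once from (d ⊗ id)Δ and once from the expansion of d(zz) in
  -- `theta2`; only the factors z z in the left tensor slot are then cancelled.
  have h : C.coR (C.d (z q i j * z q k l)) = ∑ u, ∑ v, ∑ m, ∑ n,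
      (z q i m • z q k n • theta2 C m n u v) ⊗ₜ[ℂ] (z q u j * z q v l) := by
    rw [coR_d, Bialgebra.comul_mul, comul_z, comul_z, Finset.sum_mul_sum]
    simp only [map_sum, Algebra.TensorProduct.tmul_mul_tmul, LinearMap.rTensor_tmul, d_zz_eq,
      TensorProduct.sum_tmul]
  rw [d_zz_eq] at h
  simp only [map_sum, coR_smul, ← tensorActR_mul, Algebra.TensorProduct.tmul_mul_tmul, mul_one,
    one_mul, tensorActR_tmul, smul_smul] at h ⊢
  rw [sum_swap_pairs]
  conv_rhs => rw [sum_swap_pairs]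
  rw [← h]
  simp only [Bialgebra.comul_mul, comul_z, Finset.sum_mul_sum, map_sum, LinearMap.sum_apply,
    Algebra.TensorProduct.tmul_mul_tmul]

end Basic

/-! ### Left-invariant forms -/

section InvariantForms

variable {q : ℂ} [NeZero q] {C : BicovariantCalculus.{u} (GLq q)}

theorem linearIndependent_theta (hC : HasCoordinateBasis C) :
    LinearIndependent (GLq q) (fun p : Fin 3 × Fin 3 => theta C p.1 p.2) := by
  rw [Fintype.linearIndependent_iff]
  intro g hg
  have h1 : ∑ p : Fin 3 × Fin 3, (∑ i, g (i, p.2) * Smat q i p.1) • C.d (z q p.1 p.2) = 0 := by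
    rw [← hg]
    simp only [Fintype.sum_prod_type, theta_eq, Finset.smul_sum, Finset.sum_smul, mul_smul]
    rw [sum_rotate_three, sum_rotate_three]
    exact Finset.sum_congr rfl fun i _ => Finset.sum_comm
  have h2 := Fintype.linearIndependent_iff.1 hC.1 _ h1
  rintro ⟨i, j⟩
  have h3 : ∑ k, (∑ l, g (l, j) * Smat q l k) * z q k i = g (i, j) := by
    simp only [Finset.sum_mul, mul_assoc]
    rw [Finset.sum_comm]
    simp only [← Finset.mul_sum, Smat_mul_z q (NeZero.ne q)]
    simp
  rw [← h3]
  exact Finset.sum_eq_zero fun k _ => by rw [h2 (k, j), zero_mul]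

theorem span_theta (hC : HasCoordinateBasis C) :
    Submodule.span (GLq q) (Set.range fun p : Fin 3 × Fin 3 => theta C p.1 p.2) = ⊤ := by
  rw [eq_top_iff, ← hC.2, Submodule.span_le]
  rintro _ ⟨⟨i, j⟩, rfl⟩
  simp only [d_z_eq, SetLike.mem_coe]
  exact Submodule.sum_mem _ fun k _ => Submodule.smul_mem _ _ (Submodule.subset_span ⟨(k, j), rfl⟩)

theorem algebraMap_GLq_injective (q : ℂ) : Function.Injective (algebraMap ℂ (GLq q)) := by
  intro a b h
  simpa using congrArg (counitGL q) h

theorem linearIndependent_theta_complex (hC : HasCoordinateBasis C) :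
    LinearIndependent ℂ (fun p : Fin 3 × Fin 3 => theta C p.1 p.2) := by
  rw [Fintype.linearIndependent_iff]
  intro g hg p
  refine algebraMap_GLq_injective q ?_
  rw [map_zero]
  refine Fintype.linearIndependent_iff.1 (linearIndependent_theta hC)
    (fun p => algebraMap ℂ _ (g p)) ?_ p
  simpa only [algebraMap_smul] using hg

theorem mem_inv_iff (ρ : C.Γ) : ρ ∈ C.inv ↔ C.coL ρ = 1 ⊗ₜ ρ := Iff.rfl

/-- The Maurer-Cartan forms are a left A-basis of invariant forms, so invariance of ρ forces Δ(a) =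
1 ⊗ a for each coefficient a. Applying the counit to the second factor shows that a is a scalar. -/
theorem inv_le_span_theta (hC : HasCoordinateBasis C) :
    C.inv ≤ Submodule.span ℂ (Set.range fun p : Fin 3 × Fin 3 => theta C p.1 p.2) := by
  intro ρ hρ
  let b := Module.Basis.mk (linearIndependent_theta hC) (span_theta hC).ge
  have hb : ∀ p, b p = theta C p.1 p.2 := fun p => by simp [b]
  have hsum : ρ = ∑ p, b.repr ρ p • theta C p.1 p.2 := by
    conv_lhs => rw [← b.sum_repr ρ]
    simp only [hb]
  let coord (p : Fin 3 × Fin 3) : C.Γ →ₗ[ℂ] GLq q := (b.coord p).restrictScalars ℂ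
  have hcoord : ∀ p r, coord p (theta C r.1 r.2) = if r = p then 1 else 0 := fun p r => by
    simp [coord, ← hb, Finsupp.single_apply]
  have key : ∀ p r (x : GLq q ⊗[ℂ] GLq q), (coord p).lTensor (GLq q)
      (tensorActL (GLq q) C.Γ x (1 ⊗ₜ theta C r.1 r.2)) = if r = p then x else 0 := by
    intro p r x
    induction x using TensorProduct.induction_on with
    | zero => simp
    | add x y hx hy =>
      rw [map_add, LinearMap.add_apply, map_add, hx, hy]
      split <;> simp
    | tmul a c =>
      have : coord p (c • theta C r.1 r.2) = c * coord p (theta C r.1 r.2) := by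
        simp [coord]
      rw [tensorActL_tmul, LinearMap.lTensor_tmul, this, hcoord]
      split <;> simp
  have hc : ∀ p, b.repr ρ p = algebraMap ℂ _ (Coalgebra.counit (R := ℂ) (b.repr ρ p)) := by
    intro p
    have h1 : (coord p).lTensor (GLq q) (C.coL ρ) = Coalgebra.comul (R := ℂ) (b.repr ρ p) := by
      conv_lhs => rw [hsum]
      simp only [map_sum, coL_smul, coL_theta, key]
      simp
    rw [(mem_inv_iff ρ).1 hρ, LinearMap.lTensor_tmul] at h1
    have h2 := Coalgebra.lTensor_counit_comul (R := ℂ) (b.repr ρ p)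
    rw [← h1, LinearMap.lTensor_tmul] at h2
    have h3 := congrArg (TensorProduct.rid ℂ (GLq q)) h2
    rw [TensorProduct.rid_tmul, TensorProduct.rid_tmul, one_smul] at h3
    rw [Algebra.algebraMap_eq_smul_one]
    exact h3.symm
  rw [hsum]
  refine Submodule.sum_mem _ fun p _ => ?_
  rw [hc p, algebraMap_smul]
  exact Submodule.smul_mem _ _ (Submodule.subset_span ⟨p, rfl⟩)

/-- The Maurer-Cartan forms as a basis of the left-invariant forms. -/
theorem exists_inv_basis (hC : HasCoordinateBasis C) (M N : Matrix (Fin 3 × Fin 3) (Fin 3 × Fin 3) ℂ)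
    (hMN : M * N = 1) : ∃ ω : Module.Basis (Fin 3 × Fin 3) ℂ C.inv,
      (∀ p, (ω p : C.Γ) = ∑ r, N p r • theta C r.1 r.2) ∧
      ∀ p, theta C p.1 p.2 = ∑ r, M p r • (ω r : C.Γ) := by
  have hmem : ∀ p, ∑ r : Fin 3 × Fin 3, N p r • theta C r.1 r.2 ∈ C.inv := fun p =>
    Submodule.sum_mem _ fun r _ => Submodule.smul_mem _ _ (coL_theta C r.1 r.2)
  have hθ : ∀ p : Fin 3 × Fin 3, theta C p.1 p.2
      = ∑ r, M p r • ∑ r' : Fin 3 × Fin 3, N r r' • theta C r'.1 r'.2 := fun p => by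
    simp only [Finset.smul_sum, smul_smul]
    rw [Finset.sum_comm]
    simp only [← Finset.sum_smul, ← Matrix.mul_apply, hMN, Matrix.one_apply, ite_smul, one_smul,
      zero_smul]
    simp
  let v : Fin 3 × Fin 3 → C.inv := fun p => ⟨_, hmem p⟩
  have hspan : ⊤ ≤ Submodule.span ℂ (Set.range v) := by
    rintro ⟨ρ, hρ⟩ -
    have h1 : Submodule.span ℂ (Set.range fun p : Fin 3 × Fin 3 => theta C p.1 p.2)
        ≤ (Submodule.span ℂ (Set.range v)).map C.inv.subtype := by
      rw [Submodule.span_le]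
      rintro _ ⟨p, rfl⟩
      simp only [hθ p, SetLike.mem_coe]
      exact Submodule.sum_mem _ fun r _ => Submodule.smul_mem _ _
        ⟨v r, Submodule.subset_span ⟨r, rfl⟩, rfl⟩
    obtain ⟨y, hy, hyρ⟩ := h1 (inv_le_span_theta hC hρ)
    have hy' : (⟨ρ, hρ⟩ : C.inv) = y := Subtype.ext hyρ.symm
    rwa [hy']
  have hfin : LinearIndependent ℂ v := by
    have hli : LinearIndependent ℂ (fun p : Fin 3 × Fin 3 =>
        (⟨theta C p.1 p.2, coL_theta C p.1 p.2⟩ : C.inv)) :=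
      LinearIndependent.of_comp C.inv.subtype (linearIndependent_theta_complex hC)
    rw [Fintype.linearIndependent_iff]
    intro g hg
    have h1 : ∑ r : Fin 3 × Fin 3, (∑ p, g p * N p r) • theta C r.1 r.2 = 0 := by
      have := congrArg (Subtype.val) hg
      simp only [v, Submodule.coe_sum, Submodule.coe_smul, ZeroMemClass.coe_zero,
        Finset.smul_sum, smul_smul] at this
      rw [← this, Finset.sum_comm]
      simp only [Finset.sum_smul]
    have h2 := Fintype.linearIndependent_iff.1 (linearIndependent_theta_complex hC) _ h1
    have h3 : Matrix.vecMul g N = 0 := funext fun r => h2 r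
    have h4 : Matrix.vecMul (Matrix.vecMul g N) M = g := by
      rw [Matrix.vecMul_vecMul, mul_eq_one_comm.1 hMN, Matrix.vecMul_one]
    rw [h3, Matrix.zero_vecMul] at h4
    exact fun p => congrFun h4.symm p
  refine ⟨Module.Basis.mk hfin hspan, fun p => ?_, fun p => ?_⟩
  · rw [Module.Basis.mk_apply]
  · simp only [Module.Basis.mk_apply]
    exact hθ p

end InvariantForms
/-! Partial contractions -/

section Contraction

variable {M : Type*} [AddCommGroup M] [Module ℂ M]

/-- The contraction of the second leg of `X` with an array. -/
noncomputable def contract2 (X : Matrix (Fin 3 × Fin 3) (Fin 3 × Fin 3) ℂ) (ω : Fin 3 → Fin 3 → M)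
    (i j : Fin 3) : M :=
  ∑ k, ∑ l, X (i, k) (j, l) • ω k l

/-- The contraction of the third leg of `Y` with an array. -/
noncomputable def contract3
    (Y : Matrix (Fin 3 × Fin 3 × Fin 3) (Fin 3 × Fin 3 × Fin 3) ℂ) (ω : Fin 3 → Fin 3 → M)
    (i k j l : Fin 3) : M :=
  ∑ m, ∑ n, Y (i, k, m) (j, l, n) • ω m n

theorem contract3_add (Y Y' : Matrix (Fin 3 × Fin 3 × Fin 3) (Fin 3 × Fin 3 × Fin 3) ℂ)
    (ω : Fin 3 → Fin 3 → M) (i k j l : Fin 3) :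
    contract3 (Y + Y') ω i k j l = contract3 Y ω i k j l + contract3 Y' ω i k j l := by
  simp only [contract3, Matrix.add_apply, add_smul, Finset.sum_add_distrib]

theorem contract3_smul (c : ℂ) (Y : Matrix (Fin 3 × Fin 3 × Fin 3) (Fin 3 × Fin 3 × Fin 3) ℂ)
    (ω : Fin 3 → Fin 3 → M) (i k j l : Fin 3) :
    contract3 (c • Y) ω i k j l = c • contract3 Y ω i k j l := by
  simp only [contract3, Matrix.smul_apply, Finset.smul_sum, smul_assoc]

theorem contract3_leg23 (X : Matrix (Fin 3 × Fin 3) (Fin 3 × Fin 3) ℂ) (ω : Fin 3 → Fin 3 → M)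
    (i k j l : Fin 3) :
    contract3 (leg23 X) ω i k j l = if i = j then contract2 X ω k l else 0 := by
  simp only [contract3, contract2, leg23_apply]
  split <;> simp

theorem contract3_leg12 (X : Matrix (Fin 3 × Fin 3) (Fin 3 × Fin 3) ℂ) (ω : Fin 3 → Fin 3 → M)
    (i k j l : Fin 3) :
    contract3 (leg12 X) ω i k j l = X (i, k) (j, l) • ∑ m, ω m m := by
  simp [contract3, leg12_apply, ite_smul, Finset.smul_sum]

/-- A matrix on the first two legs does not meet the contracted third leg: as a left factor it acts
on the free row indices, as a right factor on the free column indices. -/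
theorem contract3_leg12_mul (X : Matrix (Fin 3 × Fin 3) (Fin 3 × Fin 3) ℂ)
    (Y : Matrix (Fin 3 × Fin 3 × Fin 3) (Fin 3 × Fin 3 × Fin 3) ℂ) (ω : Fin 3 → Fin 3 → M)
    (i k j l : Fin 3) :
    contract3 (leg12 X * Y) ω i k j l = ∑ a, ∑ b, X (i, k) (a, b) • contract3 Y ω a b j l := by
  simp only [contract3, Matrix.mul_apply, Fintype.sum_prod_type, leg12_apply, Finset.smul_sum,
    Finset.sum_smul, smul_smul, ite_mul, zero_mul, Finset.sum_ite_eq, Finset.mem_univ, if_true]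
  rw [sum_swap_pairs]

theorem contract3_mul_leg12 (X : Matrix (Fin 3 × Fin 3) (Fin 3 × Fin 3) ℂ)
    (Y : Matrix (Fin 3 × Fin 3 × Fin 3) (Fin 3 × Fin 3 × Fin 3) ℂ) (ω : Fin 3 → Fin 3 → M)
    (i k j l : Fin 3) :
    contract3 (Y * leg12 X) ω i k j l = ∑ a, ∑ b, X (a, b) (j, l) • contract3 Y ω i k a b := by
  simp only [contract3, Matrix.mul_apply, Fintype.sum_prod_type, leg12_apply, Finset.smul_sum,
    Finset.sum_smul, smul_smul, mul_ite, mul_zero, Finset.sum_ite_eq', Finset.mem_univ, if_true]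
  rw [sum_swap_pairs]
  simp only [mul_comm]

/-- The right-hand side is, up to the factor t, what the relations of the generating forms produce
when the adjoint action is applied to the contraction of X with ω. This turns the adjoint action on
θ into a computation with matrices on three legs. -/
theorem contract3_leg23_mul_mul (s X : Matrix (Fin 3 × Fin 3) (Fin 3 × Fin 3) ℂ)
    (ω : Fin 3 → Fin 3 → M) (i k j l : Fin 3) :
    contract3 (leg23 s * leg12 X * leg23 s) ω i k j l
      = ∑ m, ∑ n, X (i, m) (j, n) • ∑ e, ∑ a, ∑ b, (s (k, a) (m, e) * s (n, e) (l, b)) • ω a b := by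
  simp only [contract3, Matrix.mul_apply, Fintype.sum_prod_type, leg12_apply, leg23_apply,
    mul_ite, mul_zero, ite_mul, zero_mul, Finset.sum_ite_eq, Finset.sum_ite_eq', Finset.mem_univ,
    if_true, Finset.sum_const_zero, Finset.sum_ite_irrel, Finset.smul_sum, Finset.sum_smul,
    Finset.sum_mul, smul_smul]
  rw [sum_swap_pairs]
  conv_rhs => rw [sum_rotate_three]
  refine Finset.sum_congr rfl fun n _ => Finset.sum_congr rfl fun e _ => ?_
  conv_rhs => rw [sum_rotate_three]
  refine Finset.sum_congr rfl fun a _ => Finset.sum_congr rfl fun b _ =>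
    Finset.sum_congr rfl fun m _ => ?_
  congr 1
  ring

end Contraction

/-! ### Relations of the generating forms and the adjoint action on Maurer-Cartan forms -/

section HeckeRelations

variable {q : ℂ} [NeZero q] (C : BicovariantCalculus.{u} (GLq q))

/-- The right adjoint action of `z^k_l` on forms, `ρ ↦ S(z^k_m) ρ z^m_l`. -/
noncomputable def adz (k l : Fin 3) : C.Γ →ₗ[ℂ] C.Γ where
  toFun ρ := ∑ m, Smat q k m • (ρ <• z q m l)
  map_add' ρ ρ' := by simp only [smul_add, Finset.sum_add_distrib]
  map_smul' c ρ := by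
    simp only [Finset.smul_sum, RingHom.id_apply]
    refine Finset.sum_congr rfl fun m _ => ?_
    rw [smul_comm (MulOpposite.op _) c ρ, smul_comm _ c]

theorem adz_apply (k l : Fin 3) (ρ : C.Γ) : adz C k l ρ = ∑ m, Smat q k m • (ρ <• z q m l) := rfl

theorem smul_z_eq (ρ : C.Γ) (k l : Fin 3) : ρ <• z q k l = ∑ m, z q k m • adz C m l ρ := by
  simp only [adz_apply]
  rw [sum_z_Smat_smul C (fun m => ρ <• z q m l)]

theorem adz_eq_of {ρ : C.Γ} {l : Fin 3} {T : Fin 3 → C.Γ}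
    (h : ∀ k, ρ <• z q k l = ∑ m, z q k m • T m) (k : Fin 3) : adz C k l ρ = T k := by
  simp only [adz_apply, h]
  rw [sum_Smat_z_smul C T]

/-- The relations between the generating forms `ω_i^j` and the coordinates given by a braiding. -/
def HeckeRelations (s : Matrix (Fin 3 × Fin 3) (Fin 3 × Fin 3) ℂ) (t : ℂ)
    (ω : Fin 3 → Fin 3 → C.Γ) : Prop :=
  ∀ i j k l, adz C k l (ω i j) = t • ∑ e, ∑ a, ∑ b, (s (k, a) (i, e) * s (j, e) (l, b)) • ω a b

theorem heckeRelations_iff (s : Matrix (Fin 3 × Fin 3) (Fin 3 × Fin 3) ℂ) (t : ℂ)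
    (ω : Fin 3 → Fin 3 → C.Γ) : HeckeRelations C s t ω ↔ ∀ i j k l, ω i j <• z q k l
      = t • ∑ d, ∑ e, ∑ a, ∑ b, (s (d, a) (i, e) * s (j, e) (l, b)) • z q k d • ω a b := by
  have key : ∀ i j k l, t • ∑ d, ∑ e, ∑ a, ∑ b,
      (s (d, a) (i, e) * s (j, e) (l, b)) • z q k d • ω a b = ∑ d, z q k d • (t • ∑ e, ∑ a, ∑ b,
        (s (d, a) (i, e) * s (j, e) (l, b)) • ω a b) := fun i j k l => by
    simp only [Finset.smul_sum]
    refine Finset.sum_congr rfl fun d _ => Finset.sum_congr rfl fun e _ =>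
      Finset.sum_congr rfl fun a _ => Finset.sum_congr rfl fun b _ => ?_
    rw [smul_comm (z q k d) t, smul_comm (z q k d)]
  simp only [key]
  constructor
  · intro h i j k l
    rw [smul_z_eq]
    simp only [h i j]
  · intro h i j k l
    exact adz_eq_of C (fun k => h i j k l) k

theorem rMatrixRelations1_iff (t : ℂ) (ω : Fin 3 → Fin 3 → C.Γ) :
    RMatrixRelations1 C t ω ↔ HeckeRelations C (braidingInv q) t ω := by
  rw [heckeRelations_iff]
  simp only [RMatrixRelations1, Rmat_inv_apply q (NeZero.ne q)]

theorem rMatrixRelations2_iff (t : ℂ) (ω : Fin 3 → Fin 3 → C.Γ) :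
    RMatrixRelations2 C t ω ↔ HeckeRelations C (braiding q) t ω := by
  rw [heckeRelations_iff]
  simp only [RMatrixRelations2, braiding_apply]

/-- The matrix of the passage from the generating forms to the Maurer-Cartan forms. -/
noncomputable def heckeU (q t : ℂ) (s : Matrix (Fin 3 × Fin 3) (Fin 3 × Fin 3) ℂ) :
    Matrix (Fin 3 × Fin 3) (Fin 3 × Fin 3) ℂ :=
  Matrix.of fun r c => ((q - q⁻¹)⁻¹ • (t • (s * s) - 1)) (r.1, c.1) (r.2, c.2)

theorem U1_eq (q t : ℂ) (hq : q ≠ 0) : U1 q t = heckeU q t (braidingInv q) := by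
  ext ⟨i, j⟩ ⟨k, l⟩
  simp only [U1, heckeU, Matrix.of_apply, Rmat_inv_apply q hq, Matrix.smul_apply, Matrix.sub_apply,
    Matrix.mul_apply, Fintype.sum_prod_type, smul_eq_mul, Matrix.one_apply, Prod.mk.injEq]
  rw [Finset.sum_comm]

theorem U2_eq (q t : ℂ) : U2 q t = heckeU q t (braiding q) := by
  ext ⟨i, j⟩ ⟨k, l⟩
  simp only [U2, heckeU, Matrix.of_apply, braiding_apply, Matrix.smul_apply, Matrix.sub_apply,
    Matrix.mul_apply, Fintype.sum_prod_type, smul_eq_mul, Matrix.one_apply, Prod.mk.injEq]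

/-- The matrix whose contraction with the generating forms gives the Maurer-Cartan forms. -/
noncomputable def heckeX (q p t : ℂ) (s : Matrix (Fin 3 × Fin 3) (Fin 3 × Fin 3) ℂ) :
    Matrix (Fin 3 × Fin 3) (Fin 3 × Fin 3) ℂ :=
  (q - q⁻¹)⁻¹ • ((t * p) • s + (t - 1) • 1)

/-- The scalar that relates the quantum trace of the Maurer-Cartan forms to the trace of the
generating forms. -/
noncomputable def heckeMu (q p c t : ℂ) : ℂ := (q ^ 4 + q ^ 2 + 1) * (t - 1) + t * p * c

variable {C} {p c : ℂ} {s : Matrix (Fin 3 × Fin 3) (Fin 3 × Fin 3) ℂ}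

theorem heckeU_apply (hs : IsHeckeBraiding q p c s) (t : ℂ) (i j k l : Fin 3) :
    heckeU q t s (i, j) (k, l) = heckeX q p t s (i, k) (j, l) := by
  have : t • (s * s) - 1 = (t * p) • s + (t - 1) • 1 := by rw [hs.sq]; module
  simp only [heckeU, heckeX, this, Matrix.of_apply]

theorem traceQ_eq (C : BicovariantCalculus.{u} (GLq q)) :
    traceQ C = ∑ a, qweight q a • theta C a a := by
  simp [traceQ, qweight, Fin.sum_univ_three]

/-- The partial quantum trace of `heckeX` over its first leg is a multiple of the identity, because
that of s is the constant c and that of 1 is q⁴ + q² + 1. -/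
theorem traceQ_eq_trace (hs : IsHeckeBraiding q p c s) {t : ℂ} {ω : Fin 3 → Fin 3 → C.Γ}
    (hθ : ∀ i j, theta C i j = contract2 (heckeX q p t s) ω i j) :
    traceQ C = ((q - q⁻¹)⁻¹ * heckeMu q p c t) • ∑ k, ω k k := by
  have h1 : ∀ k l, ∑ a, qweight q a * heckeX q p t s (a, k) (a, l)
      = if k = l then (q - q⁻¹)⁻¹ * heckeMu q p c t else 0 := by
    intro k l
    have h2 : ∑ a, qweight q a * heckeX q p t s (a, k) (a, l)
        = (q - q⁻¹)⁻¹ * ((t * p) * ∑ a, qweight q a * s (a, k) (a, l)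
          + (t - 1) * ∑ a, qweight q a * if k = l then 1 else 0) := by
      simp only [heckeX, Matrix.smul_apply, Matrix.add_apply, Matrix.one_apply, smul_eq_mul,
        Prod.mk.injEq, true_and, Finset.mul_sum, mul_add, Finset.sum_add_distrib]
      congr 1 <;> exact Finset.sum_congr rfl fun a _ => by ring
    rw [h2, hs.trace]
    by_cases h : k = l
    · simp only [h, if_true, heckeMu, qweight, Fin.sum_univ_three, Matrix.cons_val_zero,
        Matrix.cons_val_one, Matrix.cons_val]
      ring
    · simp [h]
  simp only [traceQ_eq, hθ, contract2, Finset.smul_sum, smul_smul]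
  rw [sum_rotate_three]
  simp only [← Finset.sum_smul, h1, ite_smul, zero_smul]
  simp

/-- The adjoint action of the coordinates on the Maurer-Cartan forms. -/
noncomputable def adTheta (s : Matrix (Fin 3 × Fin 3) (Fin 3 × Fin 3) ℂ) (t x y : ℂ)
    (C : BicovariantCalculus.{u} (GLq q)) (i k j l : Fin 3) : C.Γ :=
  (t - 1) • (if i = j then theta C k l else 0)
    + t • (∑ a, ∑ b, s (a, b) (j, l) • ∑ d, ∑ e, s (i, k) (d, e) •
        if d = a then theta C e b else 0)
    + (x * (if i = j ∧ k = l then 1 else 0) + y * s (i, k) (j, l)) • traceQ C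

/-- With λX = tps + (t - 1), the braid relation exchanges s₂₃X₁₂s₂₃ for s₁₂X₂₃s₁₂ up to a multiple
of s₂₃² - s₁₂² = p(s₂₃ - s₁₂). The s₂₃ part becomes (t - 1)X₂₃ up to a scalar; what remains is -(t -
1)² - pt(t - 1)s₁₂ on the first two legs, whose contraction is a multiple of the trace. The
conditions on x and y express this remainder through the quantum trace of θ. -/
theorem adTheta_eq (hs : IsHeckeBraiding q p c s) {t x y : ℂ} {ω : Fin 3 → Fin 3 → C.Γ}
    (hθ : ∀ i j, theta C i j = contract2 (heckeX q p t s) ω i j)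
    (hx : heckeMu q p c t * x = -(t - 1) ^ 2) (hy : heckeMu q p c t * y = -(p * t * (t - 1)))
    (i k j l : Fin 3) : adTheta s t x y C i k j l
      = t • contract3 (leg23 s * leg12 (heckeX q p t s) * leg23 s) ω i k j l := by
  have h1 := hs.braid
  have h2 := congrArg leg12 hs.sq
  have h3 := congrArg leg23 hs.sq
  simp only [map_mul, map_add, map_smul, map_one] at h2 h3
  have h4 : t • (leg23 s * leg12 (heckeX q p t s) * leg23 s)
      = (t - 1) • leg23 (heckeX q p t s)
        + t • (leg12 s * leg23 (heckeX q p t s) * leg12 s)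
        + ((q - q⁻¹)⁻¹ * heckeMu q p c t) • leg12 (x • 1 + y • s) := by
    have h5 : ((q - q⁻¹)⁻¹ * heckeMu q p c t) • leg12 (x • 1 + y • s)
        = ((q - q⁻¹)⁻¹ * (heckeMu q p c t * x)) • 1
          + ((q - q⁻¹)⁻¹ * (heckeMu q p c t * y)) • leg12 s := by
      simp only [map_add, map_smul, map_one]
      module
    rw [h5, hx, hy]
    simp only [heckeX, map_add, map_smul, map_one, mul_add, add_mul, smul_mul_assoc,
      mul_smul_comm, mul_one, h2, h3, ← h1, smul_add]
    module
  rw [← contract3_smul, h4, contract3_add, contract3_add, contract3_smul, contract3_smul,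
    contract3_smul, contract3_leg23, contract3_mul_leg12, contract3_leg12, adTheta,
    traceQ_eq_trace hs hθ]
  simp only [contract3_leg12_mul, contract3_leg23, ← hθ, Matrix.add_apply, Matrix.smul_apply,
    Matrix.one_apply, Prod.mk.injEq, smul_eq_mul]
  module

/-- The relations of the generating forms determine the adjoint action on the Maurer-Cartan
forms. -/
theorem HeckeRelations.adz_theta (hs : IsHeckeBraiding q p c s) {t x y : ℂ}
    {ω : Fin 3 → Fin 3 → C.Γ} (h : HeckeRelations C s t ω)
    (hθ : ∀ i j, theta C i j = contract2 (heckeX q p t s) ω i j)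
    (hx : heckeMu q p c t * x = -(t - 1) ^ 2) (hy : heckeMu q p c t * y = -(p * t * (t - 1)))
    (i k j l : Fin 3) : adz C k l (theta C i j) = adTheta s t x y C i k j l := by
  rw [adTheta_eq hs hθ hx hy, contract3_leg23_mul_mul, hθ, contract2]
  simp only [map_sum, map_smul, h _ _ k l, Finset.smul_sum]
  simp only [smul_comm t]

/-- Conversely, the adjoint action on the Maurer-Cartan forms determines the relations of the
generating forms. -/
theorem heckeRelations_of_adz_theta (hs : IsHeckeBraiding q p c s) {t x y : ℂ}
    {ω : Fin 3 → Fin 3 → C.Γ} (N : Matrix (Fin 3 × Fin 3) (Fin 3 × Fin 3) ℂ)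
    (hN : ∀ i j, ω i j = ∑ r, N (i, j) r • theta C r.1 r.2)
    (hNU : N * heckeU q t s = 1)
    (hθ : ∀ i j, theta C i j = contract2 (heckeX q p t s) ω i j)
    (hx : heckeMu q p c t * x = -(t - 1) ^ 2) (hy : heckeMu q p c t * y = -(p * t * (t - 1)))
    (h : ∀ i k j l, adz C k l (theta C i j) = adTheta s t x y C i k j l) :
    HeckeRelations C s t ω := by
  intro i j k l
  have h1 : ∀ i' j', adz C k l (theta C i' j') = ∑ r, heckeU q t s (i', j') r •
      t • ∑ e, ∑ a, ∑ b, (s (k, a) (r.1, e) * s (r.2, e) (l, b)) • ω a b := fun i' j' => by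
    rw [h, adTheta_eq hs hθ hx hy, contract3_leg23_mul_mul, Fintype.sum_prod_type]
    simp only [heckeU_apply hs, Finset.smul_sum, smul_comm t]
  rw [hN, map_sum]
  simp only [map_smul, h1]
  -- The adjoint action on θ is U applied to the expected action on ω, and N is a left inverse of U.
  have h2 : ∀ F : Fin 3 × Fin 3 → C.Γ,
      ∑ x, N (i, j) x • ∑ r, heckeU q t s x r • F r = F (i, j) := fun F => by
    simp only [Finset.smul_sum, smul_smul]
    rw [Finset.sum_comm]
    simp only [← Finset.sum_smul, ← Matrix.mul_apply, hNU, Matrix.one_apply, ite_smul, one_smul,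
      zero_smul]
    simp
  exact h2 fun r => t • ∑ e, ∑ a, ∑ b, (s (k, a) (r.1, e) * s (r.2, e) (l, b)) • ω a b

end HeckeRelations

/-! ### Right coaction on the generating forms and invertibility of U -/

section Covariance

variable {q : ℂ} [NeZero q] {C : BicovariantCalculus.{u} (GLq q)}
  {p c : ℂ} {s : Matrix (Fin 3 × Fin 3) (Fin 3 × Fin 3) ℂ}

/-- The exchange relations between the coordinates and their antipodes. -/
theorem cross_relation {X : Matrix (Fin 3 × Fin 3) (Fin 3 × Fin 3) ℂ}
    (hX : ∀ i k j l, ∑ a, ∑ b, X (i, k) (a, b) • (z q a j * z q b l)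
      = ∑ a, ∑ b, X (a, b) (j, l) • (z q i a * z q k b)) (i j a b : Fin 3) :
    ∑ d, ∑ u, X (d, a) (u, b) • (Smat q i d * z q u j)
      = ∑ k, ∑ l, X (i, k) (j, l) • (z q a k * Smat q l b) := by
  -- The relation X Z₁Z₂ = Z₁Z₂ X is multiplied by S(Z) on the first leg from the left and on the
  -- second leg from the right; `hL` and `hR` evaluate its two sides.
  have hL : ∑ d, ∑ l, Smat q i d * (∑ u, ∑ v, X (d, a) (u, v) • (z q u j * z q v l)) * Smat q l b
      = ∑ d, ∑ u, X (d, a) (u, b) • (Smat q i d * z q u j) := by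
    refine Finset.sum_congr rfl fun d _ => ?_
    simp only [Finset.mul_sum, Finset.sum_mul, mul_smul_comm, smul_mul_assoc]
    rw [sum_rotate_three]
    refine Finset.sum_congr rfl fun u _ => ?_
    simp only [← Finset.smul_sum, mul_assoc, ← Finset.mul_sum, z_mul_Smat q (NeZero.ne q)]
    simp
  have hR : ∑ d, ∑ l, Smat q i d * (∑ u, ∑ v, X (u, v) (j, l) • (z q d u * z q a v)) * Smat q l b
      = ∑ k, ∑ l, X (i, k) (j, l) • (z q a k * Smat q l b) := by
    rw [Finset.sum_comm]
    conv_rhs => rw [Finset.sum_comm]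
    refine Finset.sum_congr rfl fun l _ => ?_
    rw [← Finset.sum_mul]
    simp only [← smul_mul_assoc, ← Finset.sum_mul]
    congr 1
    simp only [Finset.mul_sum, smul_mul_assoc, mul_smul_comm]
    rw [sum_rotate_three]
    simp only [← Finset.smul_sum, Smat_mul_z_mul q (NeZero.ne q)]
    rw [Finset.sum_comm]
    simp
  rw [← hL, ← hR]
  simp only [hX]

theorem IsHeckeBraiding.heckeX_comm (hs : IsHeckeBraiding q p c s) (t : ℂ) (i k j l : Fin 3) :
    ∑ a, ∑ b, heckeX q p t s (i, k) (a, b) • (z q a j * z q b l)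
      = ∑ a, ∑ b, heckeX q p t s (a, b) (j, l) • (z q i a * z q k b) := by
  have h1 := hs.comm i k j l
  have h2 : ∑ a, ∑ b, (1 : Matrix (Fin 3 × Fin 3) (Fin 3 × Fin 3) ℂ) (i, k) (a, b) •
      (z q a j * z q b l) = ∑ a, ∑ b, (1 : Matrix (Fin 3 × Fin 3) (Fin 3 × Fin 3) ℂ) (a, b) (j, l) •
      (z q i a * z q k b) := by
    simp [Matrix.one_apply, ite_and]
  simp only [heckeX, Matrix.smul_apply, Matrix.add_apply, add_smul, smul_eq_mul, mul_smul,
    Finset.sum_add_distrib, smul_add, ← Finset.smul_sum, h1, h2]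

/-- The right coaction on the generating forms. -/
theorem coR_generating {X N : Matrix (Fin 3 × Fin 3) (Fin 3 × Fin 3) ℂ}
    (hX : ∀ i k j l, ∑ a, ∑ b, X (i, k) (a, b) • (z q a j * z q b l)
      = ∑ a, ∑ b, X (a, b) (j, l) • (z q i a * z q k b)) {ω : Fin 3 → Fin 3 → C.Γ}
    (hN : ∀ i j, ω i j = ∑ r, N (i, j) r • theta C r.1 r.2)
    (hNX : N * Matrix.of (fun r c => X (r.1, c.1) (r.2, c.2)) = 1)
    (hθ : ∀ i j, theta C i j = contract2 X ω i j) (k l : Fin 3) :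
    C.coR (ω k l) = ∑ i, ∑ j, ω i j ⊗ₜ (z q i k * Smat q l j) := by
  -- The exchange relation lets X pass from the forms to the coefficients S(z) z, turning them into
  -- z S(z). Hence the coaction on θ is X applied to the asserted coaction on ω, and X is then
  -- inverted.
  have h1 : ∀ i j, C.coR (theta C i j) = ∑ r : Fin 3 × Fin 3, X (i, r.1) (j, r.2) •
      ∑ a, ∑ b, ω a b ⊗ₜ[ℂ] (z q a r.1 * Smat q r.2 b) := by
    intro i j
    rw [coR_theta, Fintype.sum_prod_type]
    simp only [hθ, contract2, TensorProduct.sum_tmul, TensorProduct.smul_tmul, Finset.smul_sum,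
      ← TensorProduct.tmul_smul]
    rw [sum_swap_pairs]
    conv_rhs => rw [sum_swap_pairs]
    simp only [← TensorProduct.tmul_sum, cross_relation hX]
  rw [hN, map_sum]
  simp only [map_smul, h1]
  have h2 : ∀ F : Fin 3 × Fin 3 → C.Γ ⊗[ℂ] GLq q,
      ∑ x, N (k, l) x • ∑ r : Fin 3 × Fin 3, X (x.1, r.1) (x.2, r.2) • F r = F (k, l) := fun F => by
    simp only [Finset.smul_sum, smul_smul]
    rw [Finset.sum_comm]
    have h3 : ∀ r : Fin 3 × Fin 3, ∑ x, N (k, l) x * X (x.1, r.1) (x.2, r.2)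
        = if (k, l) = r then 1 else 0 := fun r => by
      rw [← Matrix.one_apply, ← hNX, Matrix.mul_apply]
      rfl
    simp only [← Finset.sum_smul, h3, ite_smul, one_smul, zero_smul]
    simp
  exact h2 fun r => ∑ a, ∑ b, ω a b ⊗ₜ[ℂ] (z q a r.1 * Smat q r.2 b)

/-- For w in the kernel of U, the quantum trace of the contraction gives μ Tr w = 0, so Tr w = 0.
Then only the term with s remains, its coefficient contains tp ≠ 0, and nondegeneracy of s on
traceless arrays gives w = 0. -/
theorem isUnit_heckeU (hs : IsHeckeBraiding q p c s) {t : ℂ} (hq : q - q⁻¹ ≠ 0) (hp : p ≠ 0)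
    (ht : t ≠ 0) (hμ : heckeMu q p c t ≠ 0) : IsUnit (heckeU q t s) := by
  rw [← Matrix.mulVec_injective_iff_isUnit]
  rw [← Matrix.coe_mulVecLin, injective_iff_map_eq_zero]
  intro w hw
  have h0 : ∀ i j, contract2 (heckeX q p t s) (fun k l => w (k, l)) i j = 0 := fun i j => by
    have := congrFun hw (i, j)
    simpa [Matrix.mulVec, dotProduct, Fintype.sum_prod_type, heckeU_apply hs, contract2] using this
  have h1 : ∀ i j, contract2 (heckeX q p t s) (fun k l => w (k, l)) i j
      = (q - q⁻¹)⁻¹ * (t * p * (∑ k, ∑ l, s (i, k) (j, l) * w (k, l))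
        + (t - 1) * if i = j then ∑ k, w (k, k) else 0) := fun i j => by
    simp only [contract2, heckeX, Matrix.smul_apply, Matrix.add_apply, Matrix.one_apply,
      smul_eq_mul, Prod.mk.injEq, Finset.mul_sum, mul_add, add_mul, Finset.sum_add_distrib]
    congr 1
    · exact Finset.sum_congr rfl fun k _ => Finset.sum_congr rfl fun l _ => by ring
    · by_cases hij : i = j <;> simp [hij, Finset.mul_sum, mul_assoc]
  have htr : ∑ k, w (k, k) = 0 := by
    have h2 : ∑ a, qweight q a * contract2 (heckeX q p t s) (fun k l => w (k, l)) a a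
        = (q - q⁻¹)⁻¹ * heckeMu q p c t * ∑ k, w (k, k) := by
      have h3 : ∑ a, qweight q a * ∑ k, ∑ l, s (a, k) (a, l) * w (k, l) = c * ∑ k, w (k, k) := by
        simp only [Finset.mul_sum, ← mul_assoc]
        rw [sum_rotate_three]
        simp only [← Finset.sum_mul, hs.trace]
        simp
      have h4 : ∑ a, qweight q a = q ^ 4 + q ^ 2 + 1 := by simp [qweight, Fin.sum_univ_three]
      simp only [h1, if_true]
      have h5 : ∀ (S : Fin 3 → ℂ) (T : ℂ), ∑ a, qweight q a * S a = c * T →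
          ∑ a, qweight q a * ((q - q⁻¹)⁻¹ * (t * p * S a + (t - 1) * T))
            = (q - q⁻¹)⁻¹ * heckeMu q p c t * T := fun S T h => by
        rw [Fin.sum_univ_three] at h h4 ⊢
        rw [heckeMu]
        linear_combination (q - q⁻¹)⁻¹ * t * p * h + (q - q⁻¹)⁻¹ * (t - 1) * T * h4
      exact h5 _ _ h3
    simpa [h0, hq, hμ, sub_eq_zero] using h2.symm
  have h5 := hs.nondegenerate (fun k l => w (k, l)) (fun i j => by
    have h6 := h0 i j
    rw [h1, htr] at h6
    simpa [hq, ht, hp] using h6) htr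
  funext r
  exact congrFun (congrFun h5 r.1) r.2

end Covariance

/-! The structure functionals of Jurčo's construction -/

section Functionals

variable {q : ℂ} [NeZero q]

/-- The remaining generator is the inverse of a polynomial in the z's. Stability under two-sided
inverses is usually easier to check than the property at 𝒟⁻¹ directly. -/
theorem GLq.induction_of_inverse {p : GLq q → Prop} (halg : ∀ c : ℂ, p (algebraMap ℂ _ c))
    (hz : ∀ i j, p (z q i j)) (hadd : ∀ a b, p a → p b → p (a + b))
    (hmul : ∀ a b, p a → p b → p (a * b))
    (hinv : ∀ a b, a * b = 1 → b * a = 1 → p a → p b) (a : GLq q) : p a := by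
  let S : Subalgebra ℂ (GLq q) :=
    { carrier := {a | p a}
      mul_mem' := fun {a b} => hmul a b
      add_mem' := fun {a b} => hadd a b
      algebraMap_mem' := halg }
  have hz' : ∀ i j, z q i j ∈ S := hz
  have hdet : qdet q (z q) ∈ S := by
    unfold qdet
    have h3 : ∀ i j k l m n, z q i j * z q k l * z q m n ∈ S := fun i j k l m n =>
      S.mul_mem (S.mul_mem (hz' i j) (hz' k l)) (hz' m n)
    exact S.sub_mem (S.sub_mem (S.sub_mem (S.add_mem (S.add_mem (h3 _ _ _ _ _ _)
      (S.smul_mem (h3 _ _ _ _ _ _) _)) (S.smul_mem (h3 _ _ _ _ _ _) _))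
      (S.smul_mem (h3 _ _ _ _ _ _) _)) (S.smul_mem (h3 _ _ _ _ _ _) _))
      (S.smul_mem (h3 _ _ _ _ _ _) _)
  exact GLq.induction halg hz (hinv _ _ (det_mul_dinv q) (dinv_mul_det q) hdet) hadd hmul a

variable (L L' : GLq q →ₐ[ℂ] Matrix (Fin 3) (Fin 3) ℂ)

/-- The functional `f_i^j^k_l`. -/
noncomputable def jurcoF (i j k l : Fin 3) : GLq q →ₗ[ℂ] ℂ :=
  convFun (ell L k i ∘ₗ HopfAlgebra.antipode ℂ) (ell L' j l)

/-- The matrix of functionals on a tensor square whose composition with the coproduct is `f`. -/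
noncomputable def kroneckerPairing :
    GLq q ⊗[ℂ] GLq q →ₗ[ℂ] Matrix (Fin 3 × Fin 3) (Fin 3 × Fin 3) ℂ :=
  TensorProduct.lift (LinearMap.mk₂ ℂ
    (fun a b => Matrix.kroneckerMap (· * ·) (L (antipodeLin q a)).transpose (L' b))
    (fun a a' b => by simp [Matrix.transpose_add, Matrix.add_kronecker])
    (fun r a b => by simp [Matrix.transpose_smul, Matrix.smul_kronecker])
    (fun a b b' => by simp [Matrix.kronecker_add])
    (fun r a b => by simp [Matrix.kronecker_smul]))

/-- The antipode and the transposition both reverse products, so a ↦ L(S(a))ᵀ is multiplicative. -/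
theorem kroneckerPairing_mul (x y : GLq q ⊗[ℂ] GLq q) :
    kroneckerPairing L L' (x * y) = kroneckerPairing L L' x * kroneckerPairing L L' y := by
  induction x using TensorProduct.induction_on with
  | zero => simp
  | add x x' h h' => simp only [add_mul, map_add, h, h']
  | tmul a b =>
    induction y using TensorProduct.induction_on with
    | zero => simp
    | add y y' h h' => simp only [mul_add, map_add, h, h']
    | tmul c d =>
      simp only [kroneckerPairing, Algebra.TensorProduct.tmul_mul_tmul, TensorProduct.lift.tmul,
        LinearMap.mk₂_apply, antipodeLin_mul, map_mul, Matrix.transpose_mul]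
      exact Matrix.mul_kronecker_mul _ _ _ _

/-- The homomorphism `a ↦ (f_i^j^k_l(a))`. -/
noncomputable def jurcoHom : GLq q →ₐ[ℂ] Matrix (Fin 3 × Fin 3) (Fin 3 × Fin 3) ℂ :=
  AlgHom.ofLinearMap (kroneckerPairing L L' ∘ₗ Coalgebra.comul)
    (by
      simp only [LinearMap.comp_apply, Bialgebra.comul_one, Algebra.TensorProduct.one_def,
        kroneckerPairing, TensorProduct.lift.tmul, LinearMap.mk₂_apply]
      have : antipodeLin q 1 = 1 := HopfAlgebra.antipode_one (R := ℂ)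
      simp [this])
    (fun a b => by
      simp only [LinearMap.comp_apply, Bialgebra.comul_mul, kroneckerPairing_mul])

theorem jurcoHom_apply (a : GLq q) (i j k l : Fin 3) :
    jurcoHom L L' a (i, j) (k, l) = jurcoF L L' i j k l a := by
  simp only [jurcoHom, jurcoF, convFun, AlgHom.ofLinearMap_apply, LinearMap.comp_apply]
  induction (Coalgebra.comul (R := ℂ) a) using TensorProduct.induction_on with
  | zero => simp
  | add x y hx hy => simp only [map_add, Matrix.add_apply, hx, hy]
  | tmul x y => rfl

/-- The homomorphism `a ↦ (f_i^j^k_l ∗ a)`. -/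
noncomputable def jurcoAction : GLq q →ₐ[ℂ] Matrix (Fin 3 × Fin 3) (Fin 3 × Fin 3) (GLq q) :=
  -- Scalar matrices with entries in A commute with matrices with entries in ℂ, so the two
  -- embeddings combine to a homomorphism on A ⊗ A, which is composed with Δ.
  (Algebra.TensorProduct.lift (Matrix.scalarAlgHom (Fin 3 × Fin 3) ℂ)
    ((Algebra.ofId ℂ (GLq q)).mapMatrix.comp (jurcoHom L L')) (fun a b => by
      ext r c
      simp [Matrix.mul_apply, Matrix.diagonal_apply, Algebra.ofId_apply, Algebra.commutes])).comp
    (Bialgebra.comulAlgHom ℂ (GLq q))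

theorem jurcoAction_apply (a : GLq q) (r c : Fin 3 × Fin 3) : jurcoAction L L' a r c
    = TensorProduct.rid ℂ (GLq q) ((Matrix.entryLinearMap ℂ ℂ r c ∘ₗ
      (jurcoHom L L').toLinearMap).lTensor (GLq q) (Coalgebra.comul (R := ℂ) a)) := by
  simp only [jurcoAction, AlgHom.comp_apply, Bialgebra.comulAlgHom_apply]
  induction (Coalgebra.comul (R := ℂ) a) using TensorProduct.induction_on with
  | zero => simp
  | add x y hx hy => simp only [map_add, Matrix.add_apply, hx, hy]
  | tmul x y =>
    change (Matrix.scalarAlgHom (Fin 3 × Fin 3) ℂ x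
      * (Algebra.ofId ℂ (GLq q)).mapMatrix (jurcoHom L L' y)) r c = _
    simp [Matrix.mul_apply, Matrix.diagonal_apply, Algebra.ofId_apply, Algebra.smul_def,
      Algebra.commutes]

theorem jurcoAction_eq_convElem (a : GLq q) (i j k l : Fin 3) :
    jurcoAction L L' a (i, j) (k, l) = convElem (jurcoF L L' i j k l) a := by
  rw [jurcoAction_apply, convElem]
  congr 2
  congr 1
  exact LinearMap.ext fun b => jurcoHom_apply L L' b i j k l

/-- The values of the structure functionals on the coordinates are given by a braiding. -/
def IsJurcoPair (s : Matrix (Fin 3 × Fin 3) (Fin 3 × Fin 3) ℂ) (t : ℂ) : Prop :=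
  ∀ i j k l m n, jurcoF L L' i j k l (z q m n) = t * ∑ e, s (m, k) (i, e) * s (j, e) (n, l)

variable {L L'} {s : Matrix (Fin 3 × Fin 3) (Fin 3 × Fin 3) ℂ} {t : ℂ}

theorem jurcoAction_z (h : IsJurcoPair L L' s t) (m n i j k l : Fin 3) :
    jurcoAction L L' (z q m n) (i, j) (k, l)
      = ∑ d, (t * ∑ e, s (d, k) (i, e) * s (j, e) (n, l)) • z q m d := by
  rw [jurcoAction_eq_convElem, convElem, comul_z]
  simp only [map_sum, LinearMap.lTensor_tmul, TensorProduct.rid_tmul, h i j k l]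

/-- Since a ↦ (f ∗ a) is a homomorphism into matrices, the relation passes from the generators z to
products and inverses; for the z's it is the hypothesis on ω. -/
theorem smul_eq_jurcoAction {C : BicovariantCalculus.{u} (GLq q)} (h : IsJurcoPair L L' s t)
    {ω : Fin 3 → Fin 3 → C.Γ} (hω : HeckeRelations C s t ω) (a : GLq q) (r : Fin 3 × Fin 3) :
    ω r.1 r.2 <• a = ∑ c, jurcoAction L L' a r c • ω c.1 c.2 := by
  revert r
  induction a using GLq.induction_of_inverse with
  | halg c =>
    intro r
    rw [AlgHom.commutes, Algebra.algebraMap_eq_smul_one, Algebra.algebraMap_eq_smul_one]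
    simp only [MulOpposite.op_smul, MulOpposite.op_one, Matrix.smul_apply, Matrix.one_apply,
      smul_assoc, one_smul, ite_smul, zero_smul, smul_ite, smul_zero, Finset.sum_ite_eq,
      Finset.mem_univ, if_true]
  | hz m n =>
    rintro ⟨i, j⟩
    rw [(heckeRelations_iff C s t ω).1 hω]
    simp only [Fintype.sum_prod_type, jurcoAction_z h, Finset.sum_smul, Finset.smul_sum,
      Finset.mul_sum, smul_assoc, mul_smul]
    rw [sum_swap_pairs]
  | hadd a b ha hb =>
    intro r
    simp only [MulOpposite.op_add, add_smul, map_add, Matrix.add_apply, Finset.sum_add_distrib,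
      ha r, hb r]
  | hmul a b ha hb =>
    intro r
    have hcomm : ∀ (x : GLq q) (ρ : C.Γ), MulOpposite.op b • x • ρ = x • MulOpposite.op b • ρ :=
      fun x ρ => (smul_comm x (MulOpposite.op b) ρ).symm
    rw [MulOpposite.op_mul, mul_smul, ha r]
    simp only [Finset.smul_sum, hcomm, hb, map_mul, Matrix.mul_apply, Finset.sum_smul, mul_smul]
    rw [Finset.sum_comm]
  | hinv a b hab hba ha =>
    intro r
    have hcomm : ∀ (x : GLq q) (ρ : C.Γ), MulOpposite.op b • x • ρ = x • MulOpposite.op b • ρ :=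
      fun x ρ => (smul_comm x (MulOpposite.op b) ρ).symm
    have h1 : ∀ c : Fin 3 × Fin 3, ω c.1 c.2
        = MulOpposite.op b • ∑ c', jurcoAction L L' a c c' • ω c'.1 c'.2 := fun c => by
      rw [← ha, smul_smul, ← MulOpposite.op_mul, hab, MulOpposite.op_one, one_smul]
    symm
    calc ∑ c, jurcoAction L L' b r c • ω c.1 c.2
        = ∑ c, jurcoAction L L' b r c •
            MulOpposite.op b • ∑ c', jurcoAction L L' a c c' • ω c'.1 c'.2 :=
          Finset.sum_congr rfl fun c _ => by rw [← h1]
      _ = MulOpposite.op b •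
            ∑ c', (jurcoAction L L' b * jurcoAction L L' a) r c' • ω c'.1 c'.2 := by
          simp only [Finset.smul_sum, hcomm, Matrix.mul_apply, Finset.sum_smul, mul_smul]
          rw [Finset.sum_comm]
      _ = _ := by
          rw [← map_mul, hba, map_one]
          simp [Matrix.one_apply]

/-- The differential is an inner derivation if it is so on the coordinates. -/
theorem d_eq_commutator (C : BicovariantCalculus.{u} (GLq q)) {r : ℂ} {η : C.Γ}
    (h : ∀ i j, r • C.d (z q i j) = η <• z q i j - z q i j • η) (a : GLq q) :
    r • C.d a = η <• a - a • η := by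
  have d_one : C.d 1 = 0 := by
    have h1 := C.leibniz 1 1
    rw [mul_one, MulOpposite.op_one, one_smul, one_smul] at h1
    exact left_eq_add.1 h1
  induction a using GLq.induction_of_inverse with
  | halg c =>
    rw [Algebra.algebraMap_eq_smul_one, map_smul, d_one, MulOpposite.op_smul, smul_assoc,
      smul_assoc]
    simp
  | hz i j => exact h i j
  | hadd a b ha hb =>
    rw [map_add, smul_add, ha, hb, MulOpposite.op_add, add_smul, add_smul]
    abel
  | hmul a b ha hb =>
    rw [C.leibniz, smul_add, smul_comm r, smul_comm r, ha, hb, smul_sub, smul_sub,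
      MulOpposite.op_mul, mul_smul, mul_smul, smul_comm a (MulOpposite.op b)]
    abel
  | hinv a b hab hba ha =>
    -- The Leibniz rule for ba = 1 determines the derivative of an inverse, and commutators obey the
    -- same formula.
    have h1 : C.d b = -(b • MulOpposite.op b • C.d a) := by
      have h2 := C.leibniz b a
      rw [hba, d_one] at h2
      have h3 := congrArg (fun ρ => MulOpposite.op b • ρ) h2
      simp only [smul_zero, smul_add, smul_smul, ← MulOpposite.op_mul, hab, MulOpposite.op_one,
        one_smul] at h3
      rw [smul_comm b (MulOpposite.op b)]
      exact eq_neg_of_add_eq_zero_left h3.symm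
    rw [h1, smul_neg, smul_comm r b, smul_comm r (MulOpposite.op b), ha, smul_sub, smul_sub,
      smul_smul (MulOpposite.op b) (MulOpposite.op a), ← MulOpposite.op_mul, hab,
      MulOpposite.op_one, one_smul, ← smul_comm a (MulOpposite.op b) η, smul_smul b a, hba, one_smul]
    abel

/-- Setting the two indices of ω equal and summing joins the two copies of s into the product s².
This is the origin of s² in U, since dz = λ⁻¹[Tr ω, z]. -/
theorem HeckeRelations.adz_trace {C : BicovariantCalculus.{u} (GLq q)}
    {ω : Fin 3 → Fin 3 → C.Γ} (hω : HeckeRelations C s t ω) (k l : Fin 3) :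
    adz C k l (∑ i, ω i i) = t • contract2 (s * s) ω k l := by
  simp only [map_sum, hω _ _ k l, contract2, Matrix.mul_apply, Fintype.sum_prod_type,
    Finset.sum_smul, ← Finset.smul_sum]
  congr 1
  rw [sum_swap_pairs]

theorem contract2_heckeX {M : Type*} [AddCommGroup M] [Module ℂ M] {p c : ℂ}
    (hs : IsHeckeBraiding q p c s) (hq : q - q⁻¹ ≠ 0) (t : ℂ) (ω : Fin 3 → Fin 3 → M)
    (i j : Fin 3) : (q - q⁻¹) • contract2 (heckeX q p t s) ω i j
      = t • contract2 (s * s) ω i j - if i = j then ∑ k, ω k k else 0 := by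
  have h1 : heckeX q p t s = (q - q⁻¹)⁻¹ • (t • (s * s) - 1) := by
    rw [hs.sq, heckeX]; module
  simp only [h1, contract2, Finset.smul_sum, Matrix.smul_apply, Matrix.sub_apply, smul_assoc,
    smul_inv_smul₀ hq, sub_smul, Finset.sum_sub_distrib]
  congr 1
  by_cases h : i = j <;> simp [Matrix.one_apply, h, ite_smul]

/-- A calculus with the adjoint action given by a braiding arises from Jurčo's construction. -/
theorem exists_jurco_basis {C : BicovariantCalculus.{u} (GLq q)} (hC : HasCoordinateBasis C)
    {p c x y : ℂ} (hs : IsHeckeBraiding q p c s) (hq : q - q⁻¹ ≠ 0)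
    (hU : IsUnit (heckeU q t s))
    (hx : heckeMu q p c t * x = -(t - 1) ^ 2) (hy : heckeMu q p c t * y = -(p * t * (t - 1)))
    (h : ∀ i k j l, adz C k l (theta C i j) = adTheta s t x y C i k j l) :
    ∃ ω : Module.Basis (Fin 3 × Fin 3) ℂ C.inv,
      (∀ i j, theta C i j = ∑ k, ∑ l, heckeU q t s (i, j) (k, l) • (ω (k, l) : C.Γ)) ∧
      HeckeRelations C s t (fun i j => (ω (i, j) : C.Γ)) ∧
      ∀ L L' : GLq q →ₐ[ℂ] Matrix (Fin 3) (Fin 3) ℂ, IsJurcoPair L L' s t →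
        IsJurco C L L' (fun i j => (ω (i, j) : C.Γ)) := by
  obtain ⟨N, hUN⟩ := hU.exists_right_inv
  obtain ⟨ω, hω, hθ⟩ := exists_inv_basis hC _ N hUN
  have hNU := mul_eq_one_comm.1 hUN
  have hθ' : ∀ i j, theta C i j
      = contract2 (heckeX q p t s) (fun i j => (ω (i, j) : C.Γ)) i j := fun i j => by
    rw [hθ (i, j), Fintype.sum_prod_type]
    simp only [heckeU_apply hs, contract2]
  have hrel : HeckeRelations C s t (fun i j => (ω (i, j) : C.Γ)) :=
    heckeRelations_of_adz_theta hs N (fun i j => hω (i, j)) hNU hθ' hx hy h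
  refine ⟨ω, fun i j => by rw [hθ (i, j), Fintype.sum_prod_type], hrel, fun L L' hL => ?_⟩
  refine ⟨fun i j a => ?_, fun i j => (ω (i, j)).2, fun k l => ?_, fun a => ?_⟩
  · rw [smul_eq_jurcoAction hL hrel a (i, j), Fintype.sum_prod_type]
    simp only [jurcoAction_eq_convElem]
    rfl
  · simp only [antipode_z]
    refine coR_generating (hs.heckeX_comm t) (fun i j => hω (i, j)) ?_ hθ' k l
    rw [← hNU]
    congr 1
    ext r c
    exact (heckeU_apply hs t _ _ _ _).symm
  -- On coordinates, λ dz = zλθ and λθ is the contraction of ts² - 1 with ω: the first term is the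
  -- adjoint action on the trace, the second the trace itself.
  · rw [← d_eq_commutator C (r := q - q⁻¹) (η := ∑ i, (ω (i, i) : C.Γ)), inv_smul_smul₀ hq]
    intro i j
    rw [smul_z_eq, d_z_eq]
    simp only [hrel.adz_trace, hθ', Finset.smul_sum, smul_comm (q - q⁻¹) (z q i _),
      contract2_heckeX hs hq, smul_sub, Finset.sum_sub_distrib]
    simp [Finset.smul_sum]

end Functionals
-- Braid action on four-index arrays
section Braid

variable {M : Type*} [AddCommGroup M] [Module ℂ M]

/-- The action of a matrix on the row indices of a four-index array. -/
noncomputable def braidRows (s : Matrix (Fin 3 × Fin 3) (Fin 3 × Fin 3) ℂ)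
    (G : Fin 3 → Fin 3 → Fin 3 → Fin 3 → M) (i k j l : Fin 3) : M :=
  ∑ a, ∑ b, s (i, k) (a, b) • G a b j l

/-- The action of a matrix on the column indices of a four-index array. -/
noncomputable def braidCols (s : Matrix (Fin 3 × Fin 3) (Fin 3 × Fin 3) ℂ)
    (G : Fin 3 → Fin 3 → Fin 3 → Fin 3 → M) (i k j l : Fin 3) : M :=
  ∑ a, ∑ b, s (a, b) (j, l) • G i k a b

variable (s s' : Matrix (Fin 3 × Fin 3) (Fin 3 × Fin 3) ℂ)
  (G G' : Fin 3 → Fin 3 → Fin 3 → Fin 3 → M) (c : ℂ)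

theorem braidRows_add : braidRows s (G + G') = braidRows s G + braidRows s G' := by
  funext i k j l
  simp only [braidRows, Pi.add_apply, smul_add, Finset.sum_add_distrib]

theorem braidCols_add : braidCols s (G + G') = braidCols s G + braidCols s G' := by
  funext i k j l
  simp only [braidCols, Pi.add_apply, smul_add, Finset.sum_add_distrib]

theorem braidRows_smul : braidRows s (c • G) = c • braidRows s G := by
  funext i k j l
  simp only [braidRows, Pi.smul_apply, Finset.smul_sum, smul_comm c]

theorem braidCols_smul : braidCols s (c • G) = c • braidCols s G := by
  funext i k j l
  simp only [braidCols, Pi.smul_apply, Finset.smul_sum, smul_comm c]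

theorem braidRows_mul : braidRows (s * s') G = braidRows s (braidRows s' G) := by
  funext i k j l
  simp only [braidRows, Matrix.mul_apply, Fintype.sum_prod_type, Finset.smul_sum, Finset.sum_smul,
    mul_smul]
  rw [sum_swap_pairs]

theorem braidCols_mul : braidCols (s * s') G = braidCols s' (braidCols s G) := by
  funext i k j l
  simp only [braidCols, Matrix.mul_apply, Fintype.sum_prod_type, Finset.smul_sum, Finset.sum_smul,
    smul_smul]
  rw [sum_swap_pairs]
  simp only [mul_comm]

theorem braidRows_add_matrix : braidRows (s + s') G = braidRows s G + braidRows s' G := by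
  funext i k j l
  simp only [braidRows, Pi.add_apply, Matrix.add_apply, add_smul, Finset.sum_add_distrib]

theorem braidCols_add_matrix : braidCols (s + s') G = braidCols s G + braidCols s' G := by
  funext i k j l
  simp only [braidCols, Pi.add_apply, Matrix.add_apply, add_smul, Finset.sum_add_distrib]

theorem braidRows_smul_matrix : braidRows (c • s) G = c • braidRows s G := by
  funext i k j l
  simp only [braidRows, Pi.smul_apply, Matrix.smul_apply, Finset.smul_sum, smul_assoc]

theorem braidCols_smul_matrix : braidCols (c • s) G = c • braidCols s G := by
  funext i k j l
  simp only [braidCols, Pi.smul_apply, Matrix.smul_apply, Finset.smul_sum, smul_assoc]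

theorem braidRows_one : braidRows 1 G = G := by
  funext i k j l
  simp [braidRows, Matrix.one_apply, ite_and, ite_smul]

theorem braidCols_one : braidCols 1 G = G := by
  funext i k j l
  simp [braidCols, Matrix.one_apply, ite_and, ite_smul]

theorem braidRows_braidCols :
    braidRows s (braidCols s' G) = braidCols s' (braidRows s G) := by
  funext i k j l
  simp only [braidRows, braidCols, Finset.smul_sum]
  rw [sum_swap_pairs]
  exact Finset.sum_congr rfl fun a _ => Finset.sum_congr rfl fun b _ =>
    Finset.sum_congr rfl fun c _ => Finset.sum_congr rfl fun d _ => smul_comm _ _ _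

theorem braidRows_braiding (q : ℂ) (i k j l : Fin 3) : braidRows (braiding q) G i k j l
    = (if i = k then q else 1) • G k i j l + (if i < k then q - q⁻¹ else 0) • G i k j l :=
  sum_braiding_left q i k fun a b => G a b j l

theorem braidCols_braiding (q : ℂ) (i k j l : Fin 3) : braidCols (braiding q) G i k j l
    = (if j = l then q else 1) • G i k l j + (if j < l then q - q⁻¹ else 0) • G i k j l :=
  sum_braiding_right q j l fun a b => G i k a b

theorem braidingInv_eq (q : ℂ) :
    braidingInv q = braiding q + (-(q - q⁻¹)) • (1 : Matrix (Fin 3 × Fin 3) (Fin 3 × Fin 3) ℂ) := by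
  rw [braidingInv, neg_smul, sub_eq_add_neg]

theorem braidRows_braidingInv (q : ℂ) (i k j l : Fin 3) : braidRows (braidingInv q) G i k j l
    = (if i = k then q else 1) • G k i j l + (if i < k then q - q⁻¹ else 0) • G i k j l
      - (q - q⁻¹) • G i k j l := by
  rw [braidingInv_eq, braidRows_add_matrix, braidRows_smul_matrix, braidRows_one, Pi.add_apply,
    Pi.add_apply, Pi.add_apply, Pi.add_apply, braidRows_braiding, neg_smul]
  exact (sub_eq_add_neg _ _).symm

theorem braidCols_braidingInv (q : ℂ) (i k j l : Fin 3) : braidCols (braidingInv q) G i k j l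
    = (if j = l then q else 1) • G i k l j + (if j < l then q - q⁻¹ else 0) • G i k j l
      - (q - q⁻¹) • G i k j l := by
  rw [braidingInv_eq, braidCols_add_matrix, braidCols_smul_matrix, braidCols_one, Pi.add_apply,
    Pi.add_apply, Pi.add_apply, Pi.add_apply, braidCols_braiding, neg_smul]
  exact (sub_eq_add_neg _ _).symm

/-- An array that is invariant under the braiding is determined by its entries in ordered
position. -/
theorem eq_zero_of_ordered {q : ℂ} (hq : q ≠ 0)
    (hG : braidRows (braiding q) G = braidCols (braiding q) G)
    (h1 : ∀ i k j l, i < k → G i k j l = 0) (h2 : ∀ i j l, j ≤ l → G i i j l = 0) : G = 0 := by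
  -- At an ordered row pair the relation expresses the entry with exchanged rows through ordered
  -- ones; for equal rows it relates the two column orders with factor q.
  have key := fun i k j l => congrFun (congrFun (congrFun (congrFun hG i) k) j) l
  simp only [braidRows_braiding, braidCols_braiding] at key
  funext i k j l
  rcases lt_trichotomy i k with h | rfl | h
  · exact h1 i k j l h
  · rcases le_or_gt j l with h' | h'
    · exact h2 i j l h'
    · have := key i i j l
      rw [h2 i l j h'.le] at this
      simpa [h'.not_gt, hq] using this
  · have := key k i j l
    rw [h1 k i j l h, h1 k i l j h] at this
    simpa [h.ne] using this

end Braid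

/-! ### Commutation relations of differentials and coordinates -/

section CommutationRelations

variable {q : ℂ} [NeZero q] (C : BicovariantCalculus.{u} (GLq q))
  (s : Matrix (Fin 3 × Fin 3) (Fin 3 × Fin 3) ℂ) (t x y : ℂ)

/-- The array `z^i_j dz^k_l`. -/
noncomputable def zdz (i k j l : Fin 3) : C.Γ := z q i j • C.d (z q k l)

/-- The array `z^i_j z^k_l Tr_q θ`. -/
noncomputable def zzTrace (i k j l : Fin 3) : C.Γ := (z q i j * z q k l) • traceQ C

/-- The commutation relations of the `dz^i_j` with the `z^k_l` that are given by a braiding. -/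
noncomputable def commRHS : Fin 3 → Fin 3 → Fin 3 → Fin 3 → C.Γ :=
  (t - 1) • zdz C + t • braidCols s (braidRows s (zdz C)) + x • zzTrace C
    + y • braidRows s (zzTrace C)

theorem commRHS_apply (i k j l : Fin 3) : commRHS C s t x y i k j l
    = (t - 1) • zdz C i k j l + t • braidCols s (braidRows s (zdz C)) i k j l
      + x • zzTrace C i k j l + y • braidRows s (zzTrace C) i k j l := rfl

variable {C s t x y} {p c : ℂ}

/-- Multiplying by z z turns δθ into z dz. Every s acting on the summed row indices is moved across
Z ⊗ Z to the outer indices by the commutation of s with the coordinates. -/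
theorem sum_zz_adTheta (hs : IsHeckeBraiding q p c s) (i k j l : Fin 3) :
    ∑ m, ∑ n, z q i m • z q k n • adTheta s t x y C m n j l = commRHS C s t x y i k j l := by
  have h1 : ∀ ρ : C.Γ, ∀ a b, ∑ m, ∑ n, s (m, n) (a, b) • z q i m • z q k n • ρ
      = ∑ d, ∑ e, s (i, k) (d, e) • z q d a • z q e b • ρ := fun ρ a b => by
    have := congrArg (· • ρ) (hs.comm i k a b)
    simpa only [Finset.sum_smul, smul_assoc, mul_smul] using this.symm
  have h2 : ∑ m, ∑ n, z q i m • z q k n • (t - 1) • (if m = j then theta C n l else 0)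
      = (t - 1) • zdz C i k j l := by
    simp only [zdz, d_z_eq, Finset.smul_sum]
    rw [Finset.sum_eq_single j]
    · simp only [if_true, smul_comm (z q _ _) (t - 1)]
    · intro m _ hm; simp [hm]
    · simp
  have h3 : ∑ m, ∑ n, z q i m • z q k n • ((x * (if m = j ∧ n = l then 1 else 0)
      + y * s (m, n) (j, l)) • traceQ C) = x • zzTrace C i k j l
        + y • braidRows s (zzTrace C) i k j l := by
    simp only [add_smul, smul_add, Finset.sum_add_distrib, mul_smul, smul_comm (z q _ _) x,
      smul_comm (z q _ _) y, smul_comm (z q _ _) (s _ _), ← Finset.smul_sum, h1, braidRows, zzTrace]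
    congr 2
    rw [Finset.sum_eq_single j, Finset.sum_eq_single l]
    · simp
    · intro n _ hn; simp [hn]
    · simp
    · intro m _ hm; simp [hm]
    · simp
  have h4 : ∑ m, ∑ n, z q i m • z q k n • t • (∑ a, ∑ b, s (a, b) (j, l) •
      ∑ d, ∑ e, s (m, n) (d, e) • if d = a then theta C e b else 0)
      = t • braidCols s (braidRows s (zdz C)) i k j l := by
    simp only [smul_comm (z q _ _) t, ← Finset.smul_sum, braidCols, braidRows, zdz]
    congr 1
    simp only [Finset.smul_sum, smul_comm (z q _ _) (s _ _)]
    rw [sum_swap_pairs]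
    refine Finset.sum_congr rfl fun a _ => Finset.sum_congr rfl fun b _ => ?_
    simp only [← Finset.smul_sum]
    congr 1
    rw [sum_swap_pairs, Finset.sum_eq_single a]
    · simp only [if_true, h1, d_z_eq, Finset.smul_sum]
      rw [sum_rotate_three]
    · intro d _ hd; simp [hd]
    · simp
  simp only [adTheta, smul_add, Finset.sum_add_distrib]
  rw [commRHS_apply, h2, h4, h3, ← add_assoc]

/-- The commutation relations of the differentials are equivalent to the description of the adjoint
action on the Maurer-Cartan forms. -/
theorem adz_theta_iff (hs : IsHeckeBraiding q p c s) :
    (∀ i k j l, adz C k l (theta C i j) = adTheta s t x y C i k j l)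
      ↔ ∀ i k j l, C.d (z q i j) <• z q k l = commRHS C s t x y i k j l := by
  have h1 : ∀ i k j l, C.d (z q i j) <• z q k l
      = ∑ m, ∑ n, z q i m • z q k n • adz C n l (theta C m j) := fun i k j l => by
    simp only [d_z_eq, Finset.smul_sum, ← smul_comm (z q i _) (MulOpposite.op (z q k l)), smul_z_eq]
  constructor
  · intro h i k j l
    rw [h1, ← sum_zz_adTheta hs]
    simp only [h _ _ j l]
  · intro h i k j l
    refine congrFun (congrFun (cancel_zz (Algebra.lsmul ℂ ℂ C.Γ : GLq q →ₐ[ℂ] Module.End ℂ C.Γ)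
      (T := fun i k => adz C k l (theta C i j)) (T' := fun i k => adTheta s t x y C i k j l)
      fun i k => ?_) i) k
    simp only [Algebra.lsmul_coe]
    rw [← h1, h, sum_zz_adTheta hs]

theorem d_zz_braid (hs : IsHeckeBraiding q p c s) :
    braidRows s (fun i k j l => C.d (z q i j * z q k l))
      = braidCols s (fun i k j l => C.d (z q i j * z q k l)) := by
  funext i k j l
  simp only [braidRows, braidCols, ← map_smul, ← map_sum, hs.comm]

theorem zzTrace_braid (hs : IsHeckeBraiding q p c s) :
    braidRows s (zzTrace C) = braidCols s (zzTrace C) := by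
  funext i k j l
  simp only [braidRows, braidCols, zzTrace, ← smul_assoc, ← Finset.sum_smul, hs.comm]

/-- With A and B the row and column actions and G = z dz, the sum is tG + tBAG plus trace terms. The
Hecke relation gives A(G + BAG) = AG + BG + pBAG, which is symmetric in A and B. On the array z z
Tr_q θ the two actions agree. -/
theorem commRHS_braid (hs : IsHeckeBraiding q p c s) :
    braidRows s (commRHS C s t x y + zdz C) = braidCols s (commRHS C s t x y + zdz C) := by
  have h1 : ∀ G : Fin 3 → Fin 3 → Fin 3 → Fin 3 → C.Γ,
      braidRows s (braidRows s G) = p • braidRows s G + G := fun G => by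
    rw [← braidRows_mul, hs.sq, braidRows_add_matrix, braidRows_smul_matrix, braidRows_one]
  have h2 : ∀ G : Fin 3 → Fin 3 → Fin 3 → Fin 3 → C.Γ,
      braidCols s (braidCols s G) = p • braidCols s G + G := fun G => by
    rw [← braidCols_mul, hs.sq, braidCols_add_matrix, braidCols_smul_matrix, braidCols_one]
  simp only [commRHS, braidRows_add, braidCols_add, braidRows_smul, braidCols_smul,
    braidRows_braidCols, h1, h2, zzTrace_braid hs]
  module

/-- It suffices to know the commutation relations in ordered position. -/
theorem commRHS_of_ordered (hs : IsHeckeBraiding q p c s)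
    (hs' : ∃ r : ℂ, braiding q = s + r • (1 : Matrix (Fin 3 × Fin 3) (Fin 3 × Fin 3) ℂ))
    (h1 : ∀ i k j l, i < k → C.d (z q i j) <• z q k l = commRHS C s t x y i k j l)
    (h2 : ∀ i j l, j ≤ l → C.d (z q i j) <• z q i l = commRHS C s t x y i i j l) (i k j l : Fin 3) :
    C.d (z q i j) <• z q k l = commRHS C s t x y i k j l := by
  obtain ⟨r, hr⟩ := hs'
  -- By the Leibniz rule G is the defect in the commutation relations. Written with d(zz) it is
  -- visibly invariant under s, hence under σ, which differs from s by a scalar.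
  let G : Fin 3 → Fin 3 → Fin 3 → Fin 3 → C.Γ :=
    (fun i k j l => C.d (z q i j * z q k l)) + (-1 : ℂ) • (commRHS C s t x y + zdz C)
  have hG : ∀ i k j l, G i k j l = C.d (z q i j) <• z q k l - commRHS C s t x y i k j l := by
    intro i k j l
    have : G i k j l = C.d (z q i j * z q k l)
      + (-1 : ℂ) • (commRHS C s t x y i k j l + z q i j • C.d (z q k l)) := rfl
    rw [this, C.leibniz, neg_one_smul]
    abel
  have h0 : G = 0 := by
    refine eq_zero_of_ordered G (NeZero.ne q) ?_ (fun i k j l h => ?_) (fun i j l h => ?_)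
    · rw [hr]
      simp only [braidRows_add_matrix, braidCols_add_matrix, braidRows_smul_matrix,
        braidCols_smul_matrix, braidRows_one, braidCols_one]
      congr 1
      simp only [G]
      rw [braidRows_add s, braidCols_add s, braidRows_smul s, braidCols_smul s, d_zz_braid hs,
        commRHS_braid hs]
    · rw [hG, h1 i k j l h, sub_self]
    · rw [hG, h2 i j l h, sub_self]
  have := hG i k j l
  rw [h0] at this
  exact (sub_eq_zero.1 this.symm)

/-- The admissibility condition is nothing but the nonvanishing of μ, the factor between the two
traces. -/
theorem admissible_factor1 (hq : q ≠ 0) (t : ℂ) : heckeMu q (-(q - q⁻¹)) q⁻¹ t * q ^ 2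
    = (q ^ 6 + q ^ 4 + 1) * t - (q ^ 6 + q ^ 4 + q ^ 2) := by
  rw [heckeMu]; field_simp; ring

theorem admissible_factor2 (hq : q ≠ 0) (t : ℂ) : heckeMu q (q - q⁻¹) (q ^ 5) t
    = (q ^ 6 + q ^ 2 + 1) * t - (q ^ 4 + q ^ 2 + 1) := by
  rw [heckeMu]; field_simp; ring

theorem zdz_apply (i k j l : Fin 3) : zdz C i k j l = z q i j • C.d (z q k l) := rfl

theorem zzTrace_apply (i k j l : Fin 3) : zzTrace C i k j l = (z q i j * z q k l) • traceQ C := rfl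

theorem commRHS_braidingInv_same (i j : Fin 3) (x y : ℂ) :
    commRHS C (braidingInv q) t x y i i j j = (t / q ^ 2 + t - 1) • z q i j • C.d (z q i j)
      + (x + q⁻¹ * y) • (z q i j * z q i j) • traceQ C := by
  have hq := NeZero.ne q
  simp only [commRHS_apply, braidCols_braidingInv, braidRows_braidingInv, lt_irrefl, if_true,
    if_false, zdz, zzTrace]
  simp only [← zdz_apply, ← zzTrace_apply]
  match_scalars <;> field_simp <;> ring

theorem commRHS_braidingInv_row (i j l : Fin 3) (h : j < l) (x y : ℂ) :
    commRHS C (braidingInv q) t x y i i j l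
      = (t / q) • z q i l • C.d (z q i j) + (t - 1) • z q i j • C.d (z q i l)
        + (x + q⁻¹ * y) • (z q i j * z q i l) • traceQ C := by
  have hq := NeZero.ne q
  simp only [commRHS_apply, braidCols_braidingInv, braidRows_braidingInv, lt_irrefl, if_true,
    if_false, h, h.ne, zdz, zzTrace]
  simp only [← zdz_apply, ← zzTrace_apply]
  match_scalars <;> field_simp <;> ring

theorem commRHS_braidingInv_col (i k j : Fin 3) (h : i < k) (x y : ℂ) :
    commRHS C (braidingInv q) t x y i k j j
      = (t / q) • z q k j • C.d (z q i j) + (t - 1) • z q i j • C.d (z q k j)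
        + (x + q⁻¹ * y) • (z q i j * z q k j) • traceQ C := by
  have hq := NeZero.ne q
  simp only [commRHS_apply, braidCols_braidingInv, braidRows_braidingInv, lt_irrefl, if_true,
    if_false, h, h.ne, zdz, zzTrace, (isQMatrix_z q).col i k j h,
    smul_assoc]
  simp only [← zdz_apply, ← zzTrace_apply]
  match_scalars <;> field_simp <;> ring

theorem commRHS_braidingInv_diag (i k j l : Fin 3) (h : i < k) (h' : j < l) (x y : ℂ) :
    commRHS C (braidingInv q) t x y i k j l
      = t • z q k l • C.d (z q i j) + (t - 1) • z q i j • C.d (z q k l)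
        + (x + q⁻¹ * y) • (z q i j * z q k l) • traceQ C
        - (q⁻¹ * y) • (z q i j * z q k l - q • (z q i l * z q k j)) • traceQ C := by
  have hq := NeZero.ne q
  simp only [commRHS_apply, braidCols_braidingInv, braidRows_braidingInv, if_true, if_false, h,
    h.ne, h', h'.ne, zdz, zzTrace, (isQMatrix_z q).anti i k l j h h', sub_smul, smul_assoc]
  simp only [← zdz_apply, ← zzTrace_apply]
  match_scalars <;> field_simp <;> ring

theorem commRHS_braidingInv_anti (i k j l : Fin 3) (h : i < k) (h' : l < j) (x y : ℂ) :
    commRHS C (braidingInv q) t x y i k j l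
      = t • z q k l • C.d (z q i j) + (t - 1) • z q i j • C.d (z q k l)
        + (x + q⁻¹ * y) • (z q i j * z q k l) • traceQ C
        - (t * (q - 1 / q)) • z q k j • C.d (z q i l)
        + y • (z q i l * z q k j - q • (z q i j * z q k l)) • traceQ C := by
  have hq := NeZero.ne q
  simp only [commRHS_apply, braidCols_braidingInv, braidRows_braidingInv, if_true, if_false, h,
    h.ne, h'.ne', h'.not_gt, zdz, zzTrace, (isQMatrix_z q).anti i k j l h h',
    (isQMatrix_z q).diag i k l j h h', sub_smul, add_smul, smul_assoc]
  simp only [← zdz_apply, ← zzTrace_apply]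
  match_scalars <;> field_simp <;> ring

theorem commRHS_braiding_same (i j : Fin 3) (x y : ℂ) :
    commRHS C (braiding q) t x y i i j j = (t * q ^ 2 + t - 1) • z q i j • C.d (z q i j)
      + (x + q * y) • (z q i j * z q i j) • traceQ C := by
  have hq := NeZero.ne q
  simp only [commRHS_apply, braidCols_braiding, braidRows_braiding, lt_irrefl, if_true,
    if_false, zdz, zzTrace]
  simp only [← zdz_apply, ← zzTrace_apply]
  match_scalars <;> field_simp <;> ring

theorem commRHS_braiding_row (i j l : Fin 3) (h : j < l) (x y : ℂ) :
    commRHS C (braiding q) t x y i i j l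
      = (t * q) • z q i l • C.d (z q i j) + (t * q ^ 2 - 1) • z q i j • C.d (z q i l)
        + (x + q * y) • (z q i j * z q i l) • traceQ C := by
  have hq := NeZero.ne q
  simp only [commRHS_apply, braidCols_braiding, braidRows_braiding, lt_irrefl, if_true,
    if_false, h, h.ne, zdz, zzTrace]
  simp only [← zdz_apply, ← zzTrace_apply]
  match_scalars <;> field_simp <;> ring

theorem commRHS_braiding_col (i k j : Fin 3) (h : i < k) (x y : ℂ) :
    commRHS C (braiding q) t x y i k j j
      = (t * q) • z q k j • C.d (z q i j) + (t * q ^ 2 - 1) • z q i j • C.d (z q k j)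
        + (x + q * y) • (z q i j * z q k j) • traceQ C := by
  have hq := NeZero.ne q
  simp only [commRHS_apply, braidCols_braiding, braidRows_braiding, lt_irrefl, if_true,
    if_false, h, h.ne, zdz, zzTrace, (isQMatrix_z q).col i k j h,
    smul_assoc]
  simp only [← zdz_apply, ← zzTrace_apply]
  match_scalars <;> field_simp <;> ring

theorem commRHS_braiding_diag (i k j l : Fin 3) (h : i < k) (h' : j < l) (x y : ℂ) :
    commRHS C (braiding q) t x y i k j l
      = t • z q k l • C.d (z q i j) + (t - 1) • z q i j • C.d (z q k l)
        + (x + q * y) • (z q i j * z q k l) • traceQ C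
        + (t * (q - 1 / q)) • (z q i l • C.d (z q k j) + z q k j • C.d (z q i l))
        + (t * (q - 1 / q) ^ 2) • z q i j • C.d (z q k l)
        - (1 / q ^ 2 * (q * y)) • (z q i j * z q k l - q • (z q i l * z q k j)) • traceQ C := by
  have hq := NeZero.ne q
  simp only [commRHS_apply, braidCols_braiding, braidRows_braiding, if_true, if_false, h,
    h.ne, h', h'.ne, zdz, zzTrace, (isQMatrix_z q).anti i k l j h h', sub_smul, smul_assoc]
  simp only [← zdz_apply, ← zzTrace_apply]
  match_scalars <;> field_simp <;> ring

theorem commRHS_braiding_anti (i k j l : Fin 3) (h : i < k) (h' : l < j) (x y : ℂ) :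
    commRHS C (braiding q) t x y i k j l
      = t • z q k l • C.d (z q i j) + (t - 1) • z q i j • C.d (z q k l)
        + (x + q * y) • (z q i j * z q k l) • traceQ C
        + (t * (q - 1 / q)) • z q i l • C.d (z q k j)
        + (1 / q * (q * y)) • (z q i l * z q k j - q • (z q i j * z q k l)) • traceQ C := by
  have hq := NeZero.ne q
  simp only [commRHS_apply, braidCols_braiding, braidRows_braiding, if_true, if_false, h,
    h.ne, h'.ne', h'.not_gt, zdz, zzTrace, (isQMatrix_z q).anti i k j l h h',
    (isQMatrix_z q).diag i k l j h h', sub_smul, add_smul, smul_assoc]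
  simp only [← zdz_apply, ← zzTrace_apply]
  match_scalars <;> field_simp <;> ring

/-- On a repeated row or column σ⁻¹ acts on the trace term by q⁻¹, so its coefficient there is x +
q⁻¹y. Matching it with σ, and the additional term for i < k, j < l with β, gives x = σ - β and y =
qβ. -/
theorem isGamma1_iff (t : ℂ) : IsGamma1 C t ↔ ∀ i k j l, C.d (z q i j) <• z q k l
    = commRHS C (braidingInv q) t (sigma1 q t - beta1 q t) (q * beta1 q t) i k j l := by
  have hq := NeZero.ne q
  have e1 : sigma1 q t - beta1 q t + q⁻¹ * (q * beta1 q t) = sigma1 q t := by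
    field_simp; ring
  have e2 : q⁻¹ * (q * beta1 q t) = beta1 q t := by field_simp
  constructor
  · intro h
    refine commRHS_of_ordered (isHeckeBraiding_braidingInv q hq)
      ⟨q - q⁻¹, by rw [braidingInv]; module⟩ (fun i k j l hik => ?_) (fun i j l hjl => ?_)
    · rcases lt_trichotomy j l with hjl | rfl | hjl
      · rw [commRHS_braidingInv_diag i k j l hik hjl, e1, e2, h.diag i k j l hik hjl]
      · rw [commRHS_braidingInv_col i k j hik, e1, h.col i k j hik]
      · rw [commRHS_braidingInv_anti i k j l hik hjl, e1, h.anti i k j l hik hjl]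
    · rcases hjl.lt_or_eq with hjl | rfl
      · rw [commRHS_braidingInv_row i j l hjl, e1, h.row i j l hjl]
      · rw [commRHS_braidingInv_same, e1, h.same]
  · intro h
    exact
      { same := fun i j => by rw [h, commRHS_braidingInv_same, e1]
        row := fun i j l hjl => by rw [h, commRHS_braidingInv_row i j l hjl, e1]
        col := fun i k j hik => by rw [h, commRHS_braidingInv_col i k j hik, e1]
        diag := fun i k j l hik hjl => by
          rw [h, commRHS_braidingInv_diag i k j l hik hjl, e1, e2]
        anti := fun i k j l hik hjl => by
          rw [h, commRHS_braidingInv_anti i k j l hik hjl, e1] }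

/-- Here the factor is q instead of q⁻¹, whence x = σ^ - β^ and y = q⁻¹β^. -/
theorem isGamma2_iff (t : ℂ) : IsGamma2 C t ↔ ∀ i k j l, C.d (z q i j) <• z q k l
    = commRHS C (braiding q) t (sigma2 q t - beta2 q t) (q⁻¹ * beta2 q t) i k j l := by
  have hq := NeZero.ne q
  have e1 : sigma2 q t - beta2 q t + q * (q⁻¹ * beta2 q t) = sigma2 q t := by
    field_simp; ring
  have e2 : q * (q⁻¹ * beta2 q t) = beta2 q t := by field_simp
  constructor
  · intro h
    refine commRHS_of_ordered (isHeckeBraiding_braiding q hq)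
      ⟨0, by module⟩ (fun i k j l hik => ?_) (fun i j l hjl => ?_)
    · rcases lt_trichotomy j l with hjl | rfl | hjl
      · rw [commRHS_braiding_diag i k j l hik hjl, e1, e2, h.diag i k j l hik hjl]
      · rw [commRHS_braiding_col i k j hik, e1, h.col i k j hik]
      · rw [commRHS_braiding_anti i k j l hik hjl, e1, e2, h.anti i k j l hik hjl]
    · rcases hjl.lt_or_eq with hjl | rfl
      · rw [commRHS_braiding_row i j l hjl, e1, h.row i j l hjl]
      · rw [commRHS_braiding_same, e1, h.same]
  · intro h
    exact
      { same := fun i j => by rw [h, commRHS_braiding_same, e1]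
        row := fun i j l hjl => by rw [h, commRHS_braiding_row i j l hjl, e1]
        col := fun i k j hik => by rw [h, commRHS_braiding_col i k j hik, e1]
        diag := fun i k j l hik hjl => by
          rw [h, commRHS_braiding_diag i k j l hik hjl, e1, e2]
        anti := fun i k j l hik hjl => by
          rw [h, commRHS_braiding_anti i k j l hik hjl, e1, e2] }

end CommutationRelations

/-! ### Construction of the functionals ℓ^± -/

section LFunctionals

variable {q : ℂ} [NeZero q] {s s' : Matrix (Fin 3 × Fin 3) (Fin 3 × Fin 3) ℂ} {c c' p d : ℂ}

theorem rtt_of_comm {B : Type*} [Ring B] [Algebra ℂ B] (q : ℂ) {x : Fin 3 → Fin 3 → B}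
    (h : ∀ i k j l, ∑ a, ∑ b, braiding q (i, k) (a, b) • (x a j * x b l)
      = ∑ a, ∑ b, braiding q (a, b) (j, l) • (x i a * x k b)) : RTT q x := by
  intro i k j l
  have := h k i j l
  simp only [braiding_apply] at this
  rw [this, Finset.sum_comm]

/-- The matrices that represent the coordinates by a braiding. -/
def braidMatrix (s : Matrix (Fin 3 × Fin 3) (Fin 3 × Fin 3) ℂ) (c : ℂ) (k l : Fin 3) :
    Matrix (Fin 3) (Fin 3) ℂ :=
  Matrix.of fun i j => c * s (i, k) (l, j)

/-- Two representing matrices multiply to s₁₂s₂₃, and the relations RTT say that this product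
intertwines σ₂₃ with σ₁₂. For s in place of σ this is the braid relation, and the scalar difference
σ - s is harmless. -/
theorem isQMatrix_braidMatrix (hs : IsHeckeBraiding q p d s)
    (hs' : ∃ r : ℂ, braiding q = s + r • (1 : Matrix (Fin 3 × Fin 3) (Fin 3 × Fin 3) ℂ)) :
    IsQMatrix q (braidMatrix s c) := by
  obtain ⟨r, hr⟩ := hs'
  rw [← rtt_iff q (NeZero.ne q)]
  refine rtt_of_comm q fun i k j l => ?_
  have h1 : leg23 (braiding q) * (leg12 s * leg23 s) = leg12 s * leg23 s * leg12 (braiding q) := by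
    simp only [hr, map_add, map_smul, map_one, add_mul, mul_add, smul_mul_assoc, mul_smul_comm,
      one_mul, mul_one, hs.braid, ← mul_assoc]
  ext m n
  have h2 := congrFun (congrFun h1 (m, i, k)) (j, l, n)
  have h3 : ∀ a b j l : Fin 3, (braidMatrix s c a j * braidMatrix s c b l) m n
      = c * c * (leg12 s * leg23 s) (m, a, b) (j, l, n) := fun a b j l => by
    simp only [braidMatrix, Matrix.mul_apply, Matrix.of_apply, Fintype.sum_prod_type, leg12_apply,
      leg23_apply, mul_ite, ite_mul, zero_mul, mul_zero, Finset.sum_ite_eq, Finset.sum_ite_eq',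
      Finset.mem_univ, if_true, Finset.sum_const_zero, Finset.sum_ite_irrel, Finset.mul_sum]
    exact Finset.sum_congr rfl fun e _ => by ring
  have h4 : ∀ F : Fin 3 → Fin 3 → ℂ, ∑ a, ∑ b, braiding q (i, k) (a, b) * (c * c * F a b)
      = c * c * ∑ a, ∑ b, braiding q (i, k) (a, b) * F a b := fun F => by
    simp only [Finset.mul_sum, mul_left_comm]
  have h5 : ∀ F : Fin 3 → Fin 3 → ℂ, ∑ a, ∑ b, braiding q (a, b) (j, l) * (c * c * F a b)
      = c * c * ∑ a, ∑ b, F a b * braiding q (a, b) (j, l) := fun F => by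
    simp only [Finset.mul_sum]
    exact Finset.sum_congr rfl fun a _ => Finset.sum_congr rfl fun b _ => by ring
  simp only [Matrix.sum_apply, Matrix.smul_apply, h3, smul_eq_mul, h4, h5]
  congr 1
  rw [Matrix.mul_apply, Matrix.mul_apply] at h2
  generalize leg12 s * leg23 s = Y at h2
  simpa only [Fintype.sum_prod_type, leg12_apply, leg23_apply,
      mul_ite, ite_mul, zero_mul, mul_zero, Finset.sum_ite_eq, Finset.sum_ite_eq',
      Finset.mem_univ, if_true, Finset.sum_const_zero, Finset.sum_ite_irrel] using h2

theorem qdet_braidMatrix_braiding (q c : ℂ) (hq : q ≠ 0) :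
    qdet q (braidMatrix (braiding q) c) = (c ^ 3 * q) • (1 : Matrix (Fin 3) (Fin 3) ℂ) := by
  ext i j
  fin_cases i <;> fin_cases j <;>
    simp [qdet, braidMatrix, braiding, Rmat, Matrix.mul_apply, Fin.sum_univ_three] <;>
    field_simp

theorem qdet_braidMatrix_braidingInv (q c : ℂ) (hq : q ≠ 0) :
    qdet q (braidMatrix (braidingInv q) c)
      = (c ^ 3 * q⁻¹) • (1 : Matrix (Fin 3) (Fin 3) ℂ) := by
  ext i j
  fin_cases i <;> fin_cases j <;>
    simp [qdet, braidMatrix, braidingInv, braiding, Rmat, Matrix.mul_apply, Fin.sum_univ_three] <;>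
    field_simp

theorem exists_braidHom (hs : IsHeckeBraiding q p d s)
    (hs' : ∃ r : ℂ, braiding q = s + r • (1 : Matrix (Fin 3 × Fin 3) (Fin 3 × Fin 3) ℂ))
    {r : ℂ} (hr : r ≠ 0) (h : qdet q (braidMatrix s c) = r • 1) :
    ∃ L : GLq q →ₐ[ℂ] Matrix (Fin 3) (Fin 3) ℂ, ∀ k l, L (z q k l) = braidMatrix s c k l :=
  ⟨liftGL (braidMatrix s c) (r⁻¹ • 1) (isQMatrix_braidMatrix hs hs')
    (by rw [h, smul_mul_smul_comm, mul_inv_cancel₀ hr, one_smul, mul_one])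
    (by rw [h, smul_mul_smul_comm, inv_mul_cancel₀ hr, one_smul, mul_one]),
    fun k l => liftGL_z _ _ _ _ _ k l⟩

theorem exists_Lplus (q : ℂ) [NeZero q] {c : ℂ} (hc : c ≠ 0) :
    ∃ L : GLq q →ₐ[ℂ] Matrix (Fin 3) (Fin 3) ℂ,
      ∀ k l, L (z q k l) = braidMatrix (braiding q) c k l :=
  exists_braidHom (isHeckeBraiding_braiding q (NeZero.ne q)) ⟨0, by module⟩
    (mul_ne_zero (pow_ne_zero 3 hc) (NeZero.ne q)) (qdet_braidMatrix_braiding q c (NeZero.ne q))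

theorem exists_Lminus (q : ℂ) [NeZero q] {c : ℂ} (hc : c ≠ 0) :
    ∃ L : GLq q →ₐ[ℂ] Matrix (Fin 3) (Fin 3) ℂ,
      ∀ k l, L (z q k l) = braidMatrix (braidingInv q) c k l :=
  exists_braidHom (isHeckeBraiding_braidingInv q (NeZero.ne q))
    ⟨q - q⁻¹, by rw [braidingInv]; module⟩
    (mul_ne_zero (pow_ne_zero 3 hc) (inv_ne_zero (NeZero.ne q)))
    (qdet_braidMatrix_braidingInv q c (NeZero.ne q))

theorem isLFunctional_plus {L : GLq q →ₐ[ℂ] Matrix (Fin 3) (Fin 3) ℂ}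
    (h : ∀ k l, L (z q k l) = braidMatrix (braiding q) c k l) : IsLFunctional (Rplus q c) L := by
  intro i j k l
  rw [h]
  simp [braidMatrix, Rplus, Pmat, Matrix.mul_apply, Fintype.sum_prod_type, ite_and,
    braiding_apply]

theorem isLFunctional_minus {L : GLq q →ₐ[ℂ] Matrix (Fin 3) (Fin 3) ℂ}
    (h : ∀ k l, L (z q k l) = braidMatrix (braidingInv q) c k l) :
    IsLFunctional (Rminus q c) L := by
  intro i j k l
  rw [h, Rminus, Matrix.smul_apply, Rmat_inv_apply q (NeZero.ne q)]
  rfl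

/-- The antipode replaces the matrix c s' of L by its inverse c⁻¹ s, with s = s'⁻¹. Convolution with
L', which is given by c' s, then yields two copies of s and the factor t = c'/c. -/
theorem isJurcoPair_of_braidMatrix {L L' : GLq q →ₐ[ℂ] Matrix (Fin 3) (Fin 3) ℂ}
    (h : ∀ k l, L (z q k l) = braidMatrix s' c k l)
    (h' : ∀ k l, L' (z q k l) = braidMatrix s c' k l) (hc : c ≠ 0) (hss : s * s' = 1) :
    IsJurcoPair L L' s (c' / c) := by
  have h1 : ∀ m e, L (Smat q m e) = Matrix.of fun k i => c⁻¹ * s (m, k) (i, e) := by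
    intro m e
    -- The claimed matrix is a left inverse of L(Z), and L(S(Z)) is a right inverse; hence they
    -- agree.
    have h2 : ∀ n, ∑ f, (Matrix.of fun k i => c⁻¹ * s (m, k) (i, f)) * L (z q f n)
        = if m = n then 1 else 0 := fun n => by
      ext k b
      have h3 := congrFun (congrFun hss (m, k)) (n, b)
      rw [Matrix.mul_apply, Fintype.sum_prod_type, Finset.sum_comm, Matrix.one_apply] at h3
      have h4 : ∀ f i, c⁻¹ * s (m, k) (i, f) * (c * s' (i, f) (n, b))
          = s (m, k) (i, f) * s' (i, f) (n, b) := fun f i => by field_simp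
      simp only [h, braidMatrix, Matrix.sum_apply, Matrix.mul_apply, Matrix.of_apply, h4, h3,
        Prod.mk.injEq]
      by_cases hmn : m = n <;> simp [hmn, Matrix.one_apply]
    calc L (Smat q m e) = ∑ n, (if m = n then 1 else 0) * L (Smat q n e) := by simp
      _ = ∑ f, (Matrix.of fun k i => c⁻¹ * s (m, k) (i, f)) * ∑ n, L (z q f n) * L (Smat q n e) := by
        simp only [← h2, Finset.sum_mul, Finset.mul_sum, mul_assoc]
        rw [Finset.sum_comm]
      _ = _ := by
        simp only [← map_mul, ← map_sum, z_mul_Smat q (NeZero.ne q)]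
        simp [apply_ite L]
  intro i j k l m n
  rw [jurcoF, convFun]
  simp only [LinearMap.comp_apply, comul_z, map_sum, TensorProduct.map_tmul, LinearMap.mul'_apply,
    antipode_z, ell, AlgHom.toLinearMap_apply, Matrix.entryLinearMap_apply, h1, h', braidMatrix,
    Matrix.of_apply, Finset.mul_sum]
  exact Finset.sum_congr rfl fun e _ => by field_simp

end LFunctionals

/-! ### Right multiplication on A ⊗ Γ and Γ ⊗ A -/

section RightAction

variable (A Γ : Type*) [Ring A] [Algebra ℂ A] [AddCommGroup Γ] [Module ℂ Γ] [Module A Γ]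
  [Module Aᵐᵒᵖ Γ] [IsScalarTower ℂ A Γ] [IsScalarTower ℂ Aᵐᵒᵖ Γ] [SMulCommClass A Aᵐᵒᵖ Γ]

/-- The right multiplication of a bimodule. -/
noncomputable def rightMul : A →ₗ[ℂ] Module.End ℂ Γ :=
  (Algebra.lsmul ℂ ℂ Γ : Aᵐᵒᵖ →ₐ[ℂ] Module.End ℂ Γ).toLinearMap ∘ₗ
    (MulOpposite.opLinearEquiv ℂ).toLinearMap

/-- `(c ⊗ ρ)(a ⊗ b) = ca ⊗ ρb` on `A ⊗ Γ`. -/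
noncomputable def opActL : A ⊗[ℂ] A →ₗ[ℂ] A ⊗[ℂ] Γ →ₗ[ℂ] A ⊗[ℂ] Γ :=
  TensorProduct.map₂ (LinearMap.mul ℂ A).flip (rightMul A Γ)

/-- `(ρ ⊗ c)(a ⊗ b) = ρa ⊗ cb` on `Γ ⊗ A`. -/
noncomputable def opActR : A ⊗[ℂ] A →ₗ[ℂ] Γ ⊗[ℂ] A →ₗ[ℂ] Γ ⊗[ℂ] A :=
  TensorProduct.map₂ (rightMul A Γ) (LinearMap.mul ℂ A).flip

theorem opActL_tmul (a b c : A) (ρ : Γ) :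
    opActL A Γ (a ⊗ₜ b) (c ⊗ₜ ρ) = (c * a) ⊗ₜ (ρ <• b) := rfl

theorem opActR_tmul (a b c : A) (ρ : Γ) :
    opActR A Γ (a ⊗ₜ b) (ρ ⊗ₜ c) = (ρ <• a) ⊗ₜ (c * b) := rfl

theorem opActL_mul (x y : A ⊗[ℂ] A) (w : A ⊗[ℂ] Γ) :
    opActL A Γ (x * y) w = opActL A Γ y (opActL A Γ x w) := by
  induction x using TensorProduct.induction_on with
  | zero => simp
  | add x x' h h' => simp only [add_mul, map_add, LinearMap.add_apply, h, h']
  | tmul a b =>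
    induction y using TensorProduct.induction_on with
    | zero => simp
    | add y y' h h' => simp only [mul_add, map_add, LinearMap.add_apply, h, h']
    | tmul c d =>
      induction w using TensorProduct.induction_on with
      | zero => simp
      | add w w' h h' => simp only [map_add, h, h']
      | tmul e ρ =>
        simp only [Algebra.TensorProduct.tmul_mul_tmul, opActL_tmul, MulOpposite.op_mul, mul_smul,
          mul_assoc]

theorem opActR_mul (x y : A ⊗[ℂ] A) (w : Γ ⊗[ℂ] A) :
    opActR A Γ (x * y) w = opActR A Γ y (opActR A Γ x w) := by
  induction x using TensorProduct.induction_on with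
  | zero => simp
  | add x x' h h' => simp only [add_mul, map_add, LinearMap.add_apply, h, h']
  | tmul a b =>
    induction y using TensorProduct.induction_on with
    | zero => simp
    | add y y' h h' => simp only [mul_add, map_add, LinearMap.add_apply, h, h']
    | tmul c d =>
      induction w using TensorProduct.induction_on with
      | zero => simp
      | add w w' h h' => simp only [map_add, h, h']
      | tmul e ρ =>
        simp only [Algebra.TensorProduct.tmul_mul_tmul, opActR_tmul, MulOpposite.op_mul, mul_smul,
          mul_assoc]

theorem opActL_one (w : A ⊗[ℂ] Γ) : opActL A Γ 1 w = w := by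
  induction w using TensorProduct.induction_on with
  | zero => simp
  | add w w' h h' => simp only [map_add, h, h']
  | tmul e ρ => simp [Algebra.TensorProduct.one_def, opActL_tmul]

theorem opActR_one (w : Γ ⊗[ℂ] A) : opActR A Γ 1 w = w := by
  induction w using TensorProduct.induction_on with
  | zero => simp
  | add w w' h h' => simp only [map_add, h, h']
  | tmul e ρ => simp [Algebra.TensorProduct.one_def, opActR_tmul]

theorem opActL_tensorActL (x y : A ⊗[ℂ] A) (w : A ⊗[ℂ] Γ) :
    opActL A Γ x (tensorActL A Γ y w) = tensorActL A Γ y (opActL A Γ x w) := by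
  induction x using TensorProduct.induction_on with
  | zero => simp
  | add x x' h h' => simp only [map_add, LinearMap.add_apply, h, h']
  | tmul a b =>
    induction y using TensorProduct.induction_on with
    | zero => simp
    | add y y' h h' => simp only [map_add, LinearMap.add_apply, h, h']
    | tmul c d =>
      induction w using TensorProduct.induction_on with
      | zero => simp
      | add w w' h h' => simp only [map_add, h, h']
      | tmul e ρ =>
        simp only [opActL_tmul, tensorActL_tmul, mul_assoc, smul_comm d (MulOpposite.op b) ρ]

theorem opActR_tensorActR (x y : A ⊗[ℂ] A) (w : Γ ⊗[ℂ] A) :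
    opActR A Γ x (tensorActR A Γ y w) = tensorActR A Γ y (opActR A Γ x w) := by
  induction x using TensorProduct.induction_on with
  | zero => simp
  | add x x' h h' => simp only [map_add, LinearMap.add_apply, h, h']
  | tmul a b =>
    induction y using TensorProduct.induction_on with
    | zero => simp
    | add y y' h h' => simp only [map_add, LinearMap.add_apply, h, h']
    | tmul c d =>
      induction w using TensorProduct.induction_on with
      | zero => simp
      | add w w' h h' => simp only [map_add, h, h']
      | tmul e ρ =>
        simp only [opActR_tmul, tensorActR_tmul, mul_assoc, smul_comm c (MulOpposite.op a) e]

end RightAction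

section Extension

variable {q : ℂ} [NeZero q] {Γ T : Type*} [AddCommGroup Γ] [Module ℂ Γ] [Module (GLq q)ᵐᵒᵖ Γ]
  [IsScalarTower ℂ (GLq q)ᵐᵒᵖ Γ] [AddCommGroup T] [Module ℂ T]

/-- A linear map that is compatible with the right multiplication by the coordinates is compatible
with the right multiplication. -/
theorem map_op_smul (act : GLq q ⊗[ℂ] GLq q →ₗ[ℂ] T →ₗ[ℂ] T) (hone : ∀ w, act 1 w = w)
    (hmul : ∀ x y w, act (x * y) w = act y (act x w)) (co : Γ →ₗ[ℂ] T)
    (hz : ∀ m n x, co (x <• z q m n) = act (Coalgebra.comul (R := ℂ) (z q m n)) (co x))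
    (a : GLq q) (x : Γ) : co (x <• a) = act (Coalgebra.comul (R := ℂ) a) (co x) := by
  revert x
  induction a using GLq.induction_of_inverse with
  | halg c =>
    intro x
    rw [Algebra.algebraMap_eq_smul_one, LinearMap.map_smul Coalgebra.comul, Bialgebra.comul_one,
      LinearMap.map_smul act, LinearMap.smul_apply, hone, MulOpposite.op_smul, smul_assoc,
      MulOpposite.op_one, one_smul, LinearMap.map_smul co]
  | hz m n => exact hz m n
  | hadd a b ha hb =>
    intro x
    rw [MulOpposite.op_add, add_smul, map_add, ha, hb, map_add, map_add, LinearMap.add_apply]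
  | hmul a b ha hb =>
    intro x
    rw [MulOpposite.op_mul, mul_smul, hb, ha, Bialgebra.comul_mul, hmul]
  | hinv a b hab hba ha =>
    intro x
    have h1 := ha (x <• b)
    rw [smul_smul, ← MulOpposite.op_mul, hba, MulOpposite.op_one, one_smul] at h1
    rw [h1, ← hmul, ← Bialgebra.comul_mul, hab, Bialgebra.comul_one, hone]

end Extension

/-! ### The free bimodule of forms and its calculus -/

section Forms

variable {q : ℂ} [NeZero q]

/-- The free left module on generators `ω_i^j`, with the right multiplication
`ω_r a = ∑ Θ(a)_{rc} ω_c`. -/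
def Forms (_Θ : GLq q →ₐ[ℂ] Matrix (Fin 3 × Fin 3) (Fin 3 × Fin 3) (GLq q)) : Type u :=
  ULift.{u} (Fin 3 × Fin 3) → GLq q

variable (Θ : GLq q →ₐ[ℂ] Matrix (Fin 3 × Fin 3) (Fin 3 × Fin 3) (GLq q))

noncomputable instance : AddCommGroup (Forms.{u} Θ) :=
  inferInstanceAs (AddCommGroup (ULift.{u} (Fin 3 × Fin 3) → GLq q))

noncomputable instance : Module ℂ (Forms.{u} Θ) :=
  inferInstanceAs (Module ℂ (ULift.{u} (Fin 3 × Fin 3) → GLq q))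

noncomputable instance : Module (GLq q) (Forms.{u} Θ) :=
  inferInstanceAs (Module (GLq q) (ULift.{u} (Fin 3 × Fin 3) → GLq q))

instance : IsScalarTower ℂ (GLq q) (Forms.{u} Θ) :=
  inferInstanceAs (IsScalarTower ℂ (GLq q) (ULift.{u} (Fin 3 × Fin 3) → GLq q))

noncomputable instance : SMul (GLq q)ᵐᵒᵖ (Forms.{u} Θ) where
  smul a x := fun c => ∑ r, x ⟨r⟩ * Θ a.unop r c.down

variable {Θ}

theorem Forms.op_smul_apply (a : GLq q) (x : Forms.{u} Θ) (c : ULift.{u} (Fin 3 × Fin 3)) :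
    (x <• a) c = ∑ r, x ⟨r⟩ * Θ a r c.down := rfl

theorem Forms.smul_apply (a : GLq q) (x : Forms.{u} Θ) (c : ULift.{u} (Fin 3 × Fin 3)) :
    (a • x) c = a * x c := rfl

theorem Forms.add_apply (x y : Forms.{u} Θ) (c : ULift.{u} (Fin 3 × Fin 3)) :
    (x + y) c = x c + y c := rfl

theorem Forms.zero_apply (c : ULift.{u} (Fin 3 × Fin 3)) : (0 : Forms.{u} Θ) c = 0 := rfl

variable (Θ)

noncomputable instance : Module (GLq q)ᵐᵒᵖ (Forms.{u} Θ) where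
  one_smul x := funext fun c => by
    change (x <• (1 : GLq q)) c = _
    rw [Forms.op_smul_apply]
    simp [Matrix.one_apply]
  mul_smul a b x := funext fun c => by
    change (x <• (b.unop * a.unop)) c = ((x <• b.unop) <• a.unop) c
    simp only [Forms.op_smul_apply, map_mul, Matrix.mul_apply, Finset.mul_sum, Finset.sum_mul,
      mul_assoc]
    rw [Finset.sum_comm]
  smul_zero a := funext fun c => by
    change ((0 : Forms Θ) <• a.unop) c = _
    rw [Forms.op_smul_apply]
    simp [Forms.zero_apply]
  smul_add a x y := funext fun c => by
    change ((x + y) <• a.unop) c = (x <• a.unop) c + (y <• a.unop) c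
    simp only [Forms.op_smul_apply, Forms.add_apply, add_mul, Finset.sum_add_distrib]
  add_smul a b x := funext fun c => by
    change (x <• (a.unop + b.unop)) c = (x <• a.unop) c + (x <• b.unop) c
    simp only [Forms.op_smul_apply, map_add, Matrix.add_apply, mul_add, Finset.sum_add_distrib]
  zero_smul x := funext fun c => by
    change (x <• (0 : GLq q)) c = 0
    rw [Forms.op_smul_apply]
    simp

instance : IsScalarTower ℂ (GLq q)ᵐᵒᵖ (Forms.{u} Θ) where
  smul_assoc k a x := funext fun c => by
    change (x <• (k • a.unop)) c = k • (x <• a.unop) c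
    simp only [Forms.op_smul_apply, map_smul, Matrix.smul_apply, mul_smul_comm, Finset.smul_sum]

instance : SMulCommClass (GLq q) (GLq q)ᵐᵒᵖ (Forms.{u} Θ) where
  smul_comm a b x := funext fun c => by
    change a * (x <• b.unop) c = ((a • x) <• b.unop) c
    simp only [Forms.op_smul_apply, Forms.smul_apply, Finset.mul_sum, mul_assoc]

/-- The generators `ω_i^j`. -/
noncomputable def Forms.gen (i j : Fin 3) : Forms.{u} Θ := fun c => if c.down = (i, j) then 1 else 0

variable {Θ}

theorem Forms.eq_sum (x : Forms.{u} Θ) : x = ∑ i, ∑ j, x ⟨(i, j)⟩ • Forms.gen Θ i j := by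
  have h : ∀ (f : Fin 3 → Fin 3 → Forms.{u} Θ) (c : ULift.{u} (Fin 3 × Fin 3)),
      (∑ i, ∑ j, f i j) c = ∑ i, ∑ j, f i j c := fun f c => by
    simp only [Fin.sum_univ_three, Forms.add_apply]
  funext ⟨k, l⟩
  rw [h]
  simp [Forms.smul_apply, Forms.gen, ite_and]

theorem Forms.gen_smul (i j : Fin 3) (a : GLq q) :
    Forms.gen.{u} Θ i j <• a = ∑ k, ∑ l, Θ a (i, j) (k, l) • Forms.gen Θ k l := by
  rw [Forms.eq_sum (Forms.gen.{u} Θ i j <• a)]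
  simp [Forms.op_smul_apply, Forms.gen, -Prod.mk.injEq]

/-- The `j`-th coordinate as a linear functional. -/
noncomputable def Forms.coord (i j : Fin 3) : Forms.{u} Θ →ₗ[ℂ] GLq q where
  toFun x := x ⟨(i, j)⟩
  map_add' _ _ := rfl
  map_smul' _ _ := rfl

end Forms

section FormsCalculus

variable {q : ℂ} [NeZero q] (Θ : GLq q →ₐ[ℂ] Matrix (Fin 3 × Fin 3) (Fin 3 × Fin 3) (GLq q))

/-- The form `∑ ω_i^i`. -/
noncomputable def Forms.trace : Forms.{u} Θ := ∑ i, Forms.gen Θ i i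

/-- The differential `da = (q - q⁻¹)⁻¹ [∑ ω_i^i, a]`. -/
noncomputable def Forms.d : GLq q →ₗ[ℂ] Forms.{u} Θ where
  toFun a := (q - q⁻¹)⁻¹ • (Forms.trace Θ <• a - a • Forms.trace Θ)
  map_add' a b := by
    rw [MulOpposite.op_add, add_smul, add_smul, ← smul_add]
    congr 1
    abel
  map_smul' r a := by
    rw [MulOpposite.op_smul, smul_assoc, smul_assoc, RingHom.id_apply, ← smul_sub, smul_comm]

theorem Forms.d_apply (a : GLq q) :
    Forms.d.{u} Θ a = (q - q⁻¹)⁻¹ • (Forms.trace Θ <• a - a • Forms.trace Θ) := rfl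

theorem Forms.leibniz (a b : GLq q) :
    Forms.d.{u} Θ (a * b) = Forms.d Θ a <• b + a • Forms.d Θ b := by
  rw [Forms.d_apply, Forms.d_apply, Forms.d_apply, smul_comm (MulOpposite.op b), smul_comm a,
    smul_sub (MulOpposite.op b), smul_sub a, ← smul_comm a (MulOpposite.op b), ← smul_add,
    MulOpposite.op_mul, mul_smul, mul_smul]
  congr 1
  abel

/-- The left coaction, for which the generators are invariant. -/
noncomputable def Forms.coL : Forms.{u} Θ →ₗ[ℂ] GLq q ⊗[ℂ] Forms.{u} Θ :=
  ∑ i, ∑ j, (tensorActL (GLq q) (Forms.{u} Θ)).flip (1 ⊗ₜ Forms.gen Θ i j) ∘ₗ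
    Coalgebra.comul ∘ₗ Forms.coord i j

/-- The right coaction `ω_k^l ↦ ω_i^j ⊗ z^i_k S(z^l_j)`. -/
noncomputable def Forms.coR : Forms.{u} Θ →ₗ[ℂ] Forms.{u} Θ ⊗[ℂ] GLq q :=
  ∑ k, ∑ l, (tensorActR (GLq q) (Forms.{u} Θ)).flip
    (∑ i, ∑ j, Forms.gen Θ i j ⊗ₜ (z q i k * Smat q l j)) ∘ₗ
    Coalgebra.comul ∘ₗ Forms.coord k l

theorem Forms.coL_apply (x : Forms.{u} Θ) : Forms.coL Θ x = ∑ i, ∑ j,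
    tensorActL (GLq q) (Forms.{u} Θ) (Coalgebra.comul (R := ℂ) (x ⟨(i, j)⟩))
      (1 ⊗ₜ Forms.gen Θ i j) := by
  simp only [Forms.coL, LinearMap.sum_apply]
  rfl

theorem Forms.coR_apply (x : Forms.{u} Θ) : Forms.coR Θ x = ∑ k, ∑ l,
    tensorActR (GLq q) (Forms.{u} Θ) (Coalgebra.comul (R := ℂ) (x ⟨(k, l)⟩))
      (∑ i, ∑ j, Forms.gen Θ i j ⊗ₜ (z q i k * Smat q l j)) := by
  simp only [Forms.coR, LinearMap.sum_apply]
  rfl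

theorem Forms.coL_smul (a : GLq q) (x : Forms.{u} Θ) : Forms.coL Θ (a • x)
    = tensorActL (GLq q) (Forms.{u} Θ) (Coalgebra.comul (R := ℂ) a) (Forms.coL Θ x) := by
  simp only [Forms.coL_apply, Forms.smul_apply, Bialgebra.comul_mul, tensorActL_mul, map_sum]

theorem Forms.coR_smul (a : GLq q) (x : Forms.{u} Θ) : Forms.coR Θ (a • x)
    = tensorActR (GLq q) (Forms.{u} Θ) (Coalgebra.comul (R := ℂ) a) (Forms.coR Θ x) := by
  rw [Forms.coR_apply, Forms.coR_apply]
  generalize (fun k l => ∑ i, ∑ j, Forms.gen.{u} Θ i j ⊗ₜ[ℂ] (z q i k * Smat q l j)) = F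
  simp only [Forms.smul_apply, Bialgebra.comul_mul, tensorActR_mul]
  simp only [← map_sum (tensorActR (GLq q) (Forms.{u} Θ) (Coalgebra.comul (R := ℂ) a))]

theorem Forms.coL_gen (i j : Fin 3) :
    Forms.coL Θ (Forms.gen.{u} Θ i j) = 1 ⊗ₜ Forms.gen Θ i j := by
  rw [Forms.coL_apply, Finset.sum_eq_single i, Finset.sum_eq_single j]
  · simp [Forms.gen, tensorActL_one]
  · intro l _ hl; simp [Forms.gen, hl]
  · simp
  · intro k _ hk; simp [Forms.gen, hk]
  · simp

theorem Forms.coR_gen (k l : Fin 3) : Forms.coR Θ (Forms.gen.{u} Θ k l)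
    = ∑ i, ∑ j, Forms.gen Θ i j ⊗ₜ (z q i k * Smat q l j) := by
  rw [Forms.coR_apply, Finset.sum_eq_single k, Finset.sum_eq_single l]
  · rw [show Forms.gen.{u} Θ k l ⟨(k, l)⟩ = 1 from if_pos rfl, Bialgebra.comul_one, tensorActR_one]
  · intro l' _ hl
    rw [show Forms.gen.{u} Θ k l ⟨(k, l')⟩ = 0 from if_neg (by simp [hl]), map_zero, map_zero,
      LinearMap.zero_apply]
  · simp
  · intro k' _ hk
    refine Finset.sum_eq_zero fun l' _ => ?_
    rw [show Forms.gen.{u} Θ k l ⟨(k', l')⟩ = 0 from if_neg (by simp [hk]), map_zero, map_zero,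
      LinearMap.zero_apply]
  · simp

theorem Forms.coL_trace : Forms.coL Θ (Forms.trace.{u} Θ) = 1 ⊗ₜ Forms.trace Θ := by
  simp only [Forms.trace, map_sum, Forms.coL_gen, TensorProduct.tmul_sum]

theorem Forms.coR_trace : Forms.coR Θ (Forms.trace.{u} Θ) = Forms.trace Θ ⊗ₜ 1 := by
  simp only [Forms.trace, map_sum, Forms.coR_gen, TensorProduct.sum_tmul]
  rw [sum_rotate_three]
  simp only [← TensorProduct.tmul_sum, z_mul_Smat q (NeZero.ne q), TensorProduct.tmul_ite]
  simp

variable {Θ} {s : Matrix (Fin 3 × Fin 3) (Fin 3 × Fin 3) ℂ} {t p c : ℂ}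

/-- The coordinates act on the generators by a braiding. -/
def IsBraidedAction (Θ : GLq q →ₐ[ℂ] Matrix (Fin 3 × Fin 3) (Fin 3 × Fin 3) (GLq q))
    (s : Matrix (Fin 3 × Fin 3) (Fin 3 × Fin 3) ℂ) (t : ℂ) : Prop :=
  ∀ m n i j k l, Θ (z q m n) (i, j) (k, l)
    = ∑ d, (t * ∑ e, s (d, k) (i, e) * s (j, e) (n, l)) • z q m d

theorem Forms.coL_op_smul (hΘ : IsBraidedAction Θ s t) (a : GLq q) (x : Forms.{u} Θ) :
    Forms.coL Θ (x <• a)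
      = opActL (GLq q) (Forms.{u} Θ) (Coalgebra.comul (R := ℂ) a) (Forms.coL Θ x) := by
  refine map_op_smul _ (opActL_one _ _) (opActL_mul _ _) (Forms.coL Θ) (fun m n x => ?_) a x
  have h1 : ∀ i j, Forms.coL Θ (Forms.gen.{u} Θ i j <• z q m n)
      = opActL (GLq q) (Forms.{u} Θ) (Coalgebra.comul (R := ℂ) (z q m n))
        (1 ⊗ₜ Forms.gen Θ i j) := by
    intro i j
    simp only [Forms.gen_smul, hΘ m n i j, map_sum, Forms.coL_smul, Forms.coL_gen, comul_z, map_smul,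
      LinearMap.sum_apply, tensorActL_tmul, opActL_tmul, one_mul, mul_one,
      hΘ _ n i j, Finset.sum_smul, TensorProduct.tmul_sum, smul_assoc, TensorProduct.tmul_smul,
      Finset.smul_sum]
    conv_lhs => rw [sum_rotate_four]; rw [sum_rotate_four]; rw [sum_rotate_four]
  have hcomm : ∀ (y : GLq q) (ρ : Forms.{u} Θ), (y • ρ) <• z q m n
     = y • (ρ <• z q m n) := fun y ρ => (smul_comm y (MulOpposite.op (z q m n)) ρ).symm
  conv_lhs => rw [Forms.eq_sum x]
  conv_rhs => rw [Forms.eq_sum x]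
  simp only [Finset.smul_sum, hcomm, map_sum, Forms.coL_smul,
    h1, Forms.coL_gen, opActL_tensorActL]

theorem sum_swap_triples {M : Type*} [AddCommMonoid M]
    (F : Fin 3 → Fin 3 → Fin 3 → Fin 3 → Fin 3 → Fin 3 → M) :
    ∑ a, ∑ b, ∑ c, ∑ d, ∑ e, ∑ f, F a b c d e f
      = ∑ d, ∑ e, ∑ f, ∑ a, ∑ b, ∑ c, F a b c d e f := by
  simpa only [Fintype.sum_prod_type] using Finset.sum_comm (s := .univ) (t := .univ)
    (f := fun (p r : Fin 3 × Fin 3 × Fin 3) => F p.1 p.2.1 p.2.2 r.1 r.2.1 r.2.2)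

/-- Both sides are expanded in the forms z ω; comparing their coefficients in A leaves the identity
`key`, which no longer involves forms. -/
theorem Forms.coR_gen_smul_z {K : Fin 3 → Fin 3 → Fin 3 → Fin 3 → Fin 3 → Fin 3 → ℂ}
    (hK : ∀ m n i j k l, Θ (z q m n) (i, j) (k, l) = ∑ d, K d k i j l n • z q m d) {k l n : Fin 3}
    (key : ∀ d a b, ∑ d', ∑ a', ∑ b', K d' a' k l b' n • (z q d d' * (z q a a' * Smat q b' b))
      = ∑ i, ∑ j, ∑ f, K d a i j b f • (z q i k * Smat q l j * z q f n)) (m : Fin 3) :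
    Forms.coR Θ (Forms.gen.{u} Θ k l <• z q m n)
      = opActR (GLq q) (Forms.{u} Θ) (Coalgebra.comul (R := ℂ) (z q m n))
        (∑ i, ∑ j, Forms.gen Θ i j ⊗ₜ (z q i k * Smat q l j)) := by
  trans ∑ d, ∑ a, ∑ b, (z q m d • Forms.gen.{u} Θ a b) ⊗ₜ[ℂ] (∑ d', ∑ a', ∑ b',
    K d' a' k l b' n • (z q d d' * (z q a a' * Smat q b' b)))
  · simp only [Forms.gen_smul, hK, map_sum, Forms.coR_smul, Forms.coR_gen, comul_z, map_smul,
      LinearMap.sum_apply, tensorActR_tmul, Finset.sum_smul, 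
      TensorProduct.tmul_sum, smul_assoc, TensorProduct.tmul_smul, Finset.smul_sum]
    rw [sum_swap_triples, sum_rotate_three, sum_rotate_three]
    refine Finset.sum_congr rfl fun d _ => Finset.sum_congr rfl fun a _ =>
      Finset.sum_congr rfl fun b _ => ?_
    rw [sum_rotate_three, sum_rotate_three]
  · simp only [key]
    simp only [hK, Forms.gen_smul, map_sum, comul_z, LinearMap.sum_apply, opActR_tmul,
      Finset.sum_smul, TensorProduct.sum_tmul, TensorProduct.tmul_sum, smul_assoc,
      TensorProduct.tmul_smul, ← TensorProduct.smul_tmul', mul_assoc]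
    rw [sum_swap_triples]
    refine Finset.sum_congr rfl fun i _ => Finset.sum_congr rfl fun j _ =>
      Finset.sum_congr rfl fun f _ => ?_
    rw [sum_rotate_three]

/-- By multiplicativity it is enough to multiply the generators by z. There a coordinate z has to be
moved through z S(z): one copy of s carries it past the first factor by the relations of Z, the
other past S(z) by the exchange relation. -/
theorem Forms.coR_op_smul (hs : IsHeckeBraiding q p c s) (hΘ : IsBraidedAction Θ s t) (a : GLq q)
    (x : Forms.{u} Θ) : Forms.coR Θ (x <• a)
      = opActR (GLq q) (Forms.{u} Θ) (Coalgebra.comul (R := ℂ) a) (Forms.coR Θ x) := by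
  refine map_op_smul _ (opActR_one _ _) (opActR_mul _ _) (Forms.coR Θ) (fun m n x => ?_) a x
  have key : ∀ k l n d a b, ∑ d', ∑ a', ∑ b', (∑ e, s (d', a') (k, e) * s (l, e) (n, b')) •
        (z q d d' * (z q a a' * Smat q b' b))
      = ∑ i, ∑ j, ∑ f, (∑ e, s (d, a) (i, e) * s (j, e) (f, b)) •
        (z q i k * Smat q l j * z q f n) := by
    intro k l n d a b
    calc ∑ d', ∑ a', ∑ b', (∑ e, s (d', a') (k, e) * s (l, e) (n, b')) •
          (z q d d' * (z q a a' * Smat q b' b))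
        = ∑ e, ∑ b', s (l, e) (n, b') • ((∑ d', ∑ a', s (d', a') (k, e) • (z q d d' * z q a a'))
            * Smat q b' b) := by
          simp only [Finset.sum_mul, Finset.smul_sum, Finset.sum_smul, smul_mul_assoc, smul_smul,
            mul_assoc]
          rw [sum_swap_pairs, Finset.sum_comm]
          simp only [mul_comm]
      _ = ∑ e, ∑ i, s (d, a) (i, e) • (z q i k *
            ∑ j, ∑ f, s (j, e) (f, b) • (Smat q l j * z q f n)) := by
          simp only [cross_relation hs.comm l n _ b, ← hs.comm d a k _]
          simp only [Finset.sum_mul, Finset.mul_sum, Finset.smul_sum, smul_mul_assoc, mul_smul_comm,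
            smul_smul, mul_assoc]
          rw [sum_swap_pairs, Finset.sum_comm]
          simp only [mul_comm (s (l, _) _)]
      _ = _ := by
          simp only [Finset.mul_sum, Finset.smul_sum, Finset.sum_smul, mul_smul_comm, smul_smul,
            mul_assoc]
          rw [sum_rotate_four]
  have h1 : ∀ k l, Forms.coR Θ (Forms.gen.{u} Θ k l <• z q m n)
      = opActR (GLq q) (Forms.{u} Θ) (Coalgebra.comul (R := ℂ) (z q m n))
        (∑ i, ∑ j, Forms.gen Θ i j ⊗ₜ (z q i k * Smat q l j)) := by
    intro k l
    refine Forms.coR_gen_smul_z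
      (K := fun d k i j l n => t * ∑ e, s (d, k) (i, e) * s (j, e) (n, l)) (fun m n i j k l => hΘ m n i j k l)
      (fun d a b => ?_) m
    simp only [mul_smul, ← Finset.smul_sum, key]
  have hcomm : ∀ (y : GLq q) (ρ : Forms.{u} Θ), (y • ρ) <• z q m n
      = y • (ρ <• z q m n) := fun y ρ => (smul_comm y (MulOpposite.op (z q m n)) ρ).symm
  have h2 : ∀ k l, opActR (GLq q) (Forms.{u} Θ) (Coalgebra.comul (R := ℂ) (z q m n))
      (tensorActR (GLq q) (Forms.{u} Θ) (Coalgebra.comul (R := ℂ) (x ⟨(k, l)⟩))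
        (Forms.coR Θ (Forms.gen.{u} Θ k l)))
      = tensorActR (GLq q) (Forms.{u} Θ) (Coalgebra.comul (R := ℂ) (x ⟨(k, l)⟩))
        (Forms.coR Θ (Forms.gen.{u} Θ k l <• z q m n)) := fun k l => by
    rw [opActR_tensorActR, h1, Forms.coR_gen]
  conv_lhs => rw [Forms.eq_sum x]
  conv_rhs => rw [Forms.eq_sum x]
  simp only [Finset.smul_sum, hcomm, map_sum, Forms.coR_smul,
    h2]

/-- The trace form is coinvariant and the coaction respects both multiplications, so the coaction of
a commutator with the trace is computed factorwise in Δ(b). -/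
theorem Forms.coL_smul_d (hΘ : IsBraidedAction Θ s t) (a b : GLq q) :
    Forms.coL Θ (a • Forms.d.{u} Θ b) = tensorActL (GLq q) (Forms.{u} Θ)
      (Coalgebra.comul (R := ℂ) a) ((Forms.d Θ).lTensor (GLq q) (Coalgebra.comul (R := ℂ) b)) := by
  rw [Forms.coL_smul]
  congr 1
  rw [Forms.d_apply, map_smul, map_sub, Forms.coL_op_smul hΘ, Forms.coL_smul, Forms.coL_trace]
  induction (Coalgebra.comul (R := ℂ) b) using TensorProduct.induction_on with
  | zero => simp
  | add x y hx hy =>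
    simp only [map_add, LinearMap.add_apply] at *
    rw [← hx, ← hy]; module
  | tmul x y =>
    rw [opActL_tmul, tensorActL_tmul, one_mul, mul_one, LinearMap.lTensor_tmul, Forms.d_apply,
      ← TensorProduct.tmul_sub, ← TensorProduct.tmul_smul]

theorem Forms.coR_smul_d (hs : IsHeckeBraiding q p c s) (hΘ : IsBraidedAction Θ s t) (a b : GLq q) :
    Forms.coR Θ (a • Forms.d.{u} Θ b) = tensorActR (GLq q) (Forms.{u} Θ)
      (Coalgebra.comul (R := ℂ) a) ((Forms.d Θ).rTensor (GLq q) (Coalgebra.comul (R := ℂ) b)) := by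
  rw [Forms.coR_smul]
  congr 1
  rw [Forms.d_apply, map_smul, map_sub, Forms.coR_op_smul hs hΘ, Forms.coR_smul, Forms.coR_trace]
  induction (Coalgebra.comul (R := ℂ) b) using TensorProduct.induction_on with
  | zero => simp
  | add x y hx hy =>
    simp only [map_add, LinearMap.add_apply] at *
    rw [← hx, ← hy]; module
  | tmul x y =>
    rw [opActR_tmul, tensorActR_tmul, one_mul, mul_one, LinearMap.rTensor_tmul, Forms.d_apply,
      ← TensorProduct.sub_tmul, TensorProduct.smul_tmul']

theorem Forms.d_z (hs : IsHeckeBraiding q p c s) (hΘ : IsBraidedAction Θ s t) (hq : q - q⁻¹ ≠ 0)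
    (i j : Fin 3) : Forms.d.{u} Θ (z q i j)
      = ∑ k, z q i k • contract2 (heckeX q p t s) (Forms.gen Θ) k j := by
  have h1 : Forms.trace.{u} Θ <• z q i j
      = ∑ k, z q i k • t • contract2 (s * s) (Forms.gen Θ) k j := by
    simp only [Forms.trace, Finset.smul_sum, Forms.gen_smul, hΘ i j, contract2, Matrix.mul_apply,
      Fintype.sum_prod_type, Finset.sum_smul, smul_comm (z q i _) t, smul_comm (z q i _) (s _ _),
      Finset.mul_sum, mul_smul, smul_assoc]
    rw [sum_rotate_four, sum_rotate_three, sum_rotate_three]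
  rw [Forms.d_apply, h1, inv_smul_eq_iff₀ hq]
  simp only [Finset.smul_sum, smul_comm (q - q⁻¹) (z q i _), contract2_heckeX hs hq, smul_sub,
    Finset.sum_sub_distrib]
  simp [Finset.smul_sum, Forms.trace]

end FormsCalculus

/-! ### Coordinate basis and existence of the calculus -/

section Existence

variable {q : ℂ} [NeZero q] {Θ : GLq q →ₐ[ℂ] Matrix (Fin 3 × Fin 3) (Fin 3 × Fin 3) (GLq q)}
  {s : Matrix (Fin 3 × Fin 3) (Fin 3 × Fin 3) ℂ} {t p c : ℂ}

theorem Forms.sum_gen_eq_zero {h : Fin 3 → Fin 3 → GLq q}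
    (h0 : ∑ i, ∑ j, h i j • Forms.gen.{u} Θ i j = 0) : h = 0 := by
  have h1 : (fun c => h c.down.1 c.down.2 : Forms.{u} Θ) = 0 := by
    rw [Forms.eq_sum (fun c => h c.down.1 c.down.2 : Forms.{u} Θ)]
    exact h0
  funext i j
  exact congrFun h1 ⟨(i, j)⟩

theorem Forms.gen_eq (hs : IsHeckeBraiding q p c s) {N : Matrix (Fin 3 × Fin 3) (Fin 3 × Fin 3) ℂ}
    (hN : N * heckeU q t s = 1) (i j : Fin 3) : Forms.gen.{u} Θ i j
      = ∑ r, N (i, j) r • contract2 (heckeX q p t s) (Forms.gen Θ) r.1 r.2 := by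
  calc Forms.gen.{u} Θ i j = ∑ c : Fin 3 × Fin 3,
        (1 : Matrix (Fin 3 × Fin 3) (Fin 3 × Fin 3) ℂ) (i, j) c • Forms.gen.{u} Θ c.1 c.2 := by
        simp [Matrix.one_apply, ite_smul]
    _ = ∑ r, ∑ c : Fin 3 × Fin 3, (N (i, j) r * heckeU q t s r c) • Forms.gen.{u} Θ c.1 c.2 := by
        rw [Finset.sum_comm]
        simp only [← hN, Matrix.mul_apply, Finset.sum_smul]
    _ = _ := by
        simp only [contract2, ← heckeU_apply hs, Finset.smul_sum, smul_smul,
          Fintype.sum_prod_type]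

theorem Forms.contract2_independent (hs : IsHeckeBraiding q p c s)
    {N : Matrix (Fin 3 × Fin 3) (Fin 3 × Fin 3) ℂ} (hN : heckeU q t s * N = 1)
    {h : Fin 3 → Fin 3 → GLq q}
    (h0 : ∑ i, ∑ j, h i j • contract2 (heckeX q p t s) (Forms.gen.{u} Θ) i j = 0) : h = 0 := by
  have h1 : ∑ k, ∑ l, (∑ i, ∑ j, heckeU q t s (i, j) (k, l) • h i j) • Forms.gen.{u} Θ k l = 0 := by
    rw [← h0]
    simp only [contract2, ← heckeU_apply hs, Finset.sum_smul, Finset.smul_sum, smul_assoc,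
      smul_comm (h _ _) (heckeU q t s _ _)]
    rw [sum_swap_pairs]
  have h2 := Forms.sum_gen_eq_zero h1
  funext i j
  have h3 : ∀ c : Fin 3 × Fin 3, ∑ r : Fin 3 × Fin 3, heckeU q t s r c • h r.1 r.2 = 0 := fun c => by
    rw [Fintype.sum_prod_type]
    exact congrFun (congrFun h2 c.1) c.2
  calc h i j = ∑ r : Fin 3 × Fin 3,
        (1 : Matrix (Fin 3 × Fin 3) (Fin 3 × Fin 3) ℂ) r (i, j) • h r.1 r.2 := by
        simp [Matrix.one_apply, ite_smul]
    _ = ∑ c, N c (i, j) • ∑ r : Fin 3 × Fin 3, heckeU q t s r c • h r.1 r.2 := by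
        simp only [← hN, Matrix.mul_apply, Finset.sum_smul, Finset.smul_sum, smul_smul]
        rw [Finset.sum_comm]
        simp only [mul_comm]
    _ = 0 := by simp only [h3, smul_zero, Finset.sum_const_zero]

/-- The calculus on `Forms Θ`. -/
noncomputable def formsCalculus (hs : IsHeckeBraiding q p c s) (hΘ : IsBraidedAction Θ s t)
    (hspan : Submodule.span (GLq q) (Set.range (Forms.d.{u} Θ)) = ⊤) :
    BicovariantCalculus.{u} (GLq q) where
  Γ := Forms.{u} Θ
  d := Forms.d Θ
  leibniz := Forms.leibniz Θ
  span_d := hspan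
  coL := Forms.coL Θ
  coR := Forms.coR Θ
  coL_smul_d := Forms.coL_smul_d hΘ
  coR_smul_d := Forms.coR_smul_d hs hΘ

/-- The differentials dz arise from the generators by U followed by multiplication with Z, and both
are invertible. The same two inversions give linear independence. -/
theorem Forms.span_d_z (hs : IsHeckeBraiding q p c s) (hΘ : IsBraidedAction Θ s t)
    (hq : q - q⁻¹ ≠ 0) (hU : IsUnit (heckeU q t s)) : Submodule.span (GLq q)
      (Set.range fun r : Fin 3 × Fin 3 => Forms.d.{u} Θ (z q r.1 r.2)) = ⊤ := by
  obtain ⟨N, hN⟩ := hU.exists_left_inv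
  rw [eq_top_iff]
  intro x _
  have h1 : ∀ k j, contract2 (heckeX q p t s) (Forms.gen Θ) k j ∈ Submodule.span (GLq q)
      (Set.range fun r : Fin 3 × Fin 3 => Forms.d.{u} Θ (z q r.1 r.2)) := fun k j => by
    have h2 : contract2 (heckeX q p t s) (Forms.gen Θ) k j
        = ∑ i, Smat q k i • Forms.d.{u} Θ (z q i j) := by
      simp only [Forms.d_z hs hΘ hq, Finset.smul_sum, smul_smul]
      rw [Finset.sum_comm]
      simp only [← Finset.sum_smul, Smat_mul_z q (NeZero.ne q), ite_smul, one_smul, zero_smul]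
      simp
    rw [h2]
    exact Submodule.sum_mem _ fun i _ => Submodule.smul_mem _ _ (Submodule.subset_span ⟨(i, j), rfl⟩)
  rw [Forms.eq_sum x]
  refine Submodule.sum_mem _ fun i _ => Submodule.sum_mem _ fun j _ => Submodule.smul_mem _ _ ?_
  rw [Forms.gen_eq hs hN]
  exact Submodule.sum_mem _ fun r _ => Submodule.smul_of_tower_mem _ _ (h1 _ _)

theorem Forms.linearIndependent_d_z (hs : IsHeckeBraiding q p c s) (hΘ : IsBraidedAction Θ s t)
    (hq : q - q⁻¹ ≠ 0) (hU : IsUnit (heckeU q t s)) : LinearIndependent (GLq q)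
      (fun r : Fin 3 × Fin 3 => Forms.d.{u} Θ (z q r.1 r.2)) := by
  obtain ⟨N, hN⟩ := hU.exists_right_inv
  rw [Fintype.linearIndependent_iff]
  intro g hg
  simp only [Forms.d_z hs hΘ hq, Finset.smul_sum, smul_smul, Fintype.sum_prod_type] at hg
  have h1 : (fun k j => ∑ i, g (i, j) * z q i k) = (0 : Fin 3 → Fin 3 → GLq q) := by
    refine Forms.contract2_independent.{u} (Θ := Θ) hs hN ?_
    rw [← hg]
    simp only [Finset.sum_smul]
    rw [sum_rotate_three, sum_rotate_three]
    refine Finset.sum_congr rfl fun i _ => Finset.sum_comm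
  rintro ⟨i, j⟩
  have h2 : ∀ k, ∑ i, g (i, j) * z q i k = 0 := fun k => congrFun (congrFun h1 k) j
  have h3 : ∑ k, (∑ i', g (i', j) * z q i' k) * Smat q k i = g (i, j) := by
    simp only [Finset.sum_mul, mul_assoc]
    rw [Finset.sum_comm]
    simp only [← Finset.mul_sum, z_mul_Smat q (NeZero.ne q)]
    simp
  rw [← h3]
  simp only [h2, zero_mul, Finset.sum_const_zero]

/-- There is a calculus for which the coordinates act on the Maurer-Cartan forms by a braiding. -/
theorem exists_calculus (hs : IsHeckeBraiding q p c s) (hΘ : IsBraidedAction Θ s t)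
    (hq : q - q⁻¹ ≠ 0) (hU : IsUnit (heckeU q t s)) {x y : ℂ}
    (hx : heckeMu q p c t * x = -(t - 1) ^ 2) (hy : heckeMu q p c t * y = -(p * t * (t - 1))) :
    ∃ C : BicovariantCalculus.{u} (GLq q), HasCoordinateBasis C ∧
      ∀ i k j l, adz C k l (theta C i j) = adTheta s t x y C i k j l := by
  have hspan : Submodule.span (GLq q) (Set.range (Forms.d.{u} Θ)) = ⊤ := by
    rw [eq_top_iff, ← Forms.span_d_z.{u} hs hΘ hq hU]
    refine Submodule.span_mono ?_
    rintro _ ⟨r, rfl⟩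
    exact ⟨_, rfl⟩
  let C := formsCalculus.{u} hs hΘ hspan
  -- Only these two properties of the generators matter: they yield the Maurer-Cartan forms as
  -- contractions and the relations of the generating forms.
  obtain ⟨G, hd, hG⟩ : ∃ G : Fin 3 → Fin 3 → C.Γ,
      (∀ i j, C.d (z q i j) = ∑ k, z q i k • contract2 (heckeX q p t s) G k j) ∧
      ∀ i j a, G i j <• a = ∑ k, ∑ l, Θ a (i, j) (k, l) • G k l :=
    ⟨Forms.gen Θ, Forms.d_z hs hΘ hq, Forms.gen_smul⟩
  have hθ : ∀ i j, theta C i j = contract2 (heckeX q p t s) G i j := by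
    intro i j
    rw [theta_eq]
    simp only [hd]
    rw [sum_Smat_z_smul C (fun m => contract2 (heckeX q p t s) G m j)]
  have hω : HeckeRelations C s t G := by
    rw [heckeRelations_iff]
    intro i j k l
    simp only [hG, hΘ k l, Finset.smul_sum, Finset.sum_smul, smul_assoc, mul_smul, Finset.mul_sum]
    rw [sum_swap_pairs]
  refine ⟨C, ⟨Forms.linearIndependent_d_z hs hΘ hq hU, Forms.span_d_z hs hΘ hq hU⟩, ?_⟩
  exact fun i k j l => hω.adz_theta hs hθ hx hy i k j l

end Existence

/-! ### The two families -/

section Families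

variable {q : ℂ} [NeZero q] {t : ℂ}

theorem sub_inv_ne_zero (hq : q ≠ 0) (hq1 : q ≠ 1) (hq2 : q ≠ -1) : q - q⁻¹ ≠ 0 := by
  intro h
  have h1 : (q - 1) * (q + 1) = 0 := by
    have h2 : q * (q - q⁻¹) = 0 := by rw [h, mul_zero]
    rw [mul_sub, mul_inv_cancel₀ hq] at h2
    linear_combination h2
  rcases mul_eq_zero.1 h1 with h2 | h2
  · exact hq1 (by linear_combination h2)
  · exact hq2 (by linear_combination h2)

theorem admissible1_iff (hq : q ≠ 0) :
    Admissible1 q t ↔ t ≠ 0 ∧ heckeMu q (-(q - q⁻¹)) q⁻¹ t ≠ 0 := by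
  rw [Admissible1, ← admissible_factor1 hq]
  simp [hq]

theorem admissible2_iff (hq : q ≠ 0) :
    Admissible2 q t ↔ t ≠ 0 ∧ heckeMu q (q - q⁻¹) (q ^ 5) t ≠ 0 := by
  rw [Admissible2, ← admissible_factor2 hq]

/-- The denominator of σ and β is q²μ, so x = σ - β and y = qβ solve the equations required by the
adjoint action on θ. -/
theorem heckeMu_mul1 (hq : q ≠ 0) (h : heckeMu q (-(q - q⁻¹)) q⁻¹ t ≠ 0) :
    heckeMu q (-(q - q⁻¹)) q⁻¹ t * (sigma1 q t - beta1 q t) = -(t - 1) ^ 2 ∧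
    heckeMu q (-(q - q⁻¹)) q⁻¹ t * (q * beta1 q t) = -(-(q - q⁻¹) * t * (t - 1)) := by
  have hd : q ^ 4 * (q ^ 2 + 1) * (t - 1) - q ^ 2 + t = heckeMu q (-(q - q⁻¹)) q⁻¹ t * q ^ 2 := by
    rw [admissible_factor1 hq]; ring
  rw [sigma1, beta1, hd]
  generalize heckeMu q (-(q - q⁻¹)) q⁻¹ t = μ at h
  constructor <;> field_simp <;> ring

theorem heckeMu_mul2 (hq : q ≠ 0) (h : heckeMu q (q - q⁻¹) (q ^ 5) t ≠ 0) :
    heckeMu q (q - q⁻¹) (q ^ 5) t * (sigma2 q t - beta2 q t) = -(t - 1) ^ 2 ∧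
    heckeMu q (q - q⁻¹) (q ^ 5) t * (q⁻¹ * beta2 q t) = -((q - q⁻¹) * t * (t - 1)) := by
  have hd : q ^ 4 * (q ^ 2 * t - 1) + (q ^ 2 + 1) * (t - 1)
      = heckeMu q (q - q⁻¹) (q ^ 5) t := by
    rw [admissible_factor2 hq]; ring
  rw [sigma2, beta2, hd]
  generalize heckeMu q (q - q⁻¹) (q ^ 5) t = μ at h
  constructor <;> field_simp <;> ring

theorem exists_isBraidedAction1 (ht : t ≠ 0) :
    ∃ Θ : GLq q →ₐ[ℂ] Matrix (Fin 3 × Fin 3) (Fin 3 × Fin 3) (GLq q),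
      IsBraidedAction Θ (braidingInv q) t := by
  -- Only the ratio of the two normalizations matters; c⁺ = 1 and c⁻ = t realize the given t.
  obtain ⟨L, hL⟩ := exists_Lplus q one_ne_zero
  obtain ⟨L', hL'⟩ := exists_Lminus q ht
  have h := isJurcoPair_of_braidMatrix hL hL' one_ne_zero (braidingInv_mul q (NeZero.ne q))
  rw [div_one] at h
  exact ⟨jurcoAction L L', jurcoAction_z h⟩

theorem exists_isBraidedAction2 (ht : t ≠ 0) :
    ∃ Θ : GLq q →ₐ[ℂ] Matrix (Fin 3 × Fin 3) (Fin 3 × Fin 3) (GLq q),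
      IsBraidedAction Θ (braiding q) t := by
  obtain ⟨L, hL⟩ := exists_Lminus q one_ne_zero
  obtain ⟨L', hL'⟩ := exists_Lplus q ht
  have h := isJurcoPair_of_braidMatrix hL hL' one_ne_zero (braiding_mul_inv q (NeZero.ne q))
  rw [div_one] at h
  exact ⟨jurcoAction L L', jurcoAction_z h⟩

theorem isGamma1_iff_adz {C : BicovariantCalculus.{u} (GLq q)} : IsGamma1 C t ↔
    ∀ i k j l, adz C k l (theta C i j)
      = adTheta (braidingInv q) t (sigma1 q t - beta1 q t) (q * beta1 q t) C i k j l := by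
  rw [isGamma1_iff, adz_theta_iff (isHeckeBraiding_braidingInv q (NeZero.ne q))]

theorem isGamma2_iff_adz {C : BicovariantCalculus.{u} (GLq q)} : IsGamma2 C t ↔
    ∀ i k j l, adz C k l (theta C i j)
      = adTheta (braiding q) t (sigma2 q t - beta2 q t) (q⁻¹ * beta2 q t) C i k j l := by
  rw [isGamma2_iff, adz_theta_iff (isHeckeBraiding_braiding q (NeZero.ne q))]

theorem gamma1_properties (hq : q - q⁻¹ ≠ 0) (ht : Admissible1 q t) :
    (∃ C : BicovariantCalculus.{u} (GLq q), HasCoordinateBasis C ∧ IsGamma1 C t) ∧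
      IsUnit (U1 q t) ∧
      ∀ C : BicovariantCalculus.{u} (GLq q), HasCoordinateBasis C → IsGamma1 C t →
        ∃ ω : Module.Basis (Fin 3 × Fin 3) ℂ C.inv,
          (∀ i j, theta C i j = ∑ k, ∑ l, U1 q t (i, j) (k, l) • (ω (k, l) : C.Γ)) ∧
          RMatrixRelations1 C t (fun i j => (ω (i, j) : C.Γ)) ∧
          ∀ cp cm : ℂ, cp ≠ 0 → cm ≠ 0 → t = cm / cp →
            ∃ Lp Lm : GLq q →ₐ[ℂ] Matrix (Fin 3) (Fin 3) ℂ,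
              IsLFunctional (Rplus q cp) Lp ∧ IsLFunctional (Rminus q cm) Lm ∧
              IsJurco C Lp Lm (fun i j => (ω (i, j) : C.Γ)) := by
  have hq0 := NeZero.ne q
  obtain ⟨ht0, hμ⟩ := (admissible1_iff hq0).1 ht
  have hs := isHeckeBraiding_braidingInv q hq0
  obtain ⟨hx, hy⟩ := heckeMu_mul1 hq0 hμ
  have hU : IsUnit (heckeU q t (braidingInv q)) := isUnit_heckeU hs hq (neg_ne_zero.2 hq) ht0 hμ
  refine ⟨?_, by rwa [U1_eq q t hq0], fun C hC h => ?_⟩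
  · obtain ⟨Θ, hΘ⟩ := exists_isBraidedAction1 (q := q) ht0
    obtain ⟨C, hC, h⟩ := exists_calculus.{u} hs hΘ hq hU hx hy
    exact ⟨C, hC, isGamma1_iff_adz.2 h⟩
  · obtain ⟨ω, h1, h2, h3⟩ := exists_jurco_basis hC hs hq hU hx hy (isGamma1_iff_adz.1 h)
    refine ⟨ω, by rwa [U1_eq q t hq0], (rMatrixRelations1_iff C t _).2 h2, ?_⟩
    rintro cp cm hp hm rfl
    obtain ⟨L, hL⟩ := exists_Lplus q hp
    obtain ⟨L', hL'⟩ := exists_Lminus q hm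
    exact ⟨L, L', isLFunctional_plus hL, isLFunctional_minus hL', h3 L L'
      (isJurcoPair_of_braidMatrix hL hL' hp (braidingInv_mul q hq0))⟩

theorem gamma2_properties (hq : q - q⁻¹ ≠ 0) (ht : Admissible2 q t) :
    (∃ C : BicovariantCalculus.{u} (GLq q), HasCoordinateBasis C ∧ IsGamma2 C t) ∧
      IsUnit (U2 q t) ∧
      ∀ C : BicovariantCalculus.{u} (GLq q), HasCoordinateBasis C → IsGamma2 C t →
        ∃ ω : Module.Basis (Fin 3 × Fin 3) ℂ C.inv,
          (∀ i j, theta C i j = ∑ k, ∑ l, U2 q t (i, j) (k, l) • (ω (k, l) : C.Γ)) ∧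
          RMatrixRelations2 C t (fun i j => (ω (i, j) : C.Γ)) ∧
          ∀ cp cm : ℂ, cp ≠ 0 → cm ≠ 0 → t = cp / cm →
            ∃ Lp Lm : GLq q →ₐ[ℂ] Matrix (Fin 3) (Fin 3) ℂ,
              IsLFunctional (Rplus q cp) Lp ∧ IsLFunctional (Rminus q cm) Lm ∧
              IsJurco C Lm Lp (fun i j => (ω (i, j) : C.Γ)) := by
  have hq0 := NeZero.ne q
  obtain ⟨ht0, hμ⟩ := (admissible2_iff hq0).1 ht
  have hs := isHeckeBraiding_braiding q hq0
  obtain ⟨hx, hy⟩ := heckeMu_mul2 hq0 hμ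
  have hU : IsUnit (heckeU q t (braiding q)) := isUnit_heckeU hs hq hq ht0 hμ
  refine ⟨?_, by rwa [U2_eq q t], fun C hC h => ?_⟩
  · obtain ⟨Θ, hΘ⟩ := exists_isBraidedAction2 (q := q) ht0
    obtain ⟨C, hC, h⟩ := exists_calculus.{u} hs hΘ hq hU hx hy
    exact ⟨C, hC, isGamma2_iff_adz.2 h⟩
  · obtain ⟨ω, h1, h2, h3⟩ := exists_jurco_basis hC hs hq hU hx hy (isGamma2_iff_adz.1 h)
    refine ⟨ω, by rwa [U2_eq q t], (rMatrixRelations2_iff C t _).2 h2, ?_⟩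
    rintro cp cm hp hm rfl
    obtain ⟨L, hL⟩ := exists_Lminus q hm
    obtain ⟨L', hL'⟩ := exists_Lplus q hp
    exact ⟨L', L, isLFunctional_plus hL', isLFunctional_minus hL, h3 L L'
      (isJurcoPair_of_braidMatrix hL hL' hm (braiding_mul_inv q hq0))⟩

end Families

/-! ### Small representations: root vectors and torus characters -/

section StepHoms

/-- The images of the coordinates under a two-dimensional representation with one root vector. -/
noncomputable def stepMatrix (q : ℂ) (lo hi p' p : Fin 3) (i j : Fin 3) :
    Matrix (Fin 2) (Fin 2) ℂ :=
  !![if i = j then (if i = lo then q else 1) else 0, if i = p' ∧ j = p then 1 else 0;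
    0, if i = j then (if i = hi then q else 1) else 0]

/-- Adjacent indices `p' = p ± 1`, with `lo` the lower and `hi` the higher one. -/
def IsStep (lo hi p' p : Fin 3) : Prop :=
  (lo = 0 ∧ hi = 1 ∨ lo = 1 ∧ hi = 2) ∧ (p' = lo ∧ p = hi ∨ p' = hi ∧ p = lo)

/-- The upper right entry of such a representation is a functional playing the role of a raising or
lowering operator E or F; the diagonal entries are the group-like elements in its coproduct. -/
theorem isQMatrix_stepMatrix (q : ℂ) {lo hi p' p : Fin 3} (h : IsStep lo hi p' p) :
    IsQMatrix q (stepMatrix q lo hi p' p) := by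
  obtain ⟨⟨rfl, rfl⟩ | ⟨rfl, rfl⟩, ⟨rfl, rfl⟩ | ⟨rfl, rfl⟩⟩ := h <;>
  refine ⟨fun i j k h => ?_, fun i k j h => ?_, fun i k j l h h' => ?_, fun i k j l h h' => ?_⟩ <;>
  fin_cases i <;> fin_cases k <;> (first | (exfalso; revert h; decide) | skip) <;>
  fin_cases j <;> (first | (exfalso; revert h; decide) | skip) <;>
  (try fin_cases l) <;> (first | (exfalso; revert h'; decide) | skip) <;>
  simp [stepMatrix] <;>
  exact funext fun m => by fin_cases m <;> rfl

theorem qdet_stepMatrix (q : ℂ) {lo hi p' p : Fin 3} (h : IsStep lo hi p' p) :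
    qdet q (stepMatrix q lo hi p' p) = q • (1 : Matrix (Fin 2) (Fin 2) ℂ) := by
  obtain ⟨⟨rfl, rfl⟩ | ⟨rfl, rfl⟩, ⟨rfl, rfl⟩ | ⟨rfl, rfl⟩⟩ := h <;>
  ext i j <;> fin_cases i <;> fin_cases j <;>
  simp [qdet, stepMatrix]

variable {q : ℂ} [NeZero q]

/-- The representation of `GLq q` by the step matrices. -/
noncomputable def stepHom (q : ℂ) [NeZero q] {lo hi p' p : Fin 3} (h : IsStep lo hi p' p) :
    GLq q →ₐ[ℂ] Matrix (Fin 2) (Fin 2) ℂ :=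
  liftGL (stepMatrix q lo hi p' p) (q⁻¹ • 1) (isQMatrix_stepMatrix q h)
    (by rw [qdet_stepMatrix q h, smul_mul_smul_comm, mul_inv_cancel₀ (NeZero.ne q), one_smul,
      mul_one])
    (by rw [qdet_stepMatrix q h, smul_mul_smul_comm, inv_mul_cancel₀ (NeZero.ne q), one_smul,
      mul_one])

theorem stepHom_z {lo hi p' p : Fin 3} (h : IsStep lo hi p' p) (i j : Fin 3) :
    stepHom q h (z q i j) = stepMatrix q lo hi p' p i j := liftGL_z _ _ _ _ _ _ _

/-- In a product of three upper triangular matrices the off-diagonal entry is used in exactly one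
factor, which is the iterated coproduct of E or F on V ⊗ V ⊗ V. -/
theorem stepMatrix_mul_mul (lo hi p' p u j v l b n : Fin 3) :
    (stepMatrix q lo hi p' p u j * stepMatrix q lo hi p' p v l * stepMatrix q lo hi p' p b n) 0 1
      = (if u = p' ∧ j = p then if v = l then if b = n then
          (if l = hi then q else 1) * (if n = hi then q else 1) else 0 else 0 else 0)
        + (if u = j then if v = p' ∧ l = p then if b = n then
          (if j = lo then q else 1) * (if n = hi then q else 1) else 0 else 0 else 0)
        + (if u = j then if v = l then if b = p' ∧ n = p then
          (if j = lo then q else 1) * (if l = lo then q else 1) else 0 else 0 else 0) := by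
  have h : ∀ (P Q R : Prop) [Decidable P] [Decidable Q] [Decidable R] (x y w : ℂ),
      (if P then x else 0) * (if Q then y else 0) * (if R then w else 0)
        = if P then if Q then if R then x * y * w else 0 else 0 else 0 := by
    intro P Q R _ _ _ x y w
    by_cases hP : P <;> by_cases hQ : Q <;> by_cases hR : R <;> simp [hP, hQ, hR]
  have h00 : ∀ i j, stepMatrix q lo hi p' p i j 0 0
    = if i = j then (if j = lo then q else 1) else 0 := fun i j => by
    by_cases hij : i = j <;> simp [stepMatrix, hij]
  have h01 : ∀ i j, stepMatrix q lo hi p' p i j 0 1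
    = if i = p' ∧ j = p then 1 else 0 := fun _ _ => rfl
  have h10 : ∀ i j, stepMatrix q lo hi p' p i j 1 0 = 0 := fun _ _ => rfl
  have h11 : ∀ i j, stepMatrix q lo hi p' p i j 1 1
    = if i = j then (if j = hi then q else 1) else 0 := fun i j => by
    by_cases hij : i = j <;> simp [stepMatrix, hij]
  simp only [Matrix.mul_apply, Fin.sum_univ_two, h10, mul_zero, add_mul, h00, h01, h11, h,
    mul_one, one_mul]
  ring

/-- The diagonal character of `GLq q`. -/
noncomputable def torusHom (q : ℂ) (k : Fin 3 → ℂ) (hk : ∀ i, k i ≠ 0) : GLq q →ₐ[ℂ] ℂ :=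
  liftGL (fun i j => if i = j then k i else 0) (k 0 * k 1 * k 2)⁻¹
    { row := fun i j k h => by
        by_cases h1 : i = j <;> by_cases h2 : i = k <;> simp_all
      col := fun i k j h => by
        by_cases h1 : i = j <;> by_cases h2 : k = j <;> simp_all
      anti := fun i k j l h h' => by ring
      diag := fun i a j l h h' => by
        have : ¬ (a = j ∧ i = l) := by rintro ⟨rfl, rfl⟩; exact lt_asymm h h'
        have h0 : (if a = j then k a else 0) * (if i = l then k i else 0) = 0 := by
          by_cases h1 : a = j
          · rw [if_neg (fun h2 => this ⟨h1, h2⟩), mul_zero]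
          · rw [if_neg h1, zero_mul]
        rw [h0, smul_zero, add_zero, mul_comm] }
    (by have h0 := hk 0; have h1 := hk 1; have h2 := hk 2; simp [qdet]; field_simp)
    (by have h0 := hk 0; have h1 := hk 1; have h2 := hk 2; simp [qdet]; field_simp)

theorem torusHom_z (k : Fin 3 → ℂ) (hk : ∀ i, k i ≠ 0) (i j : Fin 3) :
    torusHom q k hk (z q i j) = if i = j then k i else 0 := liftGL_z _ _ _ _ _ _ _

end StepHoms

/-! ### Endomorphisms of the third tensor power -/

section Commutant

variable (q : ℂ)

/-- The third tensor power of the matrix of coordinates. -/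
noncomputable def zCube : Matrix (Fin 3 × Fin 3 × Fin 3) (Fin 3 × Fin 3 × Fin 3) (GLq q) :=
  Matrix.of fun r c => z q r.1 c.1 * z q r.2.1 c.2.1 * z q r.2.2 c.2.2

/-- The endomorphisms of the third tensor power of the corepresentation. -/
noncomputable def commutant :
    Subalgebra ℂ (Matrix (Fin 3 × Fin 3 × Fin 3) (Fin 3 × Fin 3 × Fin 3) ℂ) :=
  (Subalgebra.centralizer ℂ {zCube q}).comap (Algebra.ofId ℂ (GLq q)).mapMatrix

variable {q} {g : Matrix (Fin 3 × Fin 3 × Fin 3) (Fin 3 × Fin 3 × Fin 3) ℂ}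

theorem mem_commutant_iff : g ∈ commutant q ↔ ∀ i k a j l n,
    ∑ u, ∑ v, ∑ b, g (i, k, a) (u, v, b) • (z q u j * z q v l * z q b n)
      = ∑ u, ∑ v, ∑ b, g (u, v, b) (j, l, n) • (z q i u * z q k v * z q a b) := by
  simp only [commutant, Subalgebra.mem_comap, Subalgebra.mem_centralizer_iff, Set.mem_singleton_iff,
    forall_eq]
  rw [eq_comm, ← Matrix.ext_iff]
  simp only [Prod.forall, Matrix.mul_apply, Fintype.sum_prod_type, AlgHom.mapMatrix_apply,
    Matrix.map_apply, Algebra.ofId_apply, zCube, Matrix.of_apply, Algebra.smul_def,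
    Algebra.commutes]

theorem leg12_mem_commutant [NeZero q] {p c : ℂ} {s : Matrix (Fin 3 × Fin 3) (Fin 3 × Fin 3) ℂ}
    (hs : IsHeckeBraiding q p c s) : leg12 s ∈ commutant q := by
  rw [mem_commutant_iff]
  intro i k a j l n
  have h := congrArg (· * z q a n) (hs.comm i k j l)
  simp only [Finset.sum_mul, smul_mul_assoc] at h
  simpa [leg12_apply, ite_smul] using h

theorem leg23_mem_commutant [NeZero q] {p c : ℂ} {s : Matrix (Fin 3 × Fin 3) (Fin 3 × Fin 3) ℂ}
    (hs : IsHeckeBraiding q p c s) : leg23 s ∈ commutant q := by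
  rw [mem_commutant_iff]
  intro i k a j l n
  have h := congrArg (z q i j * ·) (hs.comm k a l n)
  simp only [Finset.mul_sum, mul_smul_comm, ← mul_assoc] at h
  simpa [leg23_apply, ite_smul, Finset.sum_ite_irrel] using h

variable [NeZero q]

theorem commutant_apply {n : Type*} [Fintype n] [DecidableEq n] (φ : GLq q →ₐ[ℂ] Matrix n n ℂ)
    (hg : g ∈ commutant q) (α β : n) (i k a j l m : Fin 3) :
    ∑ u, ∑ v, ∑ b, g (i, k, a) (u, v, b) * (φ (z q u j) * φ (z q v l) * φ (z q b m)) α β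
      = ∑ u, ∑ v, ∑ b, g (u, v, b) (j, l, m) * (φ (z q i u) * φ (z q k v) * φ (z q a b)) α β := by
  have h := congrFun (congrFun (congrArg φ (mem_commutant_iff.1 hg i k a j l m)) α) β
  simpa only [map_sum, map_smul, map_mul, Matrix.sum_apply, Matrix.smul_apply, smul_eq_mul] using h

/-- An endomorphism commutes with the root vector, so if it kills a basis vector it also kills the
image of that vector, a combination of the vectors in which one index p is changed to p'. -/
theorem step_rule {lo hi p' p : Fin 3} (h : IsStep lo hi p' p) (hg : g ∈ commutant q)
    {j l n : Fin 3} (h0 : ∀ r, g r (j, l, n) = 0) (r : Fin 3 × Fin 3 × Fin 3) :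
    (if j = p then (if l = hi then q else 1) * (if n = hi then q else 1) * g r (p', l, n) else 0)
    + (if l = p then (if j = lo then q else 1) * (if n = hi then q else 1) * g r (j, p', n) else 0)
    + (if n = p then (if j = lo then q else 1) * (if l = lo then q else 1) * g r (j, l, p') else 0)
    = 0 := by
  obtain ⟨i, k, a⟩ := r
  have h1 := commutant_apply (stepHom q h) hg 0 1 i k a j l n
  simp only [h0, zero_mul, Finset.sum_const_zero, stepHom_z, stepMatrix_mul_mul, mul_add,
    Finset.sum_add_distrib, add_zero] at h1
  refine Eq.trans ?_ h1
  generalize (if l = hi then q else 1) = x1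
  generalize (if n = hi then q else 1) = x2
  generalize (if j = lo then q else 1) = x3
  generalize (if l = lo then q else 1) = x4
  simp only [ite_and, ite_mul, zero_mul, Finset.sum_ite_irrel, Finset.sum_ite_eq, Finset.sum_ite_eq',
    Finset.mem_univ, if_true, Finset.sum_const_zero, mul_comm (g _ _)]

/-- The vector e₂ ⊗ e₁ ⊗ e₀ generates the whole tensor power under the root vectors. The order is
chosen so that every step involves a single new column, with a coefficient that is nonzero for all q
≠ 0, roots of unity included. -/
theorem eq_zero_of_mem_commutant (hg : g ∈ commutant q) (h210 : ∀ r, g r (2, 1, 0) = 0) :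
    g = 0 := by
  have hq := NeZero.ne q
  have e0 : IsStep 0 1 0 1 := by simp [IsStep]
  have e1 : IsStep 1 2 1 2 := by simp [IsStep]
  have f0 : IsStep 0 1 1 0 := by simp [IsStep]
  have f1 : IsStep 1 2 2 1 := by simp [IsStep]
  have h200 : ∀ r, g r (2, 0, 0) = 0 := fun r => by
    simpa [hq] using step_rule e0 hg h210 r
  have h110 : ∀ r, g r (1, 1, 0) = 0 := fun r => by
    simpa [hq] using step_rule e1 hg h210 r
  have h211 : ∀ r, g r (2, 1, 1) = 0 := fun r => by
    simpa [hq] using step_rule f0 hg h210 r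
  have h220 : ∀ r, g r (2, 2, 0) = 0 := fun r => by
    simpa [hq] using step_rule f1 hg h210 r
  have h100 : ∀ r, g r (1, 0, 0) = 0 := fun r => by
    simpa [hq] using step_rule e1 hg h200 r
  have h201 : ∀ r, g r (2, 0, 1) = 0 := fun r => by
    simpa [hq, h210 r] using step_rule f0 hg h200 r
  have h010 : ∀ r, g r (0, 1, 0) = 0 := fun r => by
    simpa [hq, h100 r] using step_rule e0 hg h110 r
  have h111 : ∀ r, g r (1, 1, 1) = 0 := fun r => by
    simpa [hq] using step_rule f0 hg h110 r
  have h120 : ∀ r, g r (1, 2, 0) = 0 := fun r => by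
    simpa [hq, h210 r] using step_rule f1 hg h110 r
  have h221 : ∀ r, g r (2, 2, 1) = 0 := fun r => by
    simpa [hq] using step_rule f0 hg h220 r
  have h212 : ∀ r, g r (2, 1, 2) = 0 := fun r => by
    simpa [hq, h221 r] using step_rule f1 hg h211 r
  have h000 : ∀ r, g r (0, 0, 0) = 0 := fun r => by
    simpa [hq] using step_rule e0 hg h100 r
  have h101 : ∀ r, g r (1, 0, 1) = 0 := fun r => by
    simpa [hq, h110 r] using step_rule f0 hg h100 r
  have h202 : ∀ r, g r (2, 0, 2) = 0 := fun r => by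
    simpa [hq] using step_rule f1 hg h201 r
  have h011 : ∀ r, g r (0, 1, 1) = 0 := fun r => by
    simpa [hq, h110 r] using step_rule f0 hg h010 r
  have h020 : ∀ r, g r (0, 2, 0) = 0 := fun r => by
    simpa [hq] using step_rule f1 hg h010 r
  have h121 : ∀ r, g r (1, 2, 1) = 0 := fun r => by
    simpa [hq] using step_rule f0 hg h120 r
  have h222 : ∀ r, g r (2, 2, 2) = 0 := fun r => by
    simpa [hq] using step_rule f1 hg h221 r
  have h112 : ∀ r, g r (1, 1, 2) = 0 := fun r => by
    simpa [hq, h211 r, h121 r] using step_rule f1 hg h111 r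
  have h001 : ∀ r, g r (0, 0, 1) = 0 := fun r => by
    simpa [hq, h100 r, h010 r] using step_rule f0 hg h000 r
  have h102 : ∀ r, g r (1, 0, 2) = 0 := fun r => by
    simpa [hq, h201 r] using step_rule f1 hg h101 r
  have h021 : ∀ r, g r (0, 2, 1) = 0 := fun r => by
    simpa [hq, h120 r] using step_rule f0 hg h020 r
  have h122 : ∀ r, g r (1, 2, 2) = 0 := fun r => by
    simpa [hq, h221 r] using step_rule f1 hg h121 r
  have h012 : ∀ r, g r (0, 1, 2) = 0 := fun r => by
    simpa [hq, h021 r] using step_rule f1 hg h011 r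
  have h002 : ∀ r, g r (0, 0, 2) = 0 := fun r => by
    simpa [hq] using step_rule f1 hg h001 r
  have h022 : ∀ r, g r (0, 2, 2) = 0 := fun r => by
    simpa [hq] using step_rule f1 hg h021 r
  ext r ⟨j, l, n⟩
  revert r
  fin_cases j <;> fin_cases l <;> fin_cases n <;> assumption

end Commutant

/-! ### The commutant is the Hecke algebra -/

section CommutantBasis

variable {q : ℂ}

/-- On a strictly decreasing pair σ is the plain flip. Starting from (2, 1, 0), the six reduced
words therefore reach the six permuted basis vectors with coefficient 1. -/
theorem leg12_braiding_mulVec_single (q : ℂ) {a b : Fin 3} (c : Fin 3) (h : b < a) :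
    (leg12 (braiding q)).mulVec (Pi.single (a, b, c) 1) = Pi.single (b, a, c) 1 := by
  ext ⟨i, j, k⟩
  rw [leg12_braiding_mulVec]
  simp only [Pi.single_apply, Prod.mk.injEq]
  by_cases h1 : j = a <;> by_cases h2 : i = b <;> by_cases h3 : k = c <;>
    simp +contextual [h1, h2, h3, h.ne, h.ne', h.not_gt]

theorem leg23_braiding_mulVec_single (q : ℂ) (a : Fin 3) {b c : Fin 3} (h : c < b) :
    (leg23 (braiding q)).mulVec (Pi.single (a, b, c) 1) = Pi.single (a, c, b) 1 := by
  ext ⟨i, j, k⟩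
  rw [leg23_braiding_mulVec]
  simp only [Pi.single_apply, Prod.mk.injEq]
  by_cases h1 : k = b <;> by_cases h2 : j = c <;> by_cases h3 : i = a <;>
    simp +contextual [h1, h2, h3, h.ne, h.ne', h.not_gt]

/-- The general element of the Hecke algebra on the third tensor power. -/
noncomputable def heckeElement (q c0 c1 c2 c3 c4 c5 : ℂ) :
    Matrix (Fin 3 × Fin 3 × Fin 3) (Fin 3 × Fin 3 × Fin 3) ℂ :=
  c0 • 1 + c1 • leg12 (braiding q) + c2 • leg23 (braiding q)
    + c3 • (leg12 (braiding q) * leg23 (braiding q))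
    + c4 • (leg23 (braiding q) * leg12 (braiding q))
    + c5 • (leg12 (braiding q) * leg23 (braiding q) * leg12 (braiding q))

theorem heckeElement_mulVec (q c0 c1 c2 c3 c4 c5 : ℂ) :
    (heckeElement q c0 c1 c2 c3 c4 c5).mulVec (Pi.single (2, 1, 0) 1)
      = c0 • Pi.single (2, 1, 0) 1 + c1 • Pi.single (1, 2, 0) 1 + c2 • Pi.single (2, 0, 1) 1
        + c3 • Pi.single (0, 2, 1) 1 + c4 • Pi.single (1, 0, 2) 1 + c5 • Pi.single (0, 1, 2) 1 := by
  have h1 : (leg12 (braiding q)).mulVec (Pi.single (2, 1, 0) 1) = Pi.single (1, 2, 0) 1 :=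
    leg12_braiding_mulVec_single q 0 (by decide)
  have h2 : (leg23 (braiding q)).mulVec (Pi.single (2, 1, 0) 1) = Pi.single (2, 0, 1) 1 :=
    leg23_braiding_mulVec_single q 2 (by decide)
  have h3 : (leg12 (braiding q)).mulVec (Pi.single (2, 0, 1) 1) = Pi.single (0, 2, 1) 1 :=
    leg12_braiding_mulVec_single q 1 (by decide)
  have h4 : (leg23 (braiding q)).mulVec (Pi.single (1, 2, 0) 1) = Pi.single (1, 0, 2) 1 :=
    leg23_braiding_mulVec_single q 1 (by decide)
  have h5 : (leg12 (braiding q)).mulVec (Pi.single (1, 0, 2) 1) = Pi.single (0, 1, 2) 1 :=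
    leg12_braiding_mulVec_single q 2 (by decide)
  simp only [heckeElement, Matrix.add_mulVec, Matrix.smul_mulVec, Matrix.one_mulVec,
    ← Matrix.mulVec_mulVec, h1, h2, h3, h4, h5]

variable [NeZero q]

theorem heckeElement_mem_commutant (c0 c1 c2 c3 c4 c5 : ℂ) :
    heckeElement q c0 c1 c2 c3 c4 c5 ∈ commutant q := by
  have h1 := leg12_mem_commutant (isHeckeBraiding_braiding q (NeZero.ne q))
  have h2 := leg23_mem_commutant (isHeckeBraiding_braiding q (NeZero.ne q))
  have h3 : ∀ {x}, x ∈ commutant q → ∀ c : ℂ, c • x ∈ commutant q :=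
    fun hx c => (commutant q).smul_mem hx c
  exact add_mem (add_mem (add_mem (add_mem (add_mem (h3 (one_mem _) _) (h3 h1 _)) (h3 h2 _))
    (h3 (mul_mem h1 h2) _)) (h3 (mul_mem h2 h1) _)) (h3 (mul_mem (mul_mem h1 h2) h1) _)

/-- Endomorphisms commute with the torus. The three distinct primes form a character that already
separates multisets of three indices, by unique factorization. -/
theorem commutant_weight {f : Matrix (Fin 3 × Fin 3 × Fin 3) (Fin 3 × Fin 3 × Fin 3) ℂ}
    (hf : f ∈ commutant q) (i k a j l n : Fin 3) :
    f (i, k, a) (j, l, n) * ((![2, 3, 5] : Fin 3 → ℂ) j * (![2, 3, 5] : Fin 3 → ℂ) l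
        * (![2, 3, 5] : Fin 3 → ℂ) n)
      = f (i, k, a) (j, l, n) * ((![2, 3, 5] : Fin 3 → ℂ) i * (![2, 3, 5] : Fin 3 → ℂ) k
        * (![2, 3, 5] : Fin 3 → ℂ) a) := by
  have hk : ∀ i, (![2, 3, 5] : Fin 3 → ℂ) i ≠ 0 := fun i => by fin_cases i <;> simp
  have h := congrArg (torusHom q ![2, 3, 5] hk) (mem_commutant_iff.1 hf i k a j l n)
  simp only [map_sum, map_smul, map_mul, torusHom_z, smul_eq_mul] at h
  generalize (![2, 3, 5] : Fin 3 → ℂ) = w at h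
  simpa [ite_mul, mul_ite] using h

/-- The endomorphisms of the third tensor power are given by the Hecke algebra. -/
theorem exists_heckeElement {f : Matrix (Fin 3 × Fin 3 × Fin 3) (Fin 3 × Fin 3 × Fin 3) ℂ}
    (hf : f ∈ commutant q) : ∃ c0 c1 c2 c3 c4 c5, f = heckeElement q c0 c1 c2 c3 c4 c5 := by
  -- The coefficients are read from the column (2, 1, 0), whose entries outside the six permutations
  -- vanish by weight. The difference then has zero column there and is zero.
  refine ⟨f (2, 1, 0) (2, 1, 0), f (1, 2, 0) (2, 1, 0), f (2, 0, 1) (2, 1, 0),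
    f (0, 2, 1) (2, 1, 0), f (1, 0, 2) (2, 1, 0), f (0, 1, 2) (2, 1, 0), ?_⟩
  rw [← sub_eq_zero]
  refine eq_zero_of_mem_commutant (sub_mem hf (heckeElement_mem_commutant _ _ _ _ _ _)) ?_
  rintro ⟨i, k, a⟩
  have h1 := congrFun (heckeElement_mulVec q (f (2, 1, 0) (2, 1, 0)) (f (1, 2, 0) (2, 1, 0))
    (f (2, 0, 1) (2, 1, 0)) (f (0, 2, 1) (2, 1, 0)) (f (1, 0, 2) (2, 1, 0))
    (f (0, 1, 2) (2, 1, 0))) (i, k, a)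
  rw [Matrix.mulVec_single_one, Matrix.col_apply] at h1
  have h2 := commutant_weight hf i k a 2 1 0
  rw [Matrix.sub_apply, h1]
  fin_cases i <;> fin_cases k <;> fin_cases a <;>
    simp at h2 ⊢ <;> norm_num at h2 <;> exact h2

theorem heckeElement_injective {c0 c1 c2 c3 c4 c5 d0 d1 d2 d3 d4 d5 : ℂ}
    (h : heckeElement q c0 c1 c2 c3 c4 c5 = heckeElement q d0 d1 d2 d3 d4 d5) :
    c2 = d2 ∧ c3 = d3 ∧ c4 = d4 ∧ c5 = d5 := by
  have h1 := congrArg (fun X => Matrix.mulVec X (Pi.single (2, 1, 0) 1)) h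
  simp only [heckeElement_mulVec] at h1
  have h2 := congrFun h1 (2, 0, 1)
  have h3 := congrFun h1 (0, 2, 1)
  have h4 := congrFun h1 (1, 0, 2)
  have h5 := congrFun h1 (0, 1, 2)
  simp at h2 h3 h4 h5
  exact ⟨h2, h3, h4, h5⟩

/-- The coefficients of an element of the Hecke algebra that commutes with the first generator. -/
theorem heckeElement_comm {c0 c1 c2 c3 c4 c5 : ℂ}
    (h : leg12 (braiding q) * heckeElement q c0 c1 c2 c3 c4 c5
      = heckeElement q c0 c1 c2 c3 c4 c5 * leg12 (braiding q)) :
    c3 = c4 ∧ c5 = c2 + c3 * (q - q⁻¹) := by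
  have hsq := congrArg leg12 (braiding_sq q (NeZero.ne q))
  simp only [map_mul, map_add, map_smul, map_one] at hsq
  have h1 : leg12 (braiding q) * heckeElement q c0 c1 c2 c3 c4 c5
      = heckeElement q c1 (c0 + c1 * (q - q⁻¹)) c3 (c2 + c3 * (q - q⁻¹)) c5
        (c4 + c5 * (q - q⁻¹)) := by
    simp only [heckeElement, mul_add, mul_smul_comm, mul_one, ← mul_assoc, hsq, add_mul,
      smul_mul_assoc, one_mul]
    module
  have h2 : heckeElement q c0 c1 c2 c3 c4 c5 * leg12 (braiding q)
      = heckeElement q c1 (c0 + c1 * (q - q⁻¹)) c4 c5 (c2 + c4 * (q - q⁻¹))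
        (c3 + c5 * (q - q⁻¹)) := by
    have h3 : ∀ Y, Y * leg12 (braiding q) * leg12 (braiding q)
        = (q - q⁻¹) • (Y * leg12 (braiding q)) + Y := fun Y => by
      rw [mul_assoc, hsq, mul_add, mul_smul_comm, mul_one]
    simp only [heckeElement, add_mul, smul_mul_assoc, one_mul, h3, hsq]
    module
  -- Both products are again in standard form, by the Hecke relation for the first generator, so
  -- coefficients can be compared.
  rw [h1, h2] at h
  obtain ⟨h3, h4, -, -⟩ := heckeElement_injective h
  exact ⟨h3, h4.symm⟩

end CommutantBasis

theorem sum_rotate_five {M : Type*} [AddCommMonoid M]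
    (F : Fin 3 → Fin 3 → Fin 3 → Fin 3 → Fin 3 → M) :
    ∑ a, ∑ b, ∑ c, ∑ d, ∑ e, F a b c d e = ∑ b, ∑ c, ∑ d, ∑ e, ∑ a, F a b c d e := by
  rw [Finset.sum_comm]
  exact Finset.sum_congr rfl fun b _ => sum_rotate_four fun a c d e => F a b c d e

/-! ### Covariance of the quadratic Maurer-Cartan forms -/

section Covariance

variable {q : ℂ} [NeZero q] {C : BicovariantCalculus.{u} (GLq q)}

/-- On an arbitrary calculus no ω is available yet. Contraction with σ is invertible, and inverting
it on θ produces invariant forms with the right coaction z S(z), because σ commutes with Z ⊗ Z. -/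
theorem exists_braided_basis (hC : HasCoordinateBasis C) :
    ∃ η : Module.Basis (Fin 3 × Fin 3) ℂ C.inv,
      (∀ i j, theta C i j = contract2 (braiding q) (fun k l => (η (k, l) : C.Γ)) i j) ∧
      ∀ k l, C.coR (η (k, l)) = ∑ i, ∑ j, (η (i, j) : C.Γ) ⊗ₜ (z q i k * Smat q l j) := by
  have hq := NeZero.ne q
  let M : Matrix (Fin 3 × Fin 3) (Fin 3 × Fin 3) ℂ :=
    Matrix.of fun r c => braiding q (r.1, c.1) (r.2, c.2)
  have hM : IsUnit M := by
    rw [← Matrix.mulVec_injective_iff_isUnit, ← Matrix.coe_mulVecLin, injective_iff_map_eq_zero]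
    intro w hw
    have h := braiding_nondegenerate q hq (fun k l => w (k, l)) fun i j => by
      have h1 := congrFun hw (i, j)
      simpa [M, Matrix.mulVec, dotProduct, Fintype.sum_prod_type] using h1
    exact funext fun p => congrFun (congrFun h p.1) p.2
  obtain ⟨N, hMN⟩ := hM.exists_right_inv
  obtain ⟨η, hη, hθ⟩ := exists_inv_basis hC M N hMN
  have hθ' : ∀ i j, theta C i j = contract2 (braiding q) (fun k l => (η (k, l) : C.Γ)) i j :=
    fun i j => by
      rw [hθ (i, j), Fintype.sum_prod_type]
      rfl
  exact ⟨η, hθ', coR_generating (isHeckeBraiding_braiding q hq).comm (fun i j => hη (i, j))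
    (mul_eq_one_comm.1 hMN) hθ'⟩

theorem basis_tmul_injective (η : Module.Basis (Fin 3 × Fin 3) ℂ C.inv)
    {x y : Fin 3 → Fin 3 → GLq q} (h : ∑ i, ∑ j, (η (i, j) : C.Γ) ⊗ₜ[ℂ] x i j
      = ∑ i, ∑ j, (η (i, j) : C.Γ) ⊗ₜ[ℂ] y i j) (i j : Fin 3) : x i j = y i j := by
  obtain ⟨e, he⟩ := LinearMap.exists_extend (η.coord (i, j))
  have he' : ∀ p, e (η p) = if p = (i, j) then 1 else 0 := fun p => by
    have h1 := LinearMap.congr_fun he (η p)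
    rw [LinearMap.comp_apply, Submodule.subtype_apply] at h1
    rw [h1]
    simp [Finsupp.single_apply]
  have h1 := congrArg (TensorProduct.lid ℂ (GLq q) ∘ e.rTensor (GLq q)) h
  simpa [he', Prod.mk.injEq, ite_and, ite_smul, Finset.sum_ite_irrel] using h1

/-- The coefficients of `theta2` in η form a matrix f on three legs. Right covariance, after
comparing the coefficients of η and multiplying away the factor S(z) on the third leg, says that f
commutes with Z ⊗ Z ⊗ Z. -/
theorem exists_commutant (hC : HasCoordinateBasis C) :
    ∃ η : Module.Basis (Fin 3 × Fin 3) ℂ C.inv,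
      (∀ i j, theta C i j = contract2 (braiding q) (fun k l => (η (k, l) : C.Γ)) i j) ∧
      ∃ f ∈ commutant q, ∀ i k j l,
        theta2 C i k j l = contract3 f (fun k l => (η (k, l) : C.Γ)) i k j l := by
  obtain ⟨η, hθ, hη⟩ := exists_braided_basis hC
  let f : Matrix (Fin 3 × Fin 3 × Fin 3) (Fin 3 × Fin 3 × Fin 3) ℂ := Matrix.of fun r c =>
    η.repr ⟨theta2 C r.1 r.2.1 c.1 c.2.1, coL_theta2 C r.1 r.2.1 c.1 c.2.1⟩ (r.2.2, c.2.2)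
  have hf : ∀ i k j l, theta2 C i k j l
      = contract3 f (fun k l => (η (k, l) : C.Γ)) i k j l := fun i k j l => by
    have h := congrArg Subtype.val
      (η.sum_repr ⟨theta2 C i k j l, coL_theta2 C i k j l⟩)
    rw [Submodule.coe_sum, Fintype.sum_prod_type] at h
    exact h.symm
  refine ⟨η, hθ, f, mem_commutant_iff.2 fun i k a j l n => ?_, hf⟩
  have h1 : ∀ b, ∑ u, ∑ v, f (i, k, a) (u, v, b) • (z q u j * z q v l)
      = ∑ u, ∑ v, ∑ m, ∑ n, f (u, v, m) (j, l, n) •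
        (z q i u * z q k v * z q a m * Smat q n b) := fun b => by
    refine (basis_tmul_injective η (x := fun a b => ∑ u, ∑ v, ∑ m, ∑ n,
      f (u, v, m) (j, l, n) • (z q i u * z q k v * z q a m * Smat q n b))
      (y := fun a b => ∑ u, ∑ v, f (i, k, a) (u, v, b) • (z q u j * z q v l)) ?_ a b).symm
    have h := coR_theta2 C i k j l
    simp only [hf, contract3, map_sum, map_smul, hη, tensorActR_tmul, one_smul,
      TensorProduct.sum_tmul, ← mul_assoc] at h
    simp only [TensorProduct.tmul_sum, TensorProduct.tmul_smul]
    convert h using 1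
    · simp only [Finset.smul_sum]
      exact (Finset.sum_congr rfl fun _ _ => sum_rotate_five _).trans (sum_rotate_five _)
    · rw [sum_swap_pairs]
      rfl
  have h2 : ∀ (w : GLq q) n', ∑ b, w * Smat q n' b * z q b n = if n' = n then w else 0 :=
    fun w n' => by
      simp only [mul_assoc, ← Finset.mul_sum, Smat_mul_z q (NeZero.ne q), mul_ite, mul_one,
        mul_zero]
  calc ∑ u, ∑ v, ∑ b, f (i, k, a) (u, v, b) • (z q u j * z q v l * z q b n)
      = ∑ b, (∑ u, ∑ v, f (i, k, a) (u, v, b) • (z q u j * z q v l)) * z q b n := by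
        simp only [Finset.sum_mul, smul_mul_assoc]
        rw [sum_rotate_three, sum_rotate_three]
    _ = _ := by
        simp only [h1, Finset.sum_mul, smul_mul_assoc]
        rw [sum_rotate_four]
        refine Finset.sum_congr rfl fun u _ => Finset.sum_congr rfl fun v _ =>
          Finset.sum_congr rfl fun m _ => ?_
        rw [Finset.sum_comm]
        simp only [← Finset.smul_sum, h2]
        simp

/-- This is d applied to the quadratic relations, with the factors z z cancelled. -/
theorem theta2_braid {p c : ℂ} {s : Matrix (Fin 3 × Fin 3) (Fin 3 × Fin 3) ℂ}
    (hs : IsHeckeBraiding q p c s) : braidRows s (theta2 C) = braidCols s (theta2 C) := by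
  have h1 : ∀ ρ : C.Γ, ∀ i k a b, ∑ m, ∑ n, s (m, n) (a, b) • z q i m • z q k n • ρ
      = ∑ d, ∑ e, s (i, k) (d, e) • z q d a • z q e b • ρ := fun ρ i k a b => by
    have := congrArg (· • ρ) (hs.comm i k a b)
    simpa only [Finset.sum_smul, smul_assoc, mul_smul] using this.symm
  funext i k j l
  refine congrFun (congrFun (cancel_zz (Algebra.lsmul ℂ ℂ C.Γ : GLq q →ₐ[ℂ] Module.End ℂ C.Γ)
    (T := fun i k => braidRows s (theta2 C) i k j l)
    (T' := fun i k => braidCols s (theta2 C) i k j l) fun i k => ?_) i) k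
  have h2 := congrFun (congrFun (congrFun (congrFun (d_zz_braid (C := C) hs) i) k) j) l
  simp only [braidRows, braidCols, Algebra.lsmul_coe, d_zz_eq, Finset.smul_sum] at h2 ⊢
  simp only [smul_comm (z q _ _) (s _ _)]
  calc _ = ∑ a, ∑ b, ∑ m, ∑ n, s (m, n) (a, b) • z q i m • z q k n • theta2 C a b j l :=
        sum_swap_pairs _
    _ = ∑ a, ∑ b, ∑ m, ∑ n, s (i, k) (m, n) • z q m a • z q n b • theta2 C a b j l := by
        simp only [h1]
    _ = _ := by rw [sum_swap_pairs, h2, sum_swap_pairs]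

/-- The general form of the left- and right-covariant forms `S(z^i_m z^k_n) d(z^m_j z^n_l)`. -/
theorem exists_theta2_eq (hC : HasCoordinateBasis C) :
    ∃ η : Module.Basis (Fin 3 × Fin 3) ℂ C.inv,
      (∀ i j, theta C i j = contract2 (braiding q) (fun k l => (η (k, l) : C.Γ)) i j) ∧
      ∃ c0 c1 a b : ℂ, ∀ i k j l, theta2 C i k j l
        = contract3 (heckeElement q c0 c1 a b b (a + b * (q - q⁻¹)))
          (fun k l => (η (k, l) : C.Γ)) i k j l := by
  obtain ⟨η, hθ, f, hf, hf2⟩ := exists_commutant hC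
  refine ⟨η, hθ, ?_⟩
  have hs := isHeckeBraiding_braiding q (NeZero.ne q)
  -- As η is a basis, a matrix on three legs is determined by its contraction; invariance of
  -- `theta2` under σ thus becomes commutation of f with σ₁₂.
  have hinj : ∀ f g : Matrix (Fin 3 × Fin 3 × Fin 3) (Fin 3 × Fin 3 × Fin 3) ℂ,
      (∀ i k j l, contract3 f (fun k l => (η (k, l) : C.Γ)) i k j l
        = contract3 g (fun k l => (η (k, l) : C.Γ)) i k j l) → f = g := by
    intro f g h
    ext ⟨i, k, m⟩ ⟨j, l, n⟩
    have h1 : ∑ p : Fin 3 × Fin 3, f (i, k, p.1) (j, l, p.2) • η p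
        = ∑ p : Fin 3 × Fin 3, g (i, k, p.1) (j, l, p.2) • η p := by
      refine Subtype.ext ?_
      rw [Submodule.coe_sum, Submodule.coe_sum, Fintype.sum_prod_type, Fintype.sum_prod_type]
      exact h i k j l
    have h2 := congrArg (fun ρ => η.repr ρ (m, n)) h1
    simpa only [η.repr_sum_self] using h2
  have hcomm : leg12 (braiding q) * f = f * leg12 (braiding q) := hinj _ _ fun i k j l => by
    rw [contract3_leg12_mul, contract3_mul_leg12]
    have h := congrFun (congrFun (congrFun (congrFun (theta2_braid (C := C) hs) i) k) j) l
    simpa only [braidRows, braidCols, hf2] using h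
  obtain ⟨c0, c1, c2, c3, c4, c5, rfl⟩ := exists_heckeElement hf
  obtain ⟨rfl, rfl⟩ := heckeElement_comm hcomm
  exact ⟨c0, c1, c2, c3, hf2⟩

end Covariance

/-! ### Classification -/

section AdjointForm

variable {q : ℂ} [NeZero q] (C : BicovariantCalculus.{u} (GLq q))

/-- The array `δ^i_j θ^k_l`. -/
noncomputable def deltaTheta (i k j l : Fin 3) : C.Γ := if i = j then theta C k l else 0

variable {C} {p c : ℂ} {s : Matrix (Fin 3 × Fin 3) (Fin 3 × Fin 3) ℂ}

/-- The Leibniz rule splits d(zz) into (dz)z, which gives the adjoint action on θ, and z dz, which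
gives δθ. -/
theorem theta2_eq_adz (i k j l : Fin 3) :
    theta2 C i k j l = adz C k l (theta C i j) + deltaTheta C i k j l := by
  refine congrFun (congrFun (cancel_zz (Algebra.lsmul ℂ ℂ C.Γ : GLq q →ₐ[ℂ] Module.End ℂ C.Γ)
    (T := fun i k => theta2 C i k j l)
    (T' := fun i k => adz C k l (theta C i j) + deltaTheta C i k j l) fun i k => ?_) i) k
  simp only [Algebra.lsmul_coe, ← d_zz_eq, C.leibniz, smul_add, Finset.sum_add_distrib]
  congr 1
  · simp only [d_z_eq, Finset.smul_sum, ← smul_comm (z q i _) (MulOpposite.op (z q k l)),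
      smul_z_eq]
  · simp only [deltaTheta, d_z_eq, smul_ite, smul_zero, Finset.smul_sum, Finset.sum_ite_irrel,
      Finset.sum_const_zero, Finset.sum_ite_eq', Finset.mem_univ, if_true]

/-- The contraction of σ₂₃ with η is δθ, and factors σ₁₂ become row and column actions on it. The
terms 1 and σ₁₂ contract to the trace of η, which is q⁻⁵ Tr_q θ; hence the factors (q⁵)⁻¹ in x and
y. -/
theorem exists_adz_eq (hC : HasCoordinateBasis C) : ∃ a b x y : ℂ, ∀ i k j l,
    adz C k l (theta C i j) = (a - 1) • deltaTheta C i k j l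
      + b • (braidRows (braiding q) (deltaTheta C) i k j l
        + braidCols (braiding q) (deltaTheta C) i k j l)
      + (a + b * (q - q⁻¹)) •
        braidCols (braiding q) (braidRows (braiding q) (deltaTheta C)) i k j l
      + (x * (if i = j ∧ k = l then 1 else 0) + y * braiding q (i, k) (j, l)) • traceQ C := by
  have hq := NeZero.ne q
  obtain ⟨η, hθ, c0, c1, a, b, h⟩ := exists_theta2_eq hC
  have htr : traceQ C = q ^ 5 • ∑ m, (η (m, m) : C.Γ) := by
    simp only [traceQ_eq, hθ, contract2, Finset.smul_sum, smul_smul]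
    rw [sum_rotate_three]
    simp only [← Finset.sum_smul, braiding_trace q hq, ite_smul, zero_smul]
    simp
  refine ⟨a, b, c0 * (q ^ 5)⁻¹, c1 * (q ^ 5)⁻¹, fun i k j l => ?_⟩
  have h1 : contract3 1 (fun k l => (η (k, l) : C.Γ)) i k j l
      = (if i = j ∧ k = l then (1 : ℂ) else 0) • ∑ m, (η (m, m) : C.Γ) := by
    rw [← map_one leg12, contract3_leg12, Matrix.one_apply]
    simp only [Prod.mk.injEq]
  have h2 := h i k j l
  have h3 : ∀ i k j l, contract3 (leg23 (braiding q)) (fun k l => (η (k, l) : C.Γ)) i k j l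
      = deltaTheta C i k j l := fun i k j l => by
    rw [contract3_leg23, deltaTheta, hθ]
  simp only [theta2_eq_adz, heckeElement, contract3_add, contract3_smul, contract3_mul_leg12,
    contract3_leg12_mul, contract3_leg12, h1, h3] at h2
  rw [eq_sub_of_add_eq h2, htr]
  simp only [braidRows, braidCols]
  match_scalars <;> field_simp

/-- The relations of the adjoint action of the coordinates. -/
theorem isQMatrix_adz : IsQMatrix q fun i j => MulOpposite.op (adz C i j) := by
  refine (rtt_iff q (NeZero.ne q) _).1 (rtt_of_comm q fun i k j l => ?_)
  refine MulOpposite.unop_injective (LinearMap.ext fun ρ => ?_)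
  simp only [← MulOpposite.op_mul, ← MulOpposite.op_smul, ← Finset.op_sum,
    MulOpposite.unop_op, LinearMap.sum_apply, LinearMap.smul_apply, Module.End.mul_apply]
  have hs := isHeckeBraiding_braiding q (NeZero.ne q)
  refine congrFun (congrFun (cancel_zz (Algebra.lsmul ℂ ℂ C.Γ : GLq q →ₐ[ℂ] Module.End ℂ C.Γ)
    (T := fun i k => ∑ a, ∑ b, braiding q (i, k) (a, b) • adz C b l (adz C a j ρ))
    (T' := fun i k => ∑ a, ∑ b, braiding q (a, b) (j, l) • adz C k b (adz C i a ρ))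
    fun i k => ?_) i) k
  have h1 : ∀ ρ : C.Γ, ∀ a b, ∑ m, ∑ n, braiding q (m, n) (a, b) • z q i m • z q k n • ρ
      = ∑ d, ∑ e, braiding q (i, k) (d, e) • z q d a • z q e b • ρ := fun ρ a b => by
    have := congrArg (· • ρ) (hs.comm i k a b)
    simpa only [Finset.sum_smul, smul_assoc, mul_smul] using this.symm
  have h2 : ∀ i j k l, ρ <• (z q i j * z q k l)
      = ∑ m, ∑ n, z q i m • z q k n • adz C n l (adz C m j ρ) := fun i j k l => by
    rw [MulOpposite.op_mul, mul_smul, smul_z_eq C ρ]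
    simp only [Finset.smul_sum, ← smul_comm (z q i _) (MulOpposite.op (z q k l)), smul_z_eq]
  have h3 := congrArg (fun w => ρ <• w) (hs.comm i k j l)
  simp only [Finset.op_sum, Finset.sum_smul, MulOpposite.op_smul, smul_assoc, h2,
    Finset.smul_sum] at h3
  simp only [Algebra.lsmul_coe, Finset.smul_sum, smul_comm (z q _ _) (braiding q _ _)]
  rw [sum_swap_pairs]
  simp only [h1]
  rw [sum_swap_pairs, h3, sum_swap_pairs]

/-- The adjoint action is a right action of A, so its operators satisfy the relations of Z in
reversed order. Three of these relations, evaluated on suitable Maurer-Cartan forms, reduce to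
multiples of the nonzero form `theta C 2 0`; the coefficients are the three equations. -/
theorem adz_relations (hC : HasCoordinateBasis C) {a b e x y : ℂ} (he : e = a + b * (q - q⁻¹))
    (h : ∀ i k j l, adz C k l (theta C i j) = (a - 1) • deltaTheta C i k j l
      + b • (braidRows (braiding q) (deltaTheta C) i k j l
        + braidCols (braiding q) (deltaTheta C) i k j l)
      + e • braidCols (braiding q) (braidRows (braiding q) (deltaTheta C)) i k j l
      + (x * (if i = j ∧ k = l then 1 else 0) + y * braiding q (i, k) (j, l)) • traceQ C) :
    b * (b + e * (q - q⁻¹)) = 0 ∧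
    ((q ^ 4 + q ^ 2 + 1) * (a - 1) + 2 * b * q ^ 5 + e * (q - q⁻¹) * q ^ 5) * x
      = -((a - 1) * (e - 1)) ∧
    ((q ^ 4 + q ^ 2 + 1) * (a - 1) + 2 * b * q ^ 5 + e * (q - q⁻¹) * q ^ 5) * y
      = -(2 * b * (a - 1) + b ^ 2 * (q - q⁻¹) + e * (a - 1) * (q - q⁻¹)) := by
  have hq := NeZero.ne q
  have hθ : theta C 2 0 ≠ 0 := (linearIndependent_theta_complex hC).ne_zero (2, 0)
  have hz := isQMatrix_adz (C := C)
  have h1 := LinearMap.congr_fun (congrArg MulOpposite.unop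
    (hz.anti 1 2 1 0 (by decide) (by decide))) (theta C 2 2)
  have h2 := LinearMap.congr_fun (congrArg MulOpposite.unop
    (hz.diag 1 2 0 1 (by decide) (by decide))) (theta C 2 2)
  have h3 := LinearMap.congr_fun (congrArg MulOpposite.unop
    (hz.row 2 0 1 (by decide))) (theta C 1 2)
  simp only [MulOpposite.unop_mul, MulOpposite.unop_add, MulOpposite.unop_smul, MulOpposite.unop_op,
    LinearMap.add_apply, LinearMap.smul_apply, Module.End.mul_apply] at h1 h2 h3
  simp [h, braidRows_braiding, braidCols_braiding, deltaTheta, braiding_apply, Rmat, traceQ]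
    at h1 h2 h3
  have hb : b * (b + e * (q - q⁻¹)) = 0 := by
    have : (q * (b * (b + e * (q - q⁻¹)))) • theta C 2 0 = 0 := by
      linear_combination (norm := module) (-1 : ℂ) • h2
    exact (mul_eq_zero.1 ((smul_eq_zero.1 this).resolve_right hθ)).resolve_left hq
  refine ⟨hb, ?_, ?_⟩
  · have h4 : ((a - 1) ^ 2 + (a - 1) * (b * (q - q⁻¹)) + x * ((q ^ 4 + q ^ 2 + 1) * (a - 1)
        + b * (q ^ 4 * (q - q⁻¹) + q ^ 5 + q ^ 2 * (q - q⁻¹) + q)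
        + e * (q - q⁻¹) * q ^ 5)) • theta C 2 0 = 0 := by
      linear_combination (norm := module) h1
    have h5 := (smul_eq_zero.1 h4).resolve_right hθ
    have h6 : q ^ 4 * (q - q⁻¹) + q ^ 5 + q ^ 2 * (q - q⁻¹) + q = 2 * q ^ 5 := by
      field_simp; ring
    rw [h6] at h5
    linear_combination h5 + (a - 1) * he
  · have h4 : (q * (2 * b * (a - 1) + b ^ 2 * (q - q⁻¹) + e * (a - 1) * (q - q⁻¹)
        + y * ((q ^ 4 + q ^ 2 + 1) * (a - 1)
        + b * (q ^ 4 * (q - q⁻¹) + q ^ 5 + q ^ 2 * (q - q⁻¹) + q)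
        + e * (q - q⁻¹) * q ^ 5)) + (q ^ 2 - 1) * (b * (b + e * (q - q⁻¹)))) • theta C 2 0 = 0 := by
      linear_combination (norm := module) (-1 : ℂ) • h3
    have h5 := (smul_eq_zero.1 h4).resolve_right hθ
    have h6 : q ^ 4 * (q - q⁻¹) + q ^ 5 + q ^ 2 * (q - q⁻¹) + q = 2 * q ^ 5 := by
      field_simp; ring
    rw [h6, hb, mul_zero, add_zero] at h5
    have h7 := (mul_eq_zero.1 h5).resolve_left hq
    linear_combination h7

/-- The parameters of a calculus given by a braiding are non-degenerate. -/
theorem ne_zero_of_adz_theta (hC : HasCoordinateBasis C) {t x y : ℂ} (hp : p ≠ 0) (hc : c ≠ 0)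
    (h : ∀ i k j l, adz C k l (theta C i j) = adTheta s t x y C i k j l)
    (hx : heckeMu q p c t * x = -(t - 1) ^ 2) (hy : heckeMu q p c t * y = -(p * t * (t - 1))) :
    t ≠ 0 ∧ heckeMu q p c t ≠ 0 := by
  -- If μ = 0, the equation for x forces t = 1, but then μ = pc ≠ 0.
  have hμ : heckeMu q p c t ≠ 0 := by
    intro h0
    rw [h0, zero_mul, eq_comm, neg_eq_zero, sq_eq_zero_iff, sub_eq_zero] at hx
    rw [hx, heckeMu] at h0
    simp [hp, hc] at h0
  refine ⟨?_, hμ⟩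
  rintro rfl
  have hy0 : y = 0 := by simpa [hμ] using hy
  -- For t = 0 an off-diagonal θ is annihilated by right multiplication with every z, although Z is
  -- invertible.
  have h1 : ∀ k l, theta C 0 2 <• z q k l = 0 := fun k l => by
    rw [smul_z_eq]
    simp [h, adTheta, hy0]
  refine (linearIndependent_theta_complex hC).ne_zero (0, 2) ?_
  have h2 : theta C 0 2 <• (∑ k, z q 0 k * Smat q k 0) = 0 := by
    simp [Finset.op_sum, Finset.sum_smul, mul_smul, h1]
  rw [z_mul_Smat q (NeZero.ne q)] at h2
  simpa using h2

/-- The classification of the bicovariant calculi. -/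
theorem exists_isGamma (hq : q - q⁻¹ ≠ 0) (hC : HasCoordinateBasis C) :
    (∃ t, Admissible1 q t ∧ IsGamma1 C t) ∨ (∃ t, Admissible2 q t ∧ IsGamma2 C t) := by
  have hq0 := NeZero.ne q
  obtain ⟨a, b, x, y, h⟩ := exists_adz_eq hC
  generalize he : a + b * (q - q⁻¹) = e at h
  obtain ⟨hb, hx, hy⟩ := adz_relations hC he.symm h
  -- For b = 0 only δθ and its image under both copies of σ survive, so s = σ with t = a.
  rcases mul_eq_zero.1 hb with rfl | hb
  · right
    rw [zero_mul, add_zero] at he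
    subst he
    have hμ : (q ^ 4 + q ^ 2 + 1) * (a - 1) + 2 * 0 * q ^ 5 + a * (q - q⁻¹) * q ^ 5
        = heckeMu q (q - q⁻¹) (q ^ 5) a := by rw [heckeMu]; ring
    rw [hμ] at hx hy
    have hx' : heckeMu q (q - q⁻¹) (q ^ 5) a * x = -(a - 1) ^ 2 := by rw [hx]; ring
    have hy' : heckeMu q (q - q⁻¹) (q ^ 5) a * y = -((q - q⁻¹) * a * (a - 1)) := by rw [hy]; ring
    have h' : ∀ i k j l, adz C k l (theta C i j) = adTheta (braiding q) a x y C i k j l :=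
      fun i k j l => by
        rw [h, zero_smul, add_zero]
        rfl
    obtain ⟨ht, hμ0⟩ := ne_zero_of_adz_theta hC hq (pow_ne_zero 5 hq0) h' hx' hy'
    refine ⟨a, (admissible2_iff hq0).2 ⟨ht, hμ0⟩, isGamma2_iff_adz.2 ?_⟩
    obtain ⟨hx2, hy2⟩ := heckeMu_mul2 hq0 hμ0
    rwa [mul_left_cancel₀ hμ0 (hx2.trans hx'.symm), mul_left_cancel₀ hμ0 (hy2.trans hy'.symm)]
  · left
    -- Now the coefficients are those obtained by expanding σ⁻¹ = σ - λ in both actions, so s = σ⁻¹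
    -- with t = e; the same substitution in yσ⁻¹ shifts x to x + λy.
    obtain rfl : b = -(e * (q - q⁻¹)) := eq_neg_of_add_eq_zero_left hb
    obtain rfl : a = e + e * (q - q⁻¹) ^ 2 := by linear_combination he
    have hμ : (q ^ 4 + q ^ 2 + 1) * (e + e * (q - q⁻¹) ^ 2 - 1) + 2 * -(e * (q - q⁻¹)) * q ^ 5
        + e * (q - q⁻¹) * q ^ 5 = heckeMu q (-(q - q⁻¹)) q⁻¹ e := by
      rw [heckeMu]; field_simp; ring
    rw [hμ] at hx hy
    have hy' : heckeMu q (-(q - q⁻¹)) q⁻¹ e * y = -(-(q - q⁻¹) * e * (e - 1)) := by rw [hy]; ring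
    have hx' : heckeMu q (-(q - q⁻¹)) q⁻¹ e * (x + (q - q⁻¹) * y) = -(e - 1) ^ 2 := by
      rw [mul_add, mul_left_comm, hx, hy]; ring
    have h' : ∀ i k j l, adz C k l (theta C i j)
        = adTheta (braidingInv q) e (x + (q - q⁻¹) * y) y C i k j l := fun i k j l => by
      have h1 : adTheta (braidingInv q) e (x + (q - q⁻¹) * y) y C i k j l
          = (e - 1) • deltaTheta C i k j l
            + e • braidCols (braidingInv q) (braidRows (braidingInv q) (deltaTheta C)) i k j l
            + ((x + (q - q⁻¹) * y) * (if i = j ∧ k = l then 1 else 0)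
              + y * braidingInv q (i, k) (j, l)) • traceQ C := rfl
      have h2 : braidingInv q (i, k) (j, l)
          = braiding q (i, k) (j, l) - (q - q⁻¹) * if i = j ∧ k = l then 1 else 0 := by
        rw [braidingInv, Matrix.sub_apply, Matrix.smul_apply, Matrix.one_apply, smul_eq_mul]
        simp only [Prod.mk.injEq]
      rw [h, h1, h2, braidingInv_eq]
      simp only [braidRows_add_matrix, braidCols_add_matrix, braidRows_smul_matrix,
        braidCols_smul_matrix, braidRows_one, braidCols_one, braidCols_add, braidCols_smul,
        Pi.add_apply, Pi.smul_apply]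
      module
    obtain ⟨ht, hμ0⟩ := ne_zero_of_adz_theta hC (neg_ne_zero.2 hq) (inv_ne_zero hq0) h' hx' hy'
    refine ⟨e, (admissible1_iff hq0).2 ⟨ht, hμ0⟩, isGamma1_iff_adz.2 ?_⟩
    obtain ⟨hx2, hy2⟩ := heckeMu_mul1 hq0 hμ0
    -- As μ ≠ 0, the equations for x and y have a unique solution, which is the one given by the
    -- coefficients of Γ_1.
    rwa [mul_left_cancel₀ hμ0 (hx2.trans hx'.symm), mul_left_cancel₀ hμ0 (hy2.trans hy'.symm)]

end AdjointForm

end QuantumGL3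

theorem mainTheorem3 (q : ℂ) [NeZero q] (hq1 : q ≠ 1) (hq2 : q ≠ -1) (hq3 : q ≠ Complex.I)
    (hq4 : q ≠ -Complex.I) :
    (∀ C : BicovariantCalculus.{u} (GLq q), HasCoordinateBasis C →
      (∃ t, Admissible1 q t ∧ IsGamma1 C t) ∨ (∃ t, Admissible2 q t ∧ IsGamma2 C t)) ∧
    (∀ t, Admissible1 q t →
      (∃ C : BicovariantCalculus.{u} (GLq q), HasCoordinateBasis C ∧ IsGamma1 C t) ∧
      IsUnit (U1 q t) ∧
      ∀ C : BicovariantCalculus.{u} (GLq q), HasCoordinateBasis C → IsGamma1 C t →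
        ∃ ω : Module.Basis (Fin 3 × Fin 3) ℂ C.inv,
          (∀ i j, theta C i j = ∑ k, ∑ l, U1 q t (i, j) (k, l) • (ω (k, l) : C.Γ)) ∧
          RMatrixRelations1 C t (fun i j => (ω (i, j) : C.Γ)) ∧
          ∀ cp cm : ℂ, cp ≠ 0 → cm ≠ 0 → t = cm / cp →
            ∃ Lp Lm : GLq q →ₐ[ℂ] Matrix (Fin 3) (Fin 3) ℂ,
              IsLFunctional (Rplus q cp) Lp ∧ IsLFunctional (Rminus q cm) Lm ∧
              IsJurco C Lp Lm (fun i j => (ω (i, j) : C.Γ))) ∧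
    (∀ t, Admissible2 q t →
      (∃ C : BicovariantCalculus.{u} (GLq q), HasCoordinateBasis C ∧ IsGamma2 C t) ∧
      IsUnit (U2 q t) ∧
      ∀ C : BicovariantCalculus.{u} (GLq q), HasCoordinateBasis C → IsGamma2 C t →
        ∃ ω : Module.Basis (Fin 3 × Fin 3) ℂ C.inv,
          (∀ i j, theta C i j = ∑ k, ∑ l, U2 q t (i, j) (k, l) • (ω (k, l) : C.Γ)) ∧
          RMatrixRelations2 C t (fun i j => (ω (i, j) : C.Γ)) ∧
          ∀ cp cm : ℂ, cp ≠ 0 → cm ≠ 0 → t = cp / cm →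
            ∃ Lp Lm : GLq q →ₐ[ℂ] Matrix (Fin 3) (Fin 3) ℂ,
              IsLFunctional (Rplus q cp) Lp ∧ IsLFunctional (Rminus q cm) Lm ∧
              IsJurco C Lm Lp (fun i j => (ω (i, j) : C.Γ))) := by
  have hq := sub_inv_ne_zero (NeZero.ne q) hq1 hq2
  exact ⟨fun C hC => exists_isGamma hq hC, fun t ht => gamma1_properties hq ht,
    fun t ht => gamma2_properties hq ht⟩
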